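/- Let $n\ge 3$ and $I=(-1,1)$. An *ovaloid* in $\mathbb R^{n-1}$ is a compact connected embedded smooth hypersurface without boundary all of whose principal curvatures with respect to the outer unit normal $N$ (the one pointing into the unbounded component of the complement; $dN(v)=\kappa v$) are positive. A map $\gamma:\mathbb S^{n-2}\to\mathbb R^{n-1}$ *support-parametrizes* a set $\mathcal O\subset\mathbb R^{n-1}$ if $\mathcal O$ is an ovaloid and $\gamma$ is the inverse of its Gauss map $N:\mathcal O\to\mathbb S^{n-2}$. A *transversely convex tube in standard position* is the image $\mathcal T\subset\mathbb R^{n-1}\times\mathbb R$ of a smooth embedding $X:\mathbb S^{n-2}\times I\to\mathbb R^{n-1}\times\mathbb R$ of the form $X(u,z)=(c(z)+\alpha(u,z),z)$, where $c:I\to\mathbb R^{n-1}$ and $\alpha:\mathbb S^{n-2}\times I\to\mathbb R^{n-1}$ are smooth and, for each $z\in I$, $\alpha(\mathbb S^{n-2},z)$ is an ovaloid with center of mass (as a hypersurface) at the origin. Let $\mathcal T$ be a bounded transversely convex tube in standard position. For $z\in I$ put $\mathcal O(z)=\{p\in\mathbb R^{n-1}:(p,z)\in\mathcal T\}$. Then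 there is a unique map $\Gamma:\mathbb S^{n-2}\times I\to\mathbb R^{n-1}$ (the *support map* of $\mathcal T$) such that $\Gamma(\cdot,z)$ support-parametrizes $\mathcal O(z)$ for every $z\in I$, and $\Gamma$ is smooth. For $z_0\in I$, $\tau\in\mathbb S^{n-2}$ and $\epsilon\in\mathbb R$ let $$\mathcal O_\tau(z_0,\epsilon)=\{p\in\mathbb R^{n-1}: (p,z)\in\mathcal T \text{ for } z=z_0+\epsilon\,(p\cdot\tau)\}$$ be the projection to $\mathbb R^{n-1}$ of the tilted slice of $\mathcal T$, and let $\tau^{T}(u)=\tau-(\tau\cdot u)u$ be the tangential part of $\tau$ at $u\in\mathbb S^{n-2}$. Then for every $z_0\in I$ and $\tau\in\mathbb S^{n-2}$ there are $\delta>0$, a smooth function $z:(-\delta,\delta)\times\mathbb S^{n-2}\to I$ with $z(0,\cdot)\equiv z_0$ such that, for all $|\epsilon|<\delta$ and $u\in\mathbb S^{n-2}$, $z(\epsilon,u)$ is the unique $z\in I$ with $z=z_0+\epsilon\,\tau\cdot\Gamma(u,z)$, and diffeomorphisms $\theta_\epsilon:\mathbb S^{n-2}\to\mathbb S^{n-2}$,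 $|\epsilon|<\delta$, with $(\epsilon,u)\mapsto\theta_\epsilon(u)$ smooth, such that 1. for every $|\epsilon|<\delta$ the map $u\mapsto\Gamma\bigl(\theta_\epsilon(u),z(\epsilon,\theta_\epsilon(u))\bigr)$ support-parametrizes $\mathcal O_\tau(z_0,\epsilon)$; 2. $\theta_0=\mathrm{id}$; 3. $\displaystyle\frac{\partial\theta_\epsilon}{\partial\epsilon}(u)\Big|_{\epsilon=0}=\Bigl(u\cdot\frac{\partial\Gamma}{\partial z}(u,z_0)\Bigr)\,\tau^{T}(u)$ for every $u\in\mathbb S^{n-2}$. -/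

import Mathlib

open scoped Manifold ContDiff

noncomputable section

namespace ConvexTube

/-- Euclidean space `ℝ^(d+1)`; with `n = d + 2` this is `ℝ^(n-1)`. -/
abbrev Euc (d : ℕ) : Type := EuclideanSpace ℝ (Fin (d + 1))

/-- The unit sphere `𝕊^d = 𝕊^(n-2)` of `ℝ^(d+1)`, with Mathlib's manifold structure. -/
abbrev Sph (d : ℕ) : Type := Metric.sphere (0 : EuclideanSpace ℝ (Fin (d + 1))) 1

/-- The open interval `I = (-1, 1)`. -/
abbrev I : Set ℝ := Set.Ioo (-1) 1

/-- The union of the unbounded connected components of the complement of `O`. -/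
def exterior {d : ℕ} (O : Set (Euc d)) : Set (Euc d) :=
  {x | x ∉ O ∧ ¬ Bornology.IsBounded (connectedComponentIn Oᶜ x)}

/-- The function `f` exhibits `O` near `p` as a regular smooth level hypersurface `f = 0`, with
`f > 0` exactly on the unbounded side. -/
structure IsOutwardDefiningFunction {d : ℕ} (O : Set (Euc d)) (p : Euc d)
    (U : Set (Euc d)) (f : Euc d → ℝ) : Prop where
  isOpen : IsOpen U
  mem : p ∈ U
  smooth : ContDiffOn ℝ ∞ f U
  regular : ∀ x ∈ U, gradient f x ≠ 0
  mem_iff : ∀ x ∈ U, x ∈ O ↔ f x = 0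
  exterior_iff : ∀ x ∈ U, x ∈ exterior O ↔ 0 < f x

/-- The normalized gradient of `f`. -/
def unitNormal {d : ℕ} (f : Euc d → ℝ) (x : Euc d) : Euc d :=
  ‖gradient f x‖⁻¹ • gradient f x

/-- `u` is the outer unit normal of the hypersurface `O` at the point `p`. -/
def IsOuterUnitNormal {d : ℕ} (O : Set (Euc d)) (p u : Euc d) : Prop :=
  p ∈ O ∧ ∃ U f, IsOutwardDefiningFunction O p U f ∧ u = unitNormal f p

/-- `κ` is a principal curvature of the hypersurface `O` at `p` with respect to the outer unit
normal field `N`: there is a tangent vector `v ≠ 0` with `dN(v) = κ v`. -/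
def IsPrincipalCurvature {d : ℕ} (O : Set (Euc d)) (p : Euc d) (κ : ℝ) : Prop :=
  p ∈ O ∧ ∃ U f, IsOutwardDefiningFunction O p U f ∧
    ∃ v : Euc d, v ≠ 0 ∧ inner ℝ (gradient f p) v = 0 ∧
      fderiv ℝ (unitNormal f) p v = κ • v

/-- An ovaloid: a closed (compact, connected, boundaryless) embedded smooth hypersurface of
`ℝ^(d+1)` all of whose principal curvatures with respect to the outer unit normal are positive. -/
structure IsOvaloid {d : ℕ} (O : Set (Euc d)) : Prop where
  isCompact : IsCompact O
  isConnected : IsConnected O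
  hypersurface : ∀ p ∈ O, ∃ U f, IsOutwardDefiningFunction O p U f
  curvature_pos : ∀ p κ, IsPrincipalCurvature O p κ → 0 < κ

/-- `γ` is the support parametrization of the ovaloid `O`: the inverse of its Gauss map. -/
structure IsSupportParametrization {d : ℕ} (γ : Sph d → Euc d) (O : Set (Euc d)) : Prop where
  isOvaloid : IsOvaloid O
  range_eq : Set.range γ = O
  normal : ∀ u : Sph d, IsOuterUnitNormal O (γ u) u

/-- The inverse of the Gauss map of `O`: the point of `O` at which the outer unit normal is `u`. -/
def gaussInverse {d : ℕ} (O : Set (Euc d)) (u : Sph d) : Euc d :=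
  Classical.epsilon fun p => IsOuterUnitNormal O p u

/-- The map `X(u, z) = (c(z) + α(u, z), z)`. -/
def tubeMap {d : ℕ} (c : ℝ → Euc d) (α : Sph d × ℝ → Euc d) (q : Sph d × ℝ) : Euc d × ℝ :=
  (c q.2 + α q, q.2)

/-- The restriction of `X` to `𝕊^d × I` is a smooth embedding: it is smooth, has injective
differentials, and is a homeomorphism onto its image. -/
structure IsEmbeddingOnTube {d : ℕ} (X : Sph d × ℝ → Euc d × ℝ) : Prop where
  smooth : ContMDiffOn ((𝓡 d).prod 𝓘(ℝ, ℝ)) 𝓘(ℝ, Euc d × ℝ) ∞ X (Set.univ ×ˢ I)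
  immersion : ∀ q ∈ (Set.univ : Set (Sph d)) ×ˢ I,
    Function.Injective (mfderiv ((𝓡 d).prod 𝓘(ℝ, ℝ)) 𝓘(ℝ, Euc d × ℝ) X q)
  embedding : Topology.IsEmbedding (((Set.univ : Set (Sph d)) ×ˢ I).domRestrict X)

open MeasureTheory in
/-- `T` is a transversely convex tube in standard position in `ℝ^(d+1) × ℝ`. The centre of mass
of the hypersurface `α(𝕊^d, z)` is taken with respect to its `d`-dimensional area. -/
def IsTransverselyConvexTube {d : ℕ} (T : Set (Euc d × ℝ)) : Prop :=
  ∃ (c : ℝ → Euc d) (α : Sph d × ℝ → Euc d),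
    ContDiffOn ℝ ∞ c I ∧
    ContMDiffOn ((𝓡 d).prod 𝓘(ℝ, ℝ)) 𝓘(ℝ, Euc d) ∞ α (Set.univ ×ˢ I) ∧
    IsEmbeddingOnTube (tubeMap c α) ∧
    (∀ z ∈ I, IsOvaloid (Set.range fun u => α (u, z)) ∧
      ∫ x in Set.range (fun u => α (u, z)), x ∂(Measure.hausdorffMeasure (d : ℝ)) = 0) ∧
    T = tubeMap c α '' (Set.univ ×ˢ I)

/-- The horizontal cross-section of `T` at height `z`, as a subset of `ℝ^(d+1)`. -/
def horizontalSlice {d : ℕ} (T : Set (Euc d × ℝ)) (z : ℝ) : Set (Euc d) :=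
  {p | (p, z) ∈ T}

/-- The support map `Γ(u, z)` of `T`: for each `z`, the inverse of the Gauss map of the horizontal
cross-section at height `z`. -/
def supportMap {d : ℕ} (T : Set (Euc d × ℝ)) (u : Sph d) (z : ℝ) : Euc d :=
  gaussInverse (horizontalSlice T z) u

/-- The hyperplane `z = z₀ + ε (p · τ)`. -/
def tiltedHyperplane {d : ℕ} (τ : Sph d) (z₀ ε : ℝ) : Set (Euc d × ℝ) :=
  {q | q.2 = ε * inner ℝ q.1 (τ : Euc d) + z₀}

/-- The projection `O_τ(z₀, ε)` to `ℝ^(d+1)` of the tilted cross-section of `T`. -/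
def projectedSlice {d : ℕ} (T : Set (Euc d × ℝ)) (τ : Sph d) (z₀ ε : ℝ) : Set (Euc d) :=
  Prod.fst '' (T ∩ tiltedHyperplane τ z₀ ε)

/-- The orthogonal projection of `τ` to the tangent space of the sphere at `u`. -/
def tangentialPart {d : ℕ} (τ u : Sph d) : Euc d :=
  (τ : Euc d) - inner ℝ (τ : Euc d) (u : Euc d) • (u : Euc d)

/-- `ζ` is the smooth height function on `(-δ, δ) × 𝕊^d`: `ζ(0, u) = z₀`, and `z = ζ(ε, u)` is the
only solution in `I` of `z = z₀ + ε τ · Γ(u, z)`. -/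
structure IsHeightFunction {d : ℕ} (T : Set (Euc d × ℝ)) (τ : Sph d) (z₀ δ : ℝ)
    (ζ : ℝ → Sph d → ℝ) : Prop where
  smooth : ContMDiffOn (𝓘(ℝ, ℝ).prod (𝓡 d)) 𝓘(ℝ, ℝ) ∞
    (fun q : ℝ × Sph d => ζ q.1 q.2) (Set.Ioo (-δ) δ ×ˢ Set.univ)
  zero : ∀ u, ζ 0 u = z₀
  mem : ∀ ε ∈ Set.Ioo (-δ) δ, ∀ u, ζ ε u ∈ I
  solves_iff : ∀ ε ∈ Set.Ioo (-δ) δ, ∀ u, ∀ z ∈ I,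
    z - z₀ - ε * inner ℝ (τ : Euc d) (supportMap T u z) = 0 ↔ z = ζ ε u

end ConvexTube

end

open ConvexTube

/-!
A compact connected hypersurface of positive curvature is, near each of its points, the boundary of
a strictly convex set, hence it bounds a strictly convex body, and the inverse of its Gauss map
sends `u` to the point where `⟪u, ·⟫` is maximal. Extended to `ℝ^(d+1) \ {0}` as a function
homogeneous of degree zero, this inverse is a smooth map `γ` such that `dγ_y` takes values in `yᗮ`
and is positive definite there; conversely every such `γ` parametrizes an ovaloid by its normals.

Applied to the horizontal sections of the tube this gives `Γ`. At the point of the tilted section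
where the horizontal normal is `u`, the projected section has the normal `u - ε ⟪u, ∂Γ/∂z⟫ τ`, where
`∂Γ/∂z` is taken at the height `ζ(ε, u)`. This is a displacement of `u` along the fixed direction
`τ`, so it is inverted by a displacement `u + σ(ε, u) τ` whose size `σ` solves a scalar
fixed-point problem. Normalizing the latter displacement yields `θ_ε`. Since positivity of `dγ` is
an open condition and the sphere is compact, the projected sections remain ovaloids for small `ε`;
the derivative of the normalization at `ε = 0` turns `τ` into its tangential part.
-/

namespace ConvexTube

open Topology Set Filter

section LocalConvexity

variable {E : Type*} [AddCommGroup E] [Module ℝ E] [TopologicalSpace E]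

/-- A set that is strictly convex near each of its points. A compact set bounded by a hypersurface
of positive curvature is of this kind, and a closed connected set of this kind is convex. -/
def IsLocallyStrictConvex (K : Set E) : Prop :=
  ∀ q ∈ K, ∃ U ∈ 𝓝 q, StrictConvex ℝ (K ∩ U)

variable [IsTopologicalAddGroup E] [ContinuousSMul ℝ E] {K A : Set E} {a b : E}

namespace IsLocallyStrictConvex

theorem openSegment_subset_interior_of_segment_subset (hK : IsLocallyStrictConvex K)
    (hab : a ≠ b) (hseg : segment ℝ a b ⊆ K) : openSegment ℝ a b ⊆ interior K := by
  rw [openSegment_eq_image_lineMap]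
  rintro _ ⟨t, ht, rfl⟩
  rw [segment_eq_image_lineMap] at hseg
  obtain ⟨U, hU, hKU⟩ := hK _ (hseg ⟨t, Ioo_subset_Icc_self ht, rfl⟩)
  have hlineU : ∀ᶠ s : ℝ in 𝓝 t, AffineMap.lineMap a b s ∈ U :=
    AffineMap.lineMap_continuous.continuousAt.eventually hU
  obtain ⟨r, hr, hrU⟩ := Metric.eventually_nhds_iff_ball.1
    (hlineU.and (isOpen_Ioo.eventually_mem ht))
  have hmem : ∀ s ∈ Metric.ball t r, AffineMap.lineMap a b s ∈ K ∩ U := fun s hs =>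
    ⟨hseg ⟨s, Ioo_subset_Icc_self (hrU s hs).2, rfl⟩, (hrU s hs).1⟩
  have hleft : t - r / 2 ∈ Metric.ball t r := by
    rw [Real.ball_eq_Ioo]; constructor <;> linarith
  have hright : t + r / 2 ∈ Metric.ball t r := by
    rw [Real.ball_eq_Ioo]; constructor <;> linarith
  have hne : AffineMap.lineMap a b (t - r / 2) ≠ AffineMap.lineMap a b (t + r / 2) :=
    (AffineMap.lineMap_injective ℝ hab).ne (by linarith)
  have hmid : AffineMap.lineMap a b t ∈ openSegment ℝ
      (AffineMap.lineMap a b (t - r / 2)) (AffineMap.lineMap a b (t + r / 2)) := by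
    refine ⟨1 / 2, 1 / 2, by norm_num, by norm_num, by norm_num, ?_⟩
    simp only [AffineMap.lineMap_apply_module]
    module
  exact interior_mono inter_subset_left
    (hKU.openSegment_subset (hmem _ hleft) (hmem _ hright) hne hmid)

theorem eventually_lineMap_mem_of_eq_zero (hK : IsLocallyStrictConvex K) (hab : a ≠ b)
    (hseg : segment ℝ a b ⊆ K) :
    ∀ᶠ q : (E × E) × ℝ in 𝓝 ((a, b), 0), q.1.1 ∈ K → 0 ≤ q.2 →
      AffineMap.lineMap q.1.1 q.1.2 q.2 ∈ K := by
  obtain ⟨U, hU, hKU⟩ := hK a (hseg (left_mem_segment ℝ a b))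
  have hlineU : ∀ᶠ s : ℝ in 𝓝 0, AffineMap.lineMap a b s ∈ interior U :=
    AffineMap.lineMap_continuous.continuousAt.eventually (isOpen_interior.eventually_mem
      (by rwa [AffineMap.lineMap_apply_zero, mem_interior_iff_mem_nhds]))
  obtain ⟨s, hsU, hs⟩ :=
    ((hlineU.filter_mono nhdsWithin_le_nhds).and (Ioo_mem_nhdsGT zero_lt_one)).exists
  have hsK : AffineMap.lineMap a b s ∈ interior K :=
    hK.openSegment_subset_interior_of_segment_subset hab hseg
      (openSegment_eq_image_lineMap ℝ a b ▸ mem_image_of_mem _ hs)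
  have hlineMap : ContinuousAt (fun q : (E × E) × ℝ => AffineMap.lineMap q.1.1 q.1.2 s)
      ((a, b), 0) := by
    simp only [AffineMap.lineMap_apply_module]; fun_prop
  filter_upwards [hlineMap.eventually (isOpen_interior.eventually_mem hsK),
    hlineMap.eventually (mem_interior_iff_mem_nhds.1 hsU), continuousAt_fst.fst.eventually hU,
    continuousAt_snd.eventually (gt_mem_nhds hs.1)] with q hqK hqU hqaU hqs hqa hq0
  have hmem := hKU.convex.lineMap_mem ⟨hqa, hqaU⟩ ⟨interior_subset hqK, hqU⟩
    ⟨div_nonneg hq0 hs.1.le, (div_le_one hs.1).2 hqs.le⟩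
  rw [AffineMap.lineMap_lineMap_right, div_mul_cancel₀ _ hs.1.ne'] at hmem
  exact hmem.1

theorem eventually_lineMap_mem (hK : IsLocallyStrictConvex K) (hseg : segment ℝ a b ⊆ K)
    {t : ℝ} (ht : t ∈ Icc (0 : ℝ) 1) :
    ∀ᶠ q : (E × E) × ℝ in 𝓝 ((a, b), t), q.1.1 ∈ K → q.1.2 ∈ K → q.2 ∈ Icc (0 : ℝ) 1 →
      AffineMap.lineMap q.1.1 q.1.2 q.2 ∈ K := by
  obtain rfl | hab := eq_or_ne a b
  · obtain ⟨U, hU, hKU⟩ := hK a (hseg (left_mem_segment ℝ a a))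
    filter_upwards [continuousAt_fst.fst.eventually hU, continuousAt_fst.snd.eventually hU]
      with q hq₁ hq₂ hqa hqb hqt
    exact (hKU.convex.lineMap_mem ⟨hqa, hq₁⟩ ⟨hqb, hq₂⟩ hqt).1
  obtain rfl | ht0 := ht.1.eq_or_lt
  · filter_upwards [hK.eventually_lineMap_mem_of_eq_zero hab hseg] with q hq hqa _ hqt
    exact hq hqa hqt.1
  obtain rfl | ht1 := ht.2.eq_or_lt
  · have hswap : Tendsto (fun q : (E × E) × ℝ => (q.1.swap, 1 - q.2)) (𝓝 ((a, b), 1))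
        (𝓝 ((b, a), 0)) := by
      have hcont : Continuous fun q : (E × E) × ℝ => (q.1.swap, 1 - q.2) := by fun_prop
      simpa using hcont.tendsto ((a, b), 1)
    filter_upwards [hswap.eventually (hK.eventually_lineMap_mem_of_eq_zero hab.symm
      (segment_symm ℝ a b ▸ hseg))] with q hq _ hqb hqt
    have hmem := hq hqb (sub_nonneg.2 hqt.2)
    rwa [Prod.fst_swap, Prod.snd_swap, AffineMap.lineMap_apply_one_sub] at hmem
  have hmem : AffineMap.lineMap a b t ∈ interior K :=
    hK.openSegment_subset_interior_of_segment_subset hab hseg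
      (openSegment_eq_image_lineMap ℝ a b ▸ mem_image_of_mem _ ⟨ht0, ht1⟩)
  have hlineMap : Continuous fun q : (E × E) × ℝ => AffineMap.lineMap q.1.1 q.1.2 q.2 := by
    simp only [AffineMap.lineMap_apply_module]; fun_prop
  filter_upwards [hlineMap.continuousAt.eventually (isOpen_interior.eventually_mem hmem)]
    with q hq _ _ _ using interior_subset hq

-- The pairs of points of `A` joined by a segment inside `K` form a clopen subset of `A × A`.
theorem segment_subset (hK : IsLocallyStrictConvex K) (hKc : IsClosed K)
    (hA : IsPreconnected A) (hAK : A ⊆ K) (ha : a ∈ A) (hb : b ∈ A) : segment ℝ a b ⊆ K := by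
  have : PreconnectedSpace A := isPreconnected_iff_preconnectedSpace.1 hA
  let S : Set (A × A) := {p | ∀ t ∈ Icc (0 : ℝ) 1, AffineMap.lineMap (p.1 : E) (p.2 : E) t ∈ K}
  have mem_S {p : A × A} : p ∈ S ↔ segment ℝ (p.1 : E) p.2 ⊆ K := by
    rw [segment_eq_image_lineMap, image_subset_iff]; rfl
  have hclosed : IsClosed S := by
    simp only [S, ofPred_forall, AffineMap.lineMap_apply_module]
    exact isClosed_biInter fun t _ => hKc.preimage (by fun_prop)
  have hopen : IsOpen S := by
    refine isOpen_iff_eventually.2 fun p hp => ?_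
    have hcoe : Continuous fun q : (A × A) × ℝ => (((q.1.1 : E), (q.1.2 : E)), q.2) := by fun_prop
    have hnear : ∀ᶠ q in 𝓝 p, ∀ t ∈ Icc (0 : ℝ) 1, t ∈ Icc (0 : ℝ) 1 →
        AffineMap.lineMap (q.1 : E) (q.2 : E) t ∈ K := by
      refine isCompact_Icc.eventually_forall_of_forall_eventually fun t ht => ?_
      filter_upwards [(hcoe.tendsto (p, t)).eventually (hK.eventually_lineMap_mem (mem_S.1 hp) ht)]
        with q hq using hq (hAK q.1.1.2) (hAK q.1.2.2)
    filter_upwards [hnear] with q hq t ht using hq t ht ht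
  have hdiag : (⟨a, ha⟩, ⟨a, ha⟩) ∈ S := mem_S.2 (by simpa using hAK ha)
  have huniv : S = univ := IsClopen.eq_univ ⟨hclosed, hopen⟩ ⟨_, hdiag⟩
  have hab : ((⟨a, ha⟩, ⟨b, hb⟩) : A × A) ∈ S := huniv ▸ mem_univ _
  exact mem_S.1 hab

theorem openSegment_subset_interior (hK : IsLocallyStrictConvex K) (hKc : IsClosed K)
    (hA : IsPreconnected A) (hAK : A ⊆ K) (ha : a ∈ A) (hb : b ∈ A) (hab : a ≠ b) :
    openSegment ℝ a b ⊆ interior K :=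
  hK.openSegment_subset_interior_of_segment_subset hab (hK.segment_subset hKc hA hAK ha hb)

end IsLocallyStrictConvex

end LocalConvexity

section SublevelSets

theorem lt_max_of_deriv_deriv_pos {g : ℝ → ℝ} {a b t : ℝ} (hg : ContinuousOn g (Icc a b))
    (hconvex : ∀ s ∈ Ioo a b, deriv g s = 0 → 0 < deriv (deriv g) s) (ht : t ∈ Ioo a b) :
    g t < max (g a) (g b) := by
  by_contra! hle
  obtain ⟨m, hm, hmax⟩ : ∃ m ∈ Ioo a b, IsMaxOn g (Icc a b) m := by
    obtain ⟨m, hm, hmax⟩ :=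
      isCompact_Icc.exists_isMaxOn ⟨t, Ioo_subset_Icc_self ht⟩ hg
    by_cases hgm : g m ≤ g t
    · exact ⟨t, ht, fun s hs => (hmax hs).trans hgm⟩
    · obtain ⟨ha, hb⟩ := max_lt_iff.1 (hle.trans_lt (not_le.1 hgm))
      exact ⟨m, ⟨lt_of_le_of_ne hm.1 fun h => ha.ne (h ▸ rfl),
        lt_of_le_of_ne hm.2 fun h => hb.ne (h ▸ rfl)⟩, hmax⟩
  have hnhds : Icc a b ∈ 𝓝 m := Icc_mem_nhds hm.1 hm.2
  have hlocmax : IsLocalMax g m := hmax.isLocalMax hnhds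
  have hpos := hconvex m hm hlocmax.deriv_eq_zero
  have hlocmin : IsLocalMin g m :=
    isLocalMin_of_deriv_deriv_pos hpos hlocmax.deriv_eq_zero (hg.continuousAt hnhds)
  have hconst : g =ᶠ[𝓝 m] fun _ => g m := by
    filter_upwards [hlocmax, hlocmin] with s hs hs' using le_antisymm hs hs'
  rw [hconst.deriv.deriv_eq] at hpos
  simp at hpos

variable {E : Type*} [NormedAddCommGroup E] [NormedSpace ℝ E] {f : E → ℝ} {B : Set E}

theorem deriv_deriv_comp {F : Type*} [NormedAddCommGroup F] [NormedSpace ℝ F] {f : E → F}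
    {c : ℝ → E} {t : ℝ} (hf : ContDiffAt ℝ 2 f (c t)) (hc : ContDiffAt ℝ 2 c t) :
    deriv (deriv fun s => f (c s)) t =
      fderiv ℝ (fderiv ℝ f) (c t) (deriv c t) (deriv c t) +
        fderiv ℝ f (c t) (deriv (deriv c) t) := by
  have hderiv : deriv (fun s => f (c s)) =ᶠ[𝓝 t] fun s => fderiv ℝ f (c s) (deriv c s) := by
    filter_upwards [hc.continuousAt.eventually (hf.eventually (by simp)), hc.eventually (by simp)]
      with s hfs hcs
    exact ((hfs.differentiableAt two_ne_zero).hasFDerivAt.comp_hasDerivAt s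
      (hcs.differentiableAt two_ne_zero).hasDerivAt).deriv
  have hdc : DifferentiableAt ℝ (deriv c) t :=
    (((hc.fderiv_right (m := 1) (by norm_num)).clm_apply
      (contDiffAt_const (c := (1 : ℝ)))).differentiableAt one_ne_zero).congr_of_eventuallyEq
      (.of_forall fun _ => rfl)
  have hdf : DifferentiableAt ℝ (fderiv ℝ f) (c t) :=
    (hf.fderiv_right (m := 1) (by norm_num)).differentiableAt one_ne_zero
  rw [hderiv.deriv_eq]
  exact ((hdf.hasFDerivAt.comp_hasDerivAt t
    (hc.differentiableAt two_ne_zero).hasDerivAt).clm_apply hdc.hasDerivAt).deriv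

theorem deriv_deriv_comp_lineMap {F : Type*} [NormedAddCommGroup F] [NormedSpace ℝ F] {f : E → F}
    {x y : E} {t : ℝ} (hf : ContDiffAt ℝ 2 f (AffineMap.lineMap x y t)) :
    deriv (deriv fun s => f (AffineMap.lineMap x y s)) t =
      fderiv ℝ (fderiv ℝ f) (AffineMap.lineMap x y t) (y - x) (y - x) := by
  have hline : deriv (AffineMap.lineMap (k := ℝ) x y) = fun _ => y - x :=
    funext fun s => AffineMap.hasDerivAt_lineMap.deriv
  simpa [hline] using deriv_deriv_comp (c := AffineMap.lineMap x y) hf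
    (AffineMap.contDiff_lineMap x y).contDiffAt

theorem strictConvex_sep_le (hB : Convex ℝ B) (hBo : IsOpen B) (hf : ContDiffOn ℝ 2 f B)
    (hconvex : ∀ x ∈ B, ∀ v ≠ 0, fderiv ℝ f x v = 0 → 0 < fderiv ℝ (fderiv ℝ f) x v v) (c : ℝ) :
    StrictConvex ℝ {x ∈ B | f x ≤ c} := by
  rw [strictConvex_iff_openSegment_subset]
  rintro x ⟨hxB, hxc⟩ y ⟨hyB, hyc⟩ hxy
  rw [openSegment_eq_image_lineMap]
  rintro _ ⟨t, ht, rfl⟩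
  have hline : ∀ s ∈ Icc (0 : ℝ) 1, AffineMap.lineMap x y s ∈ B := fun s hs =>
    hB.lineMap_mem hxB hyB hs
  have hfB : ∀ s ∈ Icc (0 : ℝ) 1, ContDiffAt ℝ 2 f (AffineMap.lineMap x y s) := fun s hs =>
    hf.contDiffAt (hBo.mem_nhds (hline s hs))
  have hderiv : ∀ s ∈ Icc (0 : ℝ) 1, HasDerivAt (fun s => f (AffineMap.lineMap x y s))
      (fderiv ℝ f (AffineMap.lineMap x y s) (y - x)) s := fun s hs =>
    ((hfB s hs).differentiableAt two_ne_zero).hasFDerivAt.comp_hasDerivAt s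
      AffineMap.hasDerivAt_lineMap
  have hlt := lt_max_of_deriv_deriv_pos
    (fun s hs => (hderiv s hs).continuousAt.continuousWithinAt) (fun s hs hs0 => by
      rw [deriv_deriv_comp_lineMap (hfB s (Ioo_subset_Icc_self hs))]
      exact hconvex _ (hline s (Ioo_subset_Icc_self hs)) _ (sub_ne_zero.2 hxy.symm)
        ((hderiv s (Ioo_subset_Icc_self hs)).deriv ▸ hs0)) ht
  simp only [AffineMap.lineMap_apply_zero, AffineMap.lineMap_apply_one] at hlt
  have hfc : f (AffineMap.lineMap x y t) < c := hlt.trans_le (max_le hxc hyc)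
  have htIcc := Ioo_subset_Icc_self ht
  rw [mem_interior_iff_mem_nhds]
  filter_upwards [hBo.mem_nhds (hline t htIcc), (hfB t htIcc).continuousAt.eventually_lt_const hfc]
    with w hwB hwc using ⟨hwB, hwc.le⟩

theorem eventually_fderiv_fderiv_pos [FiniteDimensional ℝ E] {p : E} (hf : ContDiffAt ℝ 2 f p)
    (hconvex : ∀ v ≠ 0, fderiv ℝ f p v = 0 → 0 < fderiv ℝ (fderiv ℝ f) p v v) :
    ∀ᶠ x in 𝓝 p, ∀ v ≠ 0, fderiv ℝ f x v = 0 → 0 < fderiv ℝ (fderiv ℝ f) x v v := by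
  have hf₁ := hf.fderiv_right (m := 1) (by norm_num)
  have hf₂ := (hf₁.fderiv_right (m := 0) (by norm_num)).continuousAt
  have hunit : ∀ᶠ x in 𝓝 p, ∀ v ∈ Metric.sphere (0 : E) 1,
      fderiv ℝ f x v = 0 → 0 < fderiv ℝ (fderiv ℝ f) x v v := by
    refine (isCompact_sphere 0 1).eventually_forall_of_forall_eventually fun v hv => ?_
    have hdf : ContinuousAt (fun q : E × E => fderiv ℝ f q.1 q.2) (p, v) :=
      (hf₁.continuousAt.comp continuousAt_fst).clm_apply continuousAt_snd
    have hddf : ContinuousAt (fun q : E × E => fderiv ℝ (fderiv ℝ f) q.1 q.2 q.2) (p, v) :=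
      ((hf₂.comp continuousAt_fst).clm_apply continuousAt_snd).clm_apply continuousAt_snd
    by_cases hv0 : fderiv ℝ f p v = 0
    · filter_upwards [hddf.eventually_const_lt (hconvex v (ne_zero_of_mem_unit_sphere ⟨v, hv⟩) hv0)]
        with q hq _ using hq
    · filter_upwards [hdf.eventually_ne hv0] with q hq hq0 using absurd hq0 hq
  filter_upwards [hunit] with x hx v hv hv0
  have hpos := hx (‖v‖⁻¹ • v) (by simp [norm_smul, hv]) (by simp [hv0])
  simp only [map_smul, smul_apply, smul_eq_mul] at hpos
  have hinv : 0 ≤ ‖v‖⁻¹ := by positivity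
  exact pos_of_mul_pos_right (pos_of_mul_pos_right hpos hinv) hinv

end SublevelSets

section Gradient

variable {E : Type*} [NormedAddCommGroup E] [InnerProductSpace ℝ E]

theorem inner_pos_of_isSymmetric_of_eigenvalue_pos [FiniteDimensional ℝ E] {S : E →ₗ[ℝ] E}
    (hS : S.IsSymmetric) (hpos : ∀ (κ : ℝ) v, v ≠ 0 → S v = κ • v → 0 < κ) {v : E}
    (hv : v ≠ 0) : 0 < inner ℝ (S v) v := by
  set b := hS.eigenvectorBasis rfl
  have hbpos : ∀ i, 0 < hS.eigenvalues rfl i := fun i =>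
    hpos _ (b i) (b.orthonormal.ne_zero i) (hS.apply_eigenvectorBasis rfl i)
  have hsum : inner ℝ (S v) v = ∑ i, hS.eigenvalues rfl i * inner ℝ (b i) v ^ 2 := by
    rw [← b.sum_inner_mul_inner]
    refine Finset.sum_congr rfl fun i _ => ?_
    rw [hS v (b i), hS.apply_eigenvectorBasis, inner_smul_right, real_inner_comm v (b i),
      RCLike.ofReal_real_eq_id, id_eq]
    ring
  obtain ⟨i, hi⟩ : ∃ i, inner ℝ (b i) v ≠ 0 := by
    by_contra! hzero
    exact hv (InnerProductSpace.ext_inner_left_basis b.toBasis fun i => by simp [hzero])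
  rw [hsum]
  exact Finset.sum_pos' (fun j _ => mul_nonneg (hbpos j).le (sq_nonneg _))
    ⟨i, Finset.mem_univ _, mul_pos (hbpos i) (by positivity)⟩

variable [CompleteSpace E] {f : E → ℝ} {x : E}

theorem contDiffAt_gradient {m n : WithTop ℕ∞} (hf : ContDiffAt ℝ n f x) (hmn : m + 1 ≤ n) :
    ContDiffAt ℝ m (gradient f) x :=
  (InnerProductSpace.toDual ℝ E).symm.contDiff.contDiffAt.comp x (hf.fderiv_right hmn)

theorem inner_fderiv_gradient (hf : DifferentiableAt ℝ (fderiv ℝ f) x) (v w : E) :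
    inner ℝ (fderiv ℝ (gradient f) x v) w = fderiv ℝ (fderiv ℝ f) x v w := by
  have hgrad : HasFDerivAt (gradient f) _ x :=
    (InnerProductSpace.toDual ℝ E).symm.toContinuousLinearEquiv.toContinuousLinearMap
      |>.hasFDerivAt.comp x hf.hasFDerivAt
  rw [hgrad.fderiv]
  simp

end Gradient

section UnitNormal

variable {d : ℕ} {f : Euc d → ℝ} {x v w : Euc d}

theorem norm_unitNormal (hx : gradient f x ≠ 0) : ‖unitNormal f x‖ = 1 := by
  rw [unitNormal, norm_smul, norm_inv, norm_norm, inv_mul_cancel₀ (norm_ne_zero_iff.2 hx)]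

theorem norm_gradient_smul_unitNormal (hx : gradient f x ≠ 0) :
    ‖gradient f x‖ • unitNormal f x = gradient f x := by
  rw [unitNormal, smul_inv_smul₀ (norm_ne_zero_iff.2 hx)]

theorem contDiffAt_unitNormal {m n : WithTop ℕ∞} (hf : ContDiffAt ℝ n f x) (hmn : m + 1 ≤ n)
    (hx : gradient f x ≠ 0) : ContDiffAt ℝ m (unitNormal f) x :=
  (((contDiffAt_gradient hf hmn).norm ℝ hx).inv (norm_ne_zero_iff.2 hx)).smul
    (contDiffAt_gradient hf hmn)

theorem inner_fderiv_unitNormal (hf : ContDiffAt ℝ 2 f x) (hx : gradient f x ≠ 0)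
    (hw : inner ℝ (gradient f x) w = 0) :
    inner ℝ (fderiv ℝ (unitNormal f) x v) w =
      ‖gradient f x‖⁻¹ * fderiv ℝ (fderiv ℝ f) x v w := by
  have hgrad : DifferentiableAt ℝ (gradient f) x :=
    (contDiffAt_gradient (m := 1) hf (by norm_num)).differentiableAt one_ne_zero
  have hnormal : HasFDerivAt (unitNormal f) _ x :=
    ((hgrad.norm ℝ hx).inv (norm_ne_zero_iff.2 hx)).hasFDerivAt.smul hgrad.hasFDerivAt
  rw [hnormal.fderiv, ← inner_fderiv_gradient
    ((hf.fderiv_right (m := 1) (by norm_num)).differentiableAt one_ne_zero)]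
  simp [inner_add_left, inner_smul_left, hw]

theorem inner_gradient_fderiv_unitNormal (hf : ContDiffAt ℝ 2 f x) (hx : gradient f x ≠ 0) :
    inner ℝ (gradient f x) (fderiv ℝ (unitNormal f) x v) = 0 := by
  have hnormal : DifferentiableAt ℝ (unitNormal f) x :=
    (contDiffAt_unitNormal (m := 1) hf (by norm_num) hx).differentiableAt one_ne_zero
  have hnorm : (fun y => inner ℝ (unitNormal f y) (unitNormal f y)) =ᶠ[𝓝 x] fun _ => (1 : ℝ) := by
    filter_upwards [(contDiffAt_gradient (m := 1) hf (by norm_num)).continuousAt.eventually_ne hx]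
      with y hy
    rw [real_inner_self_eq_norm_sq, norm_unitNormal hy, one_pow]
  have hderiv := congrArg (· v) (hnorm.fderiv_eq (𝕜 := ℝ))
  simp only [fderiv_inner_apply (𝕜 := ℝ) hnormal hnormal, fderiv_fun_const, Pi.zero_apply,
    zero_apply] at hderiv
  rw [real_inner_comm (unitNormal f x), ← two_mul] at hderiv
  rw [← norm_gradient_smul_unitNormal hx, inner_smul_left,
    (mul_eq_zero.1 hderiv).resolve_left two_ne_zero, mul_zero]

theorem fderiv_fderiv_pos_of_principalCurvature_pos (hf : ContDiffAt ℝ 2 f x)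
    (hx : gradient f x ≠ 0)
    (hcurv : ∀ (κ : ℝ) (v : Euc d), v ≠ 0 → inner ℝ (gradient f x) v = 0 →
      fderiv ℝ (unitNormal f) x v = κ • v → 0 < κ)
    (hv : v ≠ 0) (hvx : fderiv ℝ f x v = 0) : 0 < fderiv ℝ (fderiv ℝ f) x v v := by
  let T : Submodule ℝ (Euc d) := (ℝ ∙ gradient f x)ᗮ
  have mem_T {w : Euc d} : w ∈ T ↔ inner ℝ (gradient f x) w = 0 :=
    Submodule.mem_orthogonal_singleton_iff_inner_right
  let S : T →ₗ[ℝ] T := (fderiv ℝ (unitNormal f) x).toLinearMap.restrict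
    fun _ _ => mem_T.2 (inner_gradient_fderiv_unitNormal hf hx)
  have inner_S (a b : T) : inner ℝ (S a) b =
      ‖gradient f x‖⁻¹ * fderiv ℝ (fderiv ℝ f) x a b :=
    inner_fderiv_unitNormal hf hx (mem_T.1 b.2)
  have hsymm : S.IsSymmetric := fun a b => by
    rw [inner_S, real_inner_comm, inner_S,
      (hf.isSymmSndFDerivAt (by simp [minSmoothness_of_isRCLikeNormedField])).eq]
  have hpos := inner_pos_of_isSymmetric_of_eigenvalue_pos hsymm
    (fun κ w hw hSw => hcurv κ w (by simpa using hw) (mem_T.1 w.2) (congrArg Subtype.val hSw))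
    (v := ⟨v, mem_T.2 (by rwa [inner_gradient_left])⟩) (by simpa using hv)
  rw [inner_S] at hpos
  exact pos_of_mul_pos_right hpos (by positivity)

end UnitNormal

section Exterior

variable {d : ℕ} {O U : Set (Euc d)} {p u x : Euc d} {f : Euc d → ℝ}

theorem mem_exterior_of_forall_inner_lt (hu : u ≠ 0)
    (h : ∀ y ∈ O, inner ℝ u y < inner ℝ u x) : x ∈ exterior O := by
  refine ⟨fun hx => lt_irrefl _ (h x hx), fun hbdd => ?_⟩
  have hsub : {y : Euc d | inner ℝ u x ≤ inner ℝ u y} ⊆ connectedComponentIn Oᶜ x :=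
    (convex_halfSpace_ge (innerSL ℝ u).isLinear _).isPreconnected.subset_connectedComponentIn
      (le_refl (inner ℝ u x)) fun y hy hyO => not_lt_of_ge hy (h y hyO)
  obtain ⟨R, hR⟩ := (hbdd.subset hsub).exists_norm_le
  obtain ⟨y, hy⟩ : ∃ y, inner ℝ u y = max (inner ℝ u x) (‖u‖ * R + 1) :=
    ⟨(max (inner ℝ u x) (‖u‖ * R + 1) / ‖u‖ ^ 2) • u, by
      rw [inner_smul_right, real_inner_self_eq_norm_sq, div_mul_cancel₀]
      exact pow_ne_zero 2 (norm_ne_zero_iff.2 hu)⟩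
  have hyR : inner ℝ u y ≤ ‖u‖ * R := (real_inner_le_norm u y).trans
    (mul_le_mul_of_nonneg_left (hR y (hy.ge.trans' (le_max_left _ _))) (norm_nonneg u))
  linarith [hy ▸ le_max_right (inner ℝ u x) (‖u‖ * R + 1)]

theorem connectedComponentIn_subset_exterior (hx : x ∈ exterior O) :
    connectedComponentIn Oᶜ x ⊆ exterior O := fun _ hy =>
  ⟨connectedComponentIn_subset _ _ hy, connectedComponentIn_eq hy ▸ hx.2⟩

theorem isOpen_exterior (hO : IsClosed O) : IsOpen (exterior O) :=
  isOpen_iff_mem_nhds.2 fun _ hx => mem_of_superset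
    (hO.isOpen_compl.connectedComponentIn.mem_nhds (mem_connectedComponentIn hx.1))
    (connectedComponentIn_subset_exterior hx)

theorem compl_exterior_mem_nhds (hO : IsClosed O) (hxO : x ∉ O) (hx : x ∉ exterior O) :
    (exterior O)ᶜ ∈ 𝓝 x :=
  mem_of_superset
    (hO.isOpen_compl.connectedComponentIn.mem_nhds (mem_connectedComponentIn hxO))
    fun _ hy hyE => hx (connectedComponentIn_subset_exterior hyE
      (connectedComponentIn_eq hy ▸ mem_connectedComponentIn hxO))

namespace IsOutwardDefiningFunction

theorem contDiffAt (hf : IsOutwardDefiningFunction O p U f) : ContDiffAt ℝ ∞ f p :=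
  hf.smooth.contDiffAt (hf.isOpen.mem_nhds hf.mem)

theorem contDiffAt_two (hf : IsOutwardDefiningFunction O p U f) : ContDiffAt ℝ 2 f p :=
  hf.contDiffAt.of_le (by norm_cast)

theorem eventually_mem (hf : IsOutwardDefiningFunction O p U f) : ∀ᶠ x in 𝓝 p, x ∈ U :=
  hf.isOpen.mem_nhds hf.mem

theorem notMem_exterior_iff (hf : IsOutwardDefiningFunction O p U f) (hx : x ∈ U) :
    x ∉ exterior O ↔ f x ≤ 0 := by
  rw [hf.exterior_iff x hx, not_lt]

theorem tendsto_inv_smul_apply_add_smul (hf : IsOutwardDefiningFunction O p U f) (hp : p ∈ O)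
    (w : Euc d) : Tendsto (fun t : ℝ => t⁻¹ • f (p + t • w)) (𝓝[>] 0)
      (𝓝 (inner ℝ (gradient f p) w)) := by
  have hline := (hf.contDiffAt.differentiableAt (by simp)).hasFDerivAt.hasLineDerivAt w
  simpa only [(hf.mem_iff p hf.mem).1 hp, sub_zero, inner_gradient_left]
    using hline.tendsto_slope_zero_right

theorem eventually_add_smul_mem (hf : IsOutwardDefiningFunction O p U f) (w : Euc d) :
    ∀ᶠ t : ℝ in 𝓝[>] 0, p + t • w ∈ U := by
  have hcont : Continuous fun t : ℝ => p + t • w := by fun_prop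
  exact nhdsWithin_le_nhds (hcont.continuousAt.eventually (by simpa using hf.eventually_mem))

theorem inner_gradient_nonneg (hf : IsOutwardDefiningFunction O p U f) (hp : p ∈ O) {w : Euc d}
    (hw : ∀ᶠ t : ℝ in 𝓝[>] 0, p + t • w ∈ exterior O) : 0 ≤ inner ℝ (gradient f p) w := by
  refine ge_of_tendsto (hf.tendsto_inv_smul_apply_add_smul hp w) ?_
  filter_upwards [hw, hf.eventually_add_smul_mem w, self_mem_nhdsWithin] with t ht htU ht0
  exact mul_nonneg (inv_nonneg.2 (le_of_lt ht0)) ((hf.exterior_iff _ htU).1 ht).le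

theorem inner_gradient_nonpos (hf : IsOutwardDefiningFunction O p U f) (hp : p ∈ O) {w : Euc d}
    (hw : ∀ᶠ t : ℝ in 𝓝[>] 0, p + t • w ∉ exterior O) : inner ℝ (gradient f p) w ≤ 0 := by
  refine le_of_tendsto (hf.tendsto_inv_smul_apply_add_smul hp w) ?_
  filter_upwards [hw, hf.eventually_add_smul_mem w, self_mem_nhdsWithin] with t ht htU ht0
  exact mul_nonpos_of_nonneg_of_nonpos (inv_nonneg.2 (le_of_lt ht0))
    ((hf.notMem_exterior_iff htU).1 ht)

-- If the unit vectors `N = unitNormal f p` and `u` differ, then `u - N` points strictly out of `O`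
-- as measured by `u` and strictly into it as measured by `N`.
theorem unitNormal_eq (hf : IsOutwardDefiningFunction O p U f) (hp : p ∈ O) (hu : ‖u‖ = 1)
    (hmax : ∀ y ∈ O, inner ℝ u y ≤ inner ℝ u p) : unitNormal f p = u := by
  by_contra hne
  have hgrad := hf.regular p hf.mem
  have hlt := (inner_lt_one_iff_real_of_norm_eq_one (norm_unitNormal hgrad) hu).2 hne
  have hout : ∀ᶠ t : ℝ in 𝓝[>] 0, p + t • (u - unitNormal f p) ∈ exterior O := by
    filter_upwards [self_mem_nhdsWithin] with t (ht : 0 < t)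
    refine mem_exterior_of_forall_inner_lt (norm_ne_zero_iff.1 (hu ▸ one_ne_zero)) fun y hy =>
      (hmax y hy).trans_lt ?_
    rw [inner_add_right, inner_smul_right, inner_sub_right, real_inner_self_eq_norm_sq, hu,
      real_inner_comm (unitNormal f p)]
    nlinarith
  have hin := hf.inner_gradient_nonneg hp hout
  rw [← norm_gradient_smul_unitNormal hgrad, real_inner_smul_left, inner_sub_right,
    real_inner_self_eq_norm_sq, norm_unitNormal hgrad] at hin
  nlinarith [norm_pos_iff.2 hgrad]

end IsOutwardDefiningFunction

end Exterior

theorem exists_inner_lt_of_mem_interior_compl_exterior {d : ℕ} {O : Set (Euc d)} {u x : Euc d}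
    (hu : u ≠ 0) (hx : x ∈ interior (exterior O)ᶜ) : ∃ y ∈ O, inner ℝ u x < inner ℝ u y := by
  by_contra! hmax
  have hray : Tendsto (fun s : ℝ => x + s • u) (𝓝[>] 0) (𝓝 x) := by
    have hcont : Continuous fun s : ℝ => x + s • u := by fun_prop
    simpa using (hcont.tendsto 0).mono_left nhdsWithin_le_nhds
  obtain ⟨s, hs, hs0⟩ :=
    ((hray.eventually (mem_interior_iff_mem_nhds.1 hx)).and self_mem_nhdsWithin).exists
  refine hs (mem_exterior_of_forall_inner_lt hu fun y hy => (hmax y hy).trans_lt ?_)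
  rw [inner_add_right, inner_smul_right]
  exact lt_add_of_pos_right _ (mul_pos hs0 (real_inner_self_pos.2 hu))

namespace IsOvaloid

variable {d : ℕ} {O U : Set (Euc d)} {p u x y : Euc d} {f : Euc d → ℝ}

theorem fderiv_fderiv_pos (hO : IsOvaloid O) (hp : p ∈ O) (hf : IsOutwardDefiningFunction O p U f)
    {v : Euc d} (hv : v ≠ 0) (hvp : fderiv ℝ f p v = 0) : 0 < fderiv ℝ (fderiv ℝ f) p v v :=
  fderiv_fderiv_pos_of_principalCurvature_pos hf.contDiffAt_two
    (hf.regular p hf.mem)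
    (fun κ w hw hwp hκ => hO.curvature_pos p κ ⟨hp, U, f, hf, w, hw, hwp, hκ⟩) hv hvp

theorem isLocallyStrictConvex_compl_exterior (hO : IsOvaloid O) :
    IsLocallyStrictConvex (exterior O)ᶜ := by
  intro q hq
  by_cases hqO : q ∈ O
  · obtain ⟨U, f, hf⟩ := hO.hypersurface q hqO
    obtain ⟨r, hr, hball⟩ := Metric.eventually_nhds_iff_ball.1
      (hf.eventually_mem.and (eventually_fderiv_fderiv_pos hf.contDiffAt_two
        fun v => hO.fderiv_fderiv_pos hqO hf))
    refine ⟨Metric.ball q r, Metric.ball_mem_nhds q hr, ?_⟩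
    have heq : (exterior O)ᶜ ∩ Metric.ball q r = {x ∈ Metric.ball q r | f x ≤ 0} := by
      rw [inter_comm]
      exact Set.ext fun x => and_congr_right fun hx => hf.notMem_exterior_iff (hball x hx).1
    rw [heq]
    exact strictConvex_sep_le (convex_ball q r) Metric.isOpen_ball
      ((hf.smooth.mono fun x hx => (hball x hx).1).of_le (by norm_cast))
      (fun x hx => (hball x hx).2) 0
  · obtain ⟨r, hr, hball⟩ := Metric.mem_nhds_iff.1
      (compl_exterior_mem_nhds hO.isCompact.isClosed hqO hq)
    refine ⟨Metric.ball q r, Metric.ball_mem_nhds q hr, ?_⟩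
    rw [inter_eq_right.2 hball]
    exact (convex_ball q r).strictConvex_of_isOpen Metric.isOpen_ball

theorem openSegment_subset_interior (hO : IsOvaloid O) (hx : x ∈ O) (hy : y ∈ O) (hxy : x ≠ y) :
    openSegment ℝ x y ⊆ interior (exterior O)ᶜ :=
  hO.isLocallyStrictConvex_compl_exterior.openSegment_subset_interior
    (isOpen_exterior hO.isCompact.isClosed).isClosed_compl hO.isConnected.isPreconnected
    (fun _ hq hqE => hqE.1 hq) hx hy hxy

theorem inner_unitNormal_le (hO : IsOvaloid O) (hp : p ∈ O)
    (hf : IsOutwardDefiningFunction O p U f) (hx : x ∈ O) :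
    inner ℝ (unitNormal f p) x ≤ inner ℝ (unitNormal f p) p := by
  obtain rfl | hxp := eq_or_ne p x
  · rfl
  have hin : ∀ᶠ t : ℝ in 𝓝[>] 0, p + t • (x - p) ∉ exterior O := by
    filter_upwards [Ioo_mem_nhdsGT one_pos] with t ht
    refine interior_subset (hO.openSegment_subset_interior hp hx hxp ?_)
    rw [openSegment_eq_image']
    exact mem_image_of_mem _ ht
  rw [← sub_nonpos, ← inner_sub_right, unitNormal, real_inner_smul_left]
  exact mul_nonpos_of_nonneg_of_nonpos (by positivity) (hf.inner_gradient_nonpos hp hin)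

theorem eq_of_isMaxOn_inner (hO : IsOvaloid O) (hu : u ≠ 0) (hx : x ∈ O) (hy : y ∈ O)
    (hxmax : IsMaxOn (inner ℝ u) O x) (hymax : IsMaxOn (inner ℝ u) O y) : x = y := by
  by_contra hxy
  obtain ⟨q, hq, hlt⟩ := exists_inner_lt_of_mem_interior_compl_exterior hu
    (hO.openSegment_subset_interior hx hy hxy (midpoint_mem_openSegment x y))
  have heq : inner ℝ u x = inner ℝ u y := le_antisymm (hymax hx) (hxmax hy)
  rw [midpoint_eq_smul_add, inner_smul_right, inner_add_right, ← heq, ← two_mul,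
    invOf_mul_cancel_left] at hlt
  exact hlt.not_ge (hxmax hq)

end IsOvaloid

section Immersion

variable {V H M F G : Type*} [NormedAddCommGroup V] [NormedSpace ℝ V] [TopologicalSpace H]
  {J : ModelWithCorners ℝ V H} [TopologicalSpace M] [ChartedSpace H M]
  [NormedAddCommGroup F] [NormedSpace ℝ F] [NormedAddCommGroup G] [NormedSpace ℝ G]
  {c : ℝ → M} {t : ℝ}

theorem hasDerivAt_comp_mfderiv {f : M → F} (hf : MDifferentiableAt J 𝓘(ℝ, F) f (c t))
    (hc : MDifferentiableAt 𝓘(ℝ, ℝ) J c t) :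
    HasDerivAt (fun s => f (c s))
      (mfderiv J 𝓘(ℝ, F) f (c t) (mfderiv 𝓘(ℝ, ℝ) J c t (1 : ℝ))) t := by
  obtain ⟨L, hL, hL₁⟩ : ∃ L : ℝ →L[ℝ] F, HasFDerivAt (fun s => f (c s)) L t ∧
      L 1 = mfderiv J 𝓘(ℝ, F) f (c t) (mfderiv 𝓘(ℝ, ℝ) J c t (1 : ℝ)) :=
    ⟨_, (hf.hasMFDerivAt.comp t hc.hasMFDerivAt).hasFDerivAt, rfl⟩
  exact hL₁ ▸ hL.hasDerivAt

theorem ne_zero_of_hasDerivAt_comp_of_injective_mfderiv {f : M → F} {g : M → G} {a : F} {b : G}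
    (hc : MDifferentiableAt 𝓘(ℝ, ℝ) J c t) (hf : MDifferentiableAt J 𝓘(ℝ, F) f (c t))
    (hinj : Function.Injective (mfderiv J 𝓘(ℝ, F) f (c t)))
    (hg : MDifferentiableAt J 𝓘(ℝ, G) g (c t)) (ha : HasDerivAt (fun s => f (c s)) a t)
    (hb : HasDerivAt (fun s => g (c s)) b t) (hb0 : b ≠ 0) : a ≠ 0 := by
  rintro rfl
  have hc0 : mfderiv 𝓘(ℝ, ℝ) J c t (1 : ℝ) = 0 :=
    hinj (((hasDerivAt_comp_mfderiv hf hc).unique ha).trans (map_zero _).symm)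
  have hb' := hb.unique (hasDerivAt_comp_mfderiv hg hc)
  rw [hc0] at hb'
  exact hb0 (hb'.trans (map_zero (mfderiv J 𝓘(ℝ, G) g (c t))))

end Immersion

section RadialProjection

variable {d : ℕ} {y : Euc d}

/-- The radial projection of `ℝ^(d+1) ∖ {0}` to the unit sphere; its value at `0` is arbitrary. It
lets maps on the sphere be handled as maps on an open subset of Euclidean space. -/
noncomputable def sphereProj (y : Euc d) : Sph d :=
  if h : y = 0 then ⟨EuclideanSpace.single 0 1, by simp⟩
  else ⟨‖y‖⁻¹ • y, by simp [norm_smul, h]⟩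

theorem coe_sphereProj (hy : y ≠ 0) : (sphereProj y : Euc d) = ‖y‖⁻¹ • y := by
  simp [sphereProj, hy]

@[simp]
theorem sphereProj_coe (u : Sph d) : sphereProj (u : Euc d) = u := by
  ext1
  simp [coe_sphereProj (ne_zero_of_mem_unit_sphere u)]

theorem inv_norm_smul_smul {E : Type*} [NormedAddCommGroup E] [NormedSpace ℝ E] {r : ℝ}
    (hr : 0 < r) (x : E) : ‖r • x‖⁻¹ • r • x = ‖x‖⁻¹ • x := by
  rw [norm_smul, Real.norm_of_nonneg hr.le, mul_inv, smul_smul, mul_right_comm,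
    inv_mul_cancel₀ hr.ne', one_mul]

theorem sphereProj_smul {r : ℝ} (hr : 0 < r) (y : Euc d) : sphereProj (r • y) = sphereProj y := by
  obtain rfl | hy := eq_or_ne y 0
  · rw [smul_zero]
  · ext1
    rw [coe_sphereProj (smul_ne_zero hr.ne' hy), coe_sphereProj hy, inv_norm_smul_smul hr]

theorem contDiffOn_coe_sphereProj :
    ContDiffOn ℝ ∞ (fun y : Euc d => (sphereProj y : Euc d)) {0}ᶜ := by
  have hformula : ContDiffOn ℝ ∞ (fun y : Euc d => ‖y‖⁻¹ • y) {0}ᶜ := fun y hy =>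
    (((contDiffAt_norm ℝ hy).inv (norm_ne_zero_iff.2 hy)).smul contDiffAt_id).contDiffWithinAt
  exact hformula.congr fun y hy => coe_sphereProj hy

theorem contMDiffAt_sphereProj (hy : y ≠ 0) :
    ContMDiffAt 𝓘(ℝ, Euc d) (𝓡 d) ∞ (sphereProj : Euc d → Sph d) y := by
  have := Fact.mk (@finrank_euclideanSpace_fin ℝ _ (d + 1))
  let W : TopologicalSpace.Opens (Euc d) := ⟨{0}ᶜ, isOpen_compl_singleton⟩
  have hcoe : ContMDiff 𝓘(ℝ, Euc d) 𝓘(ℝ, Euc d) ∞ fun x : W => (sphereProj (x : Euc d) : Euc d) :=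
    fun x => contMDiffAt_subtype_iff.2
      (contDiffOn_coe_sphereProj.contDiffAt (isOpen_compl_singleton.mem_nhds x.2)).contMDiffAt
  have hproj : ContMDiff 𝓘(ℝ, Euc d) (𝓡 d) ∞ fun x : W => sphereProj (x : Euc d) :=
    hcoe.codRestrict_sphere fun x => (sphereProj x.1).2
  exact contMDiffAt_subtype_iff.1 (hproj ⟨y, hy⟩)

theorem contMDiff_coe_sph : ContMDiff (𝓡 d) 𝓘(ℝ, Euc d) ∞ (fun u : Sph d => (u : Euc d)) :=
  have := Fact.mk (@finrank_euclideanSpace_fin ℝ _ (d + 1))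
  contMDiff_coe_sphere

theorem hasDerivAt_coe_sphereProj_comp {v : ℝ → Euc d} {v' : Euc d} {u : Sph d} {t : ℝ}
    (hv : HasDerivAt v v' t) (hvt : v t = u) :
    HasDerivAt (fun s => (sphereProj (v s) : Euc d))
      (v' - inner ℝ v' (u : Euc d) • (u : Euc d)) t := by
  have hne : v t ≠ 0 := hvt ▸ ne_zero_of_mem_unit_sphere u
  have hsq : HasDerivAt (fun s => ‖v s‖ ^ 2) (2 * inner ℝ (u : Euc d) v') t := hvt ▸ hv.norm_sq
  have hinv : HasDerivAt (fun s => ‖v s‖⁻¹) (-inner ℝ v' (u : Euc d)) t := by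
    have hroot := (hsq.sqrt (by simpa using hne)).fun_inv (by simpa using hne)
    simpa [hvt, real_inner_comm] using hroot
  have hformula := hinv.smul hv
  simp only [hvt, norm_eq_of_mem_sphere, inv_one, one_smul, neg_smul, ← sub_eq_add_neg]
    at hformula
  refine hformula.congr_of_eventuallyEq ?_
  filter_upwards [hv.continuousAt.eventually_ne hne] with s hs using coe_sphereProj hs

theorem contDiffOn_comp_sphereProj {F : Type*} [NormedAddCommGroup F] [NormedSpace ℝ F]
    {f : Sph d × ℝ → F} {s : Set ℝ}
    (hf : ContMDiffOn ((𝓡 d).prod 𝓘(ℝ, ℝ)) 𝓘(ℝ, F) ∞ f (univ ×ˢ s)) :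
    ContDiffOn ℝ ∞ (fun q : Euc d × ℝ => f (sphereProj q.1, q.2)) ({0}ᶜ ×ˢ s) := by
  rw [← contMDiffOn_iff_contDiffOn]
  have hproj : ContMDiffOn 𝓘(ℝ, Euc d × ℝ) (𝓡 d) ∞ (fun q : Euc d × ℝ => sphereProj q.1)
      ({0}ᶜ ×ˢ s) := fun q hq =>
    ((contMDiffAt_sphereProj hq.1).comp q contDiffAt_fst.contMDiffAt).contMDiffWithinAt
  exact hf.comp (hproj.prodMk contDiff_snd.contMDiff.contMDiffOn) fun q hq => ⟨trivial, hq.2⟩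

theorem ne_zero_of_hasDerivAt_comp_sphereProj {F : Type*} [NormedAddCommGroup F]
    [NormedSpace ℝ F] {X : Sph d × ℝ → F} {u : Sph d} {z : ℝ}
    (hX : MDifferentiableAt ((𝓡 d).prod 𝓘(ℝ, ℝ)) 𝓘(ℝ, F) X (u, z))
    (hinj : Function.Injective (mfderiv ((𝓡 d).prod 𝓘(ℝ, ℝ)) 𝓘(ℝ, F) X (u, z)))
    {w : Euc d} (hw : inner ℝ (u : Euc d) w = 0) (hw0 : w ≠ 0) {a : F}
    (ha : HasDerivAt (fun t : ℝ => X (sphereProj ((u : Euc d) + t • w), z)) a 0) : a ≠ 0 := by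
  have hline : HasDerivAt (fun t : ℝ => (u : Euc d) + t • w) w 0 := by
    simpa using ((hasDerivAt_id (0 : ℝ)).smul_const w).const_add (u : Euc d)
  have hc0 : (sphereProj ((u : Euc d) + (0 : ℝ) • w), z) = (u, z) := by simp
  have hcm : MDifferentiableAt 𝓘(ℝ, ℝ) ((𝓡 d).prod 𝓘(ℝ, ℝ))
      (fun t : ℝ => (sphereProj ((u : Euc d) + t • w), z)) 0 := by
    have hproj := contMDiffAt_sphereProj (y := (u : Euc d) + (0 : ℝ) • w)
      (by simpa using ne_zero_of_mem_unit_sphere u)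
    have hcurve : MDifferentiableAt 𝓘(ℝ, ℝ) (𝓡 d)
        (fun t : ℝ => sphereProj ((u : Euc d) + t • w)) 0 :=
      (hproj.mdifferentiableAt (by simp)).comp (0 : ℝ) hline.differentiableAt.mdifferentiableAt
    exact hcurve.prodMk mdifferentiableAt_const
  have hcoe : MDifferentiableAt ((𝓡 d).prod 𝓘(ℝ, ℝ)) 𝓘(ℝ, Euc d)
      (fun q : Sph d × ℝ => (q.1 : Euc d)) (sphereProj ((u : Euc d) + (0 : ℝ) • w), z) :=
    (contMDiff_coe_sph.comp contMDiff_fst).mdifferentiableAt (by simp)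
  refine ne_zero_of_hasDerivAt_comp_of_injective_mfderiv hcm (hc0.symm ▸ hX) (hc0.symm ▸ hinj)
    hcoe ha (hasDerivAt_coe_sphereProj_comp (u := u) hline (by simp)) ?_
  rwa [real_inner_comm, hw, zero_smul, sub_zero]

end RadialProjection

/-- A map `γ`, constant on rays, that restricts to an inverse Gauss map of a positively curved
hypersurface: its differential at `y` takes values in `yᗮ` and is positive definite there. Working
with maps that are constant on rays instead of maps on the sphere allows plain Fréchet
derivatives. -/
structure IsSupportField {d : ℕ} (γ : Euc d → Euc d) : Prop where
  smooth : ContDiffOn ℝ ∞ γ {0}ᶜ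
  smul : ∀ y, ∀ r : ℝ, 0 < r → γ (r • y) = γ y
  perp : ∀ y, y ≠ 0 → ∀ w, inner ℝ y (fderiv ℝ γ y w) = 0
  pos : ∀ y w, y ≠ 0 → inner ℝ y w = 0 → w ≠ 0 → 0 < inner ℝ (fderiv ℝ γ y w) w

/-- The open convex body whose support function is `y ↦ ⟪y, γ y⟫`. -/
def body {d : ℕ} (γ : Euc d → Euc d) : Set (Euc d) :=
  {x | ∀ y, y ≠ 0 → inner ℝ y x < inner ℝ y (γ y)}

/-- The map onto the cone with vertex `q` over the hypersurface parametrized by `γ`, sending the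
unit sphere to the hypersurface. -/
noncomputable def cone {d : ℕ} (γ : Euc d → Euc d) (q y : Euc d) : Euc d :=
  q + ‖y‖ • (γ y - q)

namespace IsSupportField

variable {d : ℕ} {γ : Euc d → Euc d} {c m q v w x y : Euc d}

theorem contDiffAt (hγ : IsSupportField γ) (hy : y ≠ 0) : ContDiffAt ℝ ∞ γ y :=
  hγ.smooth.contDiffAt (isOpen_compl_singleton.mem_nhds hy)

theorem hasFDerivAt (hγ : IsSupportField γ) (hy : y ≠ 0) : HasFDerivAt γ (fderiv ℝ γ y) y :=
  ((hγ.contDiffAt hy).differentiableAt (by simp)).hasFDerivAt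

theorem apply_sphereProj (hγ : IsSupportField γ) (hy : y ≠ 0) : γ (sphereProj y) = γ y := by
  rw [coe_sphereProj hy, hγ.smul y _ (by positivity)]

theorem apply_mem_range (hγ : IsSupportField γ) (hy : y ≠ 0) :
    γ y ∈ range fun u : Sph d => γ u :=
  ⟨sphereProj y, hγ.apply_sphereProj hy⟩

theorem apply_eq_of_sameRay (hγ : IsSupportField γ) (hx : x ≠ 0) (hy : y ≠ 0)
    (h : SameRay ℝ x y) : γ x = γ y := by
  obtain ⟨r, hr, rfl⟩ := h.exists_pos_left hx hy
  exact (hγ.smul x r hr).symm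

theorem fderiv_self (hγ : IsSupportField γ) (hy : y ≠ 0) : fderiv ℝ γ y y = 0 := by
  have hline : HasLineDerivAt ℝ γ (fderiv ℝ γ y y) y y := (hγ.hasFDerivAt hy).hasLineDerivAt y
  have hconst : HasLineDerivAt ℝ γ 0 y y := by
    refine (hasDerivAt_const (0 : ℝ) (γ y)).congr_of_eventuallyEq ?_
    filter_upwards [lt_mem_nhds (neg_one_lt_zero : (-1 : ℝ) < 0)] with t ht
    rw [← hγ.smul y (1 + t) (by linarith), add_smul, one_smul]
  exact hline.unique hconst

theorem inner_fderiv_self_pos (hγ : IsSupportField γ) (h : LinearIndependent ℝ ![c, v]) :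
    0 < inner ℝ v (fderiv ℝ γ c v) := by
  have hc : c ≠ 0 := h.ne_zero 0
  obtain ⟨r, w, hcw, rfl⟩ : ∃ (r : ℝ) (w : Euc d), inner ℝ c w = 0 ∧ r • c + w = v := by
    refine ⟨inner ℝ c v / inner ℝ c c, v - (inner ℝ c v / inner ℝ c c : ℝ) • c, ?_, by abel⟩
    rw [inner_sub_right, inner_smul_right, div_mul_cancel₀ _ (inner_self_ne_zero.2 hc), sub_self]
  have hw : w ≠ 0 := by
    rintro rfl
    have := LinearIndependent.pair_iff.1 h (-r) 1 (by simp)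
    exact one_ne_zero this.2
  rw [map_add, map_smul, hγ.fderiv_self hc, smul_zero, zero_add, inner_add_left, inner_smul_left,
    hγ.perp c hc, mul_zero, zero_add, real_inner_comm]
  exact hγ.pos c w hc hcw hw

theorem strictMono_inner_add_smul (hγ : IsSupportField γ) (h : LinearIndependent ℝ ![x, y]) :
    StrictMono fun s : ℝ => (inner ℝ y (γ (x + s • y)) : ℝ) := by
  have hind (s : ℝ) : LinearIndependent ℝ ![x + s • y, y] := by
    simpa using h
  refine strictMono_of_deriv_pos fun s => ?_
  have hne : x + s • y ≠ 0 := (hind s).ne_zero 0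
  have hline : HasDerivAt (fun s : ℝ => x + s • y) y s := by
    simpa using ((hasDerivAt_id s).smul_const y).const_add x
  have hder := (hasDerivAt_const s y).inner ℝ ((hγ.hasFDerivAt hne).comp_hasDerivAt s hline)
  rw [inner_zero_left, add_zero] at hder
  exact hder.deriv ▸ hγ.inner_fderiv_self_pos (hind s)

theorem tendsto_apply_add_smul_atTop (hγ : IsSupportField γ) (hy : y ≠ 0) (x : Euc d) :
    Tendsto (fun s : ℝ => γ (x + s • y)) atTop (𝓝 (γ y)) := by
  have hdir : Tendsto (fun s : ℝ => s⁻¹ • x + y) atTop (𝓝 y) := by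
    simpa using ((tendsto_inv_atTop_zero (𝕜 := ℝ)).smul_const x).add_const y
  refine ((hγ.contDiffAt hy).continuousAt.tendsto.comp hdir).congr' ?_
  filter_upwards [eventually_gt_atTop 0] with s hs
  rw [Function.comp_apply, ← hγ.smul _ s hs, smul_add, smul_inv_smul₀ hs.ne']

theorem inner_lt_of_linearIndependent (hγ : IsSupportField γ)
    (h : LinearIndependent ℝ ![x, y]) : inner ℝ y (γ x) < inner ℝ y (γ y) := by
  have hmono := hγ.strictMono_inner_add_smul h
  have hlim : Tendsto (fun s : ℝ => (inner ℝ y (γ (x + s • y)) : ℝ)) atTop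
      (𝓝 (inner ℝ y (γ y))) :=
    tendsto_const_nhds.inner (hγ.tendsto_apply_add_smul_atTop (h.ne_zero 1) x)
  simpa using (hmono zero_lt_one).trans_le (hmono.monotone.ge_of_tendsto hlim 1)

theorem inner_lt (hγ : IsSupportField γ) (hd : 1 ≤ d) (hx : x ≠ 0) (hy : y ≠ 0)
    (hxy : ¬SameRay ℝ x y) : inner ℝ y (γ x) < inner ℝ y (γ y) := by
  by_cases hind : LinearIndependent ℝ ![x, y]
  · exact hγ.inner_lt_of_linearIndependent hind
  have hray : SameRay ℝ x (-y) :=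
    (sameRay_or_sameRay_neg_iff_not_linearIndependent.2 hind).resolve_left hxy
  obtain ⟨m, hm⟩ := exists_linearIndependent_pair_of_one_lt_finrank (R := ℝ)
    (by rw [finrank_euclideanSpace_fin]; omega) hy
  have hmy : LinearIndependent ℝ ![m, y] := LinearIndependent.pair_symm_iff.1 hm
  have hmy' : LinearIndependent ℝ ![m, -y] := by simpa using hmy
  have hneg := hγ.inner_lt_of_linearIndependent hmy'
  rw [inner_neg_left, inner_neg_left, neg_lt_neg_iff] at hneg
  rw [hγ.apply_eq_of_sameRay hx (neg_ne_zero.2 hy) hray]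
  exact hneg.trans (hγ.inner_lt_of_linearIndependent hmy)

theorem inner_le (hγ : IsSupportField γ) (hd : 1 ≤ d) (hx : x ≠ 0) (hy : y ≠ 0) :
    inner ℝ y (γ x) ≤ inner ℝ y (γ y) := by
  by_cases hxy : SameRay ℝ x y
  · rw [hγ.apply_eq_of_sameRay hx hy hxy]
  · exact (hγ.inner_lt hd hx hy hxy).le

theorem continuous_comp_coe (hγ : IsSupportField γ) : Continuous fun u : Sph d => γ u :=
  hγ.smooth.continuousOn.comp_continuous continuous_subtype_val ne_zero_of_mem_unit_sphere

/-! ### The body bounded by the hypersurface -/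

theorem eq_apply_of_inner_eq (hγ : IsSupportField γ)
    (hle : ∀ y, y ≠ 0 → inner ℝ y x ≤ inner ℝ y (γ y)) (hm : m ≠ 0)
    (heq : inner ℝ m x = inner ℝ m (γ m)) : x = γ m := by
  have hmin : IsLocalMin (fun y : Euc d => (inner ℝ y (γ y - x) : ℝ)) m := by
    filter_upwards [isOpen_compl_singleton.mem_nhds hm] with y hy
    rw [inner_sub_right, inner_sub_right, ← heq, sub_self, sub_nonneg]
    exact hle y hy
  have hder := (hasFDerivAt_id m).inner ℝ ((hγ.hasFDerivAt hm).sub_const x)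
  have happly := congrArg (fun L => L (γ m - x)) (hmin.hasFDerivAt_eq_zero hder)
  simp only [ContinuousLinearMap.comp_apply, ContinuousLinearMap.prod_apply,
    fderivInnerCLM_apply, zero_apply, id_eq, hγ.perp _ hm, zero_add,
    ContinuousLinearMap.id_apply] at happly
  exact (sub_eq_zero.1 (inner_self_eq_zero.1 happly)).symm

theorem mem_body_iff (hγ : IsSupportField γ) :
    x ∈ body γ ↔ ∀ n : Sph d, inner ℝ (n : Euc d) x < inner ℝ (n : Euc d) (γ n) := by
  refine ⟨fun hx n => hx n (ne_zero_of_mem_unit_sphere n), fun hx y hy => ?_⟩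
  have hproj := hx (sphereProj y)
  rw [hγ.apply_sphereProj hy, coe_sphereProj hy, inner_smul_left, inner_smul_left] at hproj
  exact lt_of_mul_lt_mul_left hproj (inv_nonneg.2 (norm_nonneg y))

theorem isOpen_body (hγ : IsSupportField γ) : IsOpen (body γ) := by
  have hleft : Continuous fun z : Euc d × Sph d => (inner ℝ (z.2 : Euc d) z.1 : ℝ) := by fun_prop
  have hright : Continuous fun z : Euc d × Sph d => (inner ℝ (z.2 : Euc d) (γ z.2) : ℝ) :=
    (continuous_subtype_val.comp continuous_snd).inner (hγ.continuous_comp_coe.comp continuous_snd)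
  refine isOpen_iff_mem_nhds.2 fun x hx => ?_
  filter_upwards [isCompact_univ.eventually_forall_of_forall_eventually (x₀ := x)
    (K := (univ : Set (Sph d)))
    (P := fun x n => inner ℝ (n : Euc d) x < inner ℝ (n : Euc d) (γ n))
    fun n _ => (isOpen_lt hleft hright).mem_nhds (hγ.mem_body_iff.1 hx n)] with y hy
  exact hγ.mem_body_iff.2 fun n => hy n trivial

theorem isBounded_body (hγ : IsSupportField γ) : Bornology.IsBounded (body γ) := by
  obtain ⟨R, hR⟩ := (isCompact_range hγ.continuous_comp_coe).isBounded.exists_norm_le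
  refine isBounded_iff_forall_norm_le.2 ⟨max R 0, fun x hx => ?_⟩
  obtain rfl | hx0 := eq_or_ne x 0
  · simp
  have hsq : ‖x‖ * ‖x‖ ≤ ‖x‖ * R := calc
    ‖x‖ * ‖x‖ = inner ℝ x x := (real_inner_self_eq_norm_mul_norm x).symm
    _ ≤ inner ℝ x (γ x) := (hx x hx0).le
    _ ≤ ‖x‖ * ‖γ x‖ := real_inner_le_norm x (γ x)
    _ ≤ ‖x‖ * R := by gcongr; exact hR _ (hγ.apply_mem_range hx0)
  exact le_max_of_le_left (le_of_mul_le_mul_left hsq (norm_pos_iff.2 hx0))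

theorem disjoint_body_range : Disjoint (body γ) (range fun u : Sph d => γ u) := by
  rw [disjoint_right]
  rintro _ ⟨m, rfl⟩ hm
  exact lt_irrefl _ (hm m (ne_zero_of_mem_unit_sphere m))

theorem closure_body_subset (hγ : IsSupportField γ) :
    closure (body γ) ⊆ body γ ∪ range fun u : Sph d => γ u := by
  intro x hx
  have hle : ∀ y, y ≠ 0 → inner ℝ y x ≤ inner ℝ y (γ y) := fun y hy =>
    closure_minimal (fun z hz => (hz y hy).le)
      (isClosed_le (by fun_prop : Continuous fun x => (inner ℝ y x : ℝ)) continuous_const) hx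
  by_contra! hxO
  refine hxO (.inl fun y hy => (hle y hy).lt_of_ne fun heq => hxO (.inr ?_))
  exact hγ.eq_apply_of_inner_eq hle hy heq ▸ hγ.apply_mem_range hy

theorem disjoint_body_exterior (hγ : IsSupportField γ) :
    Disjoint (body γ) (exterior (range fun u : Sph d => γ u)) := by
  rw [disjoint_left]
  rintro x hx ⟨hxO, hunbdd⟩
  refine hunbdd (hγ.isBounded_body.subset
    (isPreconnected_connectedComponentIn.subset_of_closure_inter_subset hγ.isOpen_body
      ⟨x, mem_connectedComponentIn hxO, hx⟩ ?_))
  rintro y ⟨hy, hyO⟩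
  exact (hγ.closure_body_subset hy).resolve_right (connectedComponentIn_subset _ _ hyO)

theorem nonempty_body (hγ : IsSupportField γ) (hd : 1 ≤ d) : (body γ).Nonempty := by
  obtain ⟨m, hm⟩ := exists_ne (0 : Euc d)
  have hm' : -m ≠ 0 := neg_ne_zero.2 hm
  refine ⟨(1 / 2 : ℝ) • (γ m + γ (-m)), fun y hy => ?_⟩
  rw [inner_smul_right, inner_add_right]
  by_cases hmy : SameRay ℝ m y
  · have hmy' : ¬SameRay ℝ (-m) y := fun h =>
      hm (eq_zero_of_sameRay_self_neg (hmy.trans h.symm fun h0 => absurd h0 hy))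
    linarith [hγ.inner_lt hd hm' hy hmy', hγ.inner_le hd hm hy]
  · linarith [hγ.inner_lt hd hm hy hmy, hγ.inner_le hd hm' hy]

/-! ### The cone over the hypersurface -/

theorem contDiffAt_cone (hγ : IsSupportField γ) (q : Euc d) (hy : y ≠ 0) :
    ContDiffAt ℝ ∞ (cone γ q) y :=
  contDiffAt_const.add ((contDiffAt_norm ℝ hy).smul ((hγ.contDiffAt hy).sub contDiffAt_const))

theorem exists_equiv_hasFDerivAt_cone (hγ : IsSupportField γ) (hq : q ∈ body γ) (hy : y ≠ 0) :
    ∃ L : Euc d ≃L[ℝ] Euc d, HasFDerivAt (cone γ q) (L : Euc d →L[ℝ] Euc d) y := by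
  have hnorm : DifferentiableAt ℝ (fun y : Euc d => ‖y‖) y :=
    (contDiffAt_norm (n := 1) ℝ hy).differentiableAt one_ne_zero
  set N := fderiv ℝ (fun y : Euc d => ‖y‖) y
  have hcone : HasFDerivAt (cone γ q) (‖y‖ • fderiv ℝ γ y + N.smulRight (γ y - q)) y :=
    (hnorm.hasFDerivAt.smul ((hγ.hasFDerivAt hy).sub_const q)).const_add q
  set D := ‖y‖ • fderiv ℝ γ y + N.smulRight (γ y - q)
  have hker : ∀ w, D w = 0 → w = 0 := by
    intro w hw
    have hDw : ‖y‖ • fderiv ℝ γ y w + N w • (γ y - q) = 0 := hw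
    have hNw : N w = 0 := by
      have hinner := congrArg (inner ℝ y) hDw
      rw [inner_add_right, inner_smul_right, inner_smul_right, hγ.perp y hy, mul_zero, zero_add,
        inner_zero_right, inner_sub_right] at hinner
      exact (mul_eq_zero.1 hinner).resolve_right (sub_pos.2 (hq y hy)).ne'
    rw [hNw, zero_smul, add_zero, smul_eq_zero_iff_right (norm_ne_zero_iff.2 hy)] at hDw
    by_contra hw0
    have hdep : ¬LinearIndependent ℝ ![y, w] := fun h => by
      simpa [hDw] using hγ.inner_fderiv_self_pos h
    obtain ⟨r, rfl⟩ : ∃ r : ℝ, r • y = w := by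
      simpa [LinearIndependent.pair_iff' hy] using hdep
    rw [map_smul, hnorm.fderiv_norm_self, smul_eq_mul, mul_eq_zero] at hNw
    exact hw0 (by rw [hNw.resolve_right (norm_ne_zero_iff.2 hy), zero_smul])
  exact ⟨(LinearEquiv.ofInjectiveEndo D.toLinearMap
    ((injective_iff_map_eq_zero D.toLinearMap).2 hker)).toContinuousLinearEquiv, hcone⟩

theorem inner_cone (γ : Euc d → Euc d) (q y n : Euc d) :
    inner ℝ n (cone γ q y) = inner ℝ n q + ‖y‖ * (inner ℝ n (γ y) - inner ℝ n q) := by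
  rw [cone, inner_add_right, inner_smul_right, inner_sub_right]

theorem cone_mem_body (hγ : IsSupportField γ) (hd : 1 ≤ d) (hq : q ∈ body γ) (hy : y ≠ 0)
    (hy1 : ‖y‖ < 1) : cone γ q y ∈ body γ := by
  intro n hn
  rw [inner_cone]
  nlinarith [hq n hn, hγ.inner_le hd hy hn, norm_nonneg y]

theorem cone_mem_exterior (hγ : IsSupportField γ) (hd : 1 ≤ d) (hq : q ∈ body γ) (hy : y ≠ 0)
    (hy1 : 1 < ‖y‖) : cone γ q y ∈ exterior (range fun u : Sph d => γ u) := by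
  refine mem_exterior_of_forall_inner_lt hy ?_
  rintro _ ⟨m, rfl⟩
  rw [inner_cone]
  nlinarith [hq y hy, hγ.inner_le hd (ne_zero_of_mem_unit_sphere m) hy]

theorem cone_mem_range (hγ : IsSupportField γ) (hy : y ≠ 0) (hy1 : ‖y‖ = 1) :
    cone γ q y ∈ range fun u : Sph d => γ u := by
  rw [cone, hy1, one_smul, add_sub_cancel]
  exact hγ.apply_mem_range hy

theorem cone_mem_range_iff (hγ : IsSupportField γ) (hd : 1 ≤ d) (hq : q ∈ body γ) (hy : y ≠ 0) :
    cone γ q y ∈ range (fun u : Sph d => γ u) ↔ ‖y‖ = 1 := by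
  refine ⟨fun h => ?_, hγ.cone_mem_range hy⟩
  by_contra hne
  obtain hlt | hgt := lt_or_gt_of_ne hne
  · exact disjoint_left.1 disjoint_body_range (hγ.cone_mem_body hd hq hy hlt) h
  · exact (hγ.cone_mem_exterior hd hq hy hgt).1 h

theorem cone_mem_exterior_iff (hγ : IsSupportField γ) (hd : 1 ≤ d) (hq : q ∈ body γ)
    (hy : y ≠ 0) : cone γ q y ∈ exterior (range fun u : Sph d => γ u) ↔ 1 < ‖y‖ := by
  refine ⟨fun h => ?_, hγ.cone_mem_exterior hd hq hy⟩
  by_contra! hle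
  obtain hlt | heq := hle.lt_or_eq
  · exact disjoint_left.1 hγ.disjoint_body_exterior (hγ.cone_mem_body hd hq hy hlt) h
  · exact h.1 (hγ.cone_mem_range hy heq)

end IsSupportField

namespace IsSupportField

variable {d : ℕ} {γ : Euc d → Euc d} {p q v w y : Euc d}

/-! ### A support field parametrizes an ovaloid -/

theorem exists_isOutwardDefiningFunction (hγ : IsSupportField γ) (hd : 1 ≤ d) (u : Sph d) :
    ∃ U f, IsOutwardDefiningFunction (range fun u : Sph d => γ u) (γ u) U f := by
  obtain ⟨q, hq⟩ := hγ.nonempty_body hd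
  have hu : (u : Euc d) ≠ 0 := ne_zero_of_mem_unit_sphere u
  obtain ⟨L, hL⟩ := hγ.exists_equiv_hasFDerivAt_cone hq hu
  -- In the coordinates `y` given by the cone, the hypersurface is `‖y‖ = 1`.
  set e := (hγ.contDiffAt_cone q hu).toOpenPartialHomeomorph (cone γ q) hL (by simp)
  have hus : (u : Euc d) ∈ e.source :=
    (hγ.contDiffAt_cone q hu).mem_toOpenPartialHomeomorph_source hL (by simp)
  have heu : e u = γ u := show cone γ q u = γ u by simp [cone]
  have hcone {x : Euc d} (hx : x ∈ e.target) : cone γ q (e.symm x) = x := e.right_inv hx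
  have hsymm {x : Euc d} (hx : x ∈ e.target) (hx0 : e.symm x ≠ 0) : ContDiffAt ℝ ∞ e.symm x :=
    have ⟨_, hL'⟩ := hγ.exists_equiv_hasFDerivAt_cone hq hx0
    e.contDiffAt_symm hx hL' (hγ.contDiffAt_cone q hx0)
  refine ⟨e.target ∩ e.symm ⁻¹' {0}ᶜ, fun x => ‖e.symm x‖ - 1, ?_, ?_, ?_, ?_, ?_, ?_⟩
  · exact e.symm.isOpen_inter_preimage isOpen_compl_singleton
  · exact heu ▸ ⟨e.map_source hus, by simpa [e.left_inv hus] using hu⟩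
  · rintro x ⟨hx, hx0⟩
    exact (((hsymm hx hx0).norm ℝ hx0).sub contDiffAt_const).contDiffWithinAt
  · rintro x ⟨hx, hx0⟩ hgrad
    obtain ⟨L', hL'⟩ := hγ.exists_equiv_hasFDerivAt_cone hq hx0
    have hnorm : DifferentiableAt ℝ (fun y : Euc d => ‖y‖) (e.symm x) :=
      (contDiffAt_norm (n := 1) ℝ hx0).differentiableAt one_ne_zero
    have hf : HasFDerivAt (fun x => ‖e.symm x‖ - 1) _ x :=
      (hnorm.hasFDerivAt.comp x (e.hasFDerivAt_symm hx hL')).sub_const 1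
    have hzero := inner_gradient_left (𝕜 := ℝ) (f := fun x => ‖e.symm x‖ - 1) (x := x)
      (y := L' (e.symm x))
    rw [hgrad, inner_zero_left, hf.fderiv] at hzero
    refine hx0 (norm_eq_zero.1 (Eq.symm ?_))
    simpa [hnorm.fderiv_norm_self] using hzero
  · rintro x ⟨hx, hx0⟩
    rw [sub_eq_zero, ← hγ.cone_mem_range_iff hd hq hx0, hcone hx]
  · rintro x ⟨hx, hx0⟩
    rw [sub_pos, ← hγ.cone_mem_exterior_iff hd hq hx0, hcone hx]

theorem unitNormal_eq (hγ : IsSupportField γ) (hd : 1 ≤ d) (u : Sph d) {U : Set (Euc d)}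
    {f : Euc d → ℝ}
    (hf : IsOutwardDefiningFunction (range fun u : Sph d => γ u) (γ u) U f) :
    unitNormal f (γ u) = u := by
  refine hf.unitNormal_eq ⟨u, rfl⟩ (norm_eq_of_mem_sphere u) ?_
  rintro _ ⟨m, rfl⟩
  exact hγ.inner_le hd (ne_zero_of_mem_unit_sphere m) (ne_zero_of_mem_unit_sphere u)

theorem isOuterUnitNormal (hγ : IsSupportField γ) (hd : 1 ≤ d) (u : Sph d) :
    IsOuterUnitNormal (range fun u : Sph d => γ u) (γ u) u :=
  have ⟨U, f, hf⟩ := hγ.exists_isOutwardDefiningFunction hd u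
  ⟨⟨u, rfl⟩, U, f, hf, (hγ.unitNormal_eq hd u hf).symm⟩

theorem gaussInverse_eq (hγ : IsSupportField γ) (hd : 1 ≤ d) (u : Sph d) :
    gaussInverse (range fun u : Sph d => γ u) u = γ u := by
  have hspec : IsOuterUnitNormal (range fun u : Sph d => γ u)
      (gaussInverse (range fun u : Sph d => γ u) u) u :=
    Classical.epsilon_spec (p := fun p => IsOuterUnitNormal _ p u) ⟨γ u, hγ.isOuterUnitNormal hd u⟩
  obtain ⟨⟨m, hm⟩, U, f, hf, hu⟩ := hspec
  rw [← hm] at hf hu ⊢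
  rw [Subtype.ext (hu.trans (hγ.unitNormal_eq hd m hf))]

theorem exists_fderiv_eq (hγ : IsSupportField γ) (hy : y ≠ 0) (hv : inner ℝ y v = 0) :
    ∃ w, inner ℝ y w = 0 ∧ fderiv ℝ γ y w = v := by
  let V : Submodule ℝ (Euc d) := (ℝ ∙ y)ᗮ
  have mem_V {w : Euc d} : w ∈ V ↔ inner ℝ y w = 0 :=
    Submodule.mem_orthogonal_singleton_iff_inner_right
  let S : V →ₗ[ℝ] V :=
    (fderiv ℝ γ y).toLinearMap.restrict fun w _ => mem_V.2 (hγ.perp y hy w)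
  have hinj : Function.Injective S := by
    refine (injective_iff_map_eq_zero S).2 fun w hw => ?_
    by_contra hw0
    have hpos := hγ.pos y w hy (mem_V.1 w.2) (by simpa using hw0)
    rw [show fderiv ℝ γ y w = 0 from congrArg Subtype.val hw, inner_zero_left] at hpos
    exact lt_irrefl _ hpos
  obtain ⟨w, hw⟩ := LinearMap.injective_iff_surjective.1 hinj ⟨v, mem_V.2 hv⟩
  exact ⟨w, mem_V.1 w.2, congrArg Subtype.val hw⟩

theorem fderiv_unitNormal_fderiv (hγ : IsSupportField γ) (hd : 1 ≤ d) (u : Sph d)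
    {U : Set (Euc d)} {f : Euc d → ℝ}
    (hf : IsOutwardDefiningFunction (range fun u : Sph d => γ u) (γ u) U f)
    (hw : inner ℝ (u : Euc d) w = 0) :
    fderiv ℝ (unitNormal f) (γ u) (fderiv ℝ γ u w) = w := by
  have hu : (u : Euc d) ≠ 0 := ne_zero_of_mem_unit_sphere u
  have hline : HasDerivAt (fun t : ℝ => (u : Euc d) + t • w) w 0 := by
    simpa using ((hasDerivAt_id (0 : ℝ)).smul_const w).const_add (u : Euc d)
  have hline0 : (u : Euc d) + (0 : ℝ) • w = u := by simp
  have hnormal : DifferentiableAt ℝ (unitNormal f) (γ u) :=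
    (contDiffAt_unitNormal (m := 1) hf.contDiffAt_two (by norm_num)
      (hf.regular _ hf.mem)).differentiableAt one_ne_zero
  have hγline : HasDerivAt (fun t : ℝ => γ ((u : Euc d) + t • w)) (fderiv ℝ γ u w) 0 :=
    HasFDerivAt.comp_hasDerivAt (x := (0 : ℝ)) (l := γ) (hline0.symm ▸ hγ.hasFDerivAt hu) hline
  have hcomp : HasDerivAt (fun t : ℝ => unitNormal f (γ ((u : Euc d) + t • w)))
      (fderiv ℝ (unitNormal f) (γ u) (fderiv ℝ γ u w)) 0 :=
    HasFDerivAt.comp_hasDerivAt (x := (0 : ℝ)) (l := unitNormal f)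
      (hline0.symm ▸ hnormal.hasFDerivAt) hγline
  have hproj := hasDerivAt_coe_sphereProj_comp (u := u) hline hline0
  rw [real_inner_comm, hw, zero_smul, sub_zero] at hproj
  refine hcomp.unique (hproj.congr_of_eventuallyEq ?_)
  filter_upwards [hline.continuousAt.eventually_ne (hline0.symm ▸ hu),
    hγline.continuousAt.eventually (hf.isOpen.mem_nhds (by simpa using hf.mem))] with t ht htU
  rw [← hγ.apply_sphereProj ht] at htU ⊢
  exact hγ.unitNormal_eq hd _ { hf with mem := htU }

theorem curvature_pos (hγ : IsSupportField γ) (hd : 1 ≤ d) {κ : ℝ}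
    (h : IsPrincipalCurvature (range fun u : Sph d => γ u) p κ) : 0 < κ := by
  obtain ⟨⟨u, rfl⟩, U, f, hf, v, hv0, hv, hκ⟩ := h
  have hu : (u : Euc d) ≠ 0 := ne_zero_of_mem_unit_sphere u
  have huv : inner ℝ (u : Euc d) v = 0 := by
    rw [← hγ.unitNormal_eq hd u hf, unitNormal, inner_smul_left, hv, mul_zero]
  obtain ⟨w, huw, rfl⟩ := hγ.exists_fderiv_eq hu huv
  have hw : w = κ • fderiv ℝ γ u w := (hγ.fderiv_unitNormal_fderiv hd u hf huw).symm.trans hκ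
  have hpos : 0 < inner ℝ (fderiv ℝ γ u w) w :=
    hγ.pos u w hu huw fun h0 => hv0 (by rw [h0, map_zero])
  nth_rewrite 2 [hw] at hpos
  rw [inner_smul_right] at hpos
  exact pos_of_mul_pos_left hpos real_inner_self_nonneg

theorem isSupportParametrization (hγ : IsSupportField γ) (hd : 1 ≤ d) :
    IsSupportParametrization (fun u : Sph d => γ u) (range fun u : Sph d => γ u) where
  isOvaloid :=
    { isCompact := isCompact_range hγ.continuous_comp_coe
      isConnected := by
        have hrank : 1 < Module.rank ℝ (Euc d) := by
          rw [← Module.finrank_eq_rank, finrank_euclideanSpace_fin]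
          exact_mod_cast Nat.lt_add_one_iff.2 hd
        have := Subtype.connectedSpace (isConnected_sphere hrank 0 zero_le_one)
        exact isConnected_range hγ.continuous_comp_coe
      hypersurface := by
        rintro _ ⟨u, rfl⟩
        exact hγ.exists_isOutwardDefiningFunction hd u
      curvature_pos := fun _ _ h => hγ.curvature_pos hd h }
  range_eq := rfl
  normal := hγ.isOuterUnitNormal hd

theorem of_unit (smooth : ContDiffOn ℝ ∞ γ {0}ᶜ)
    (smul : ∀ y, ∀ r : ℝ, 0 < r → γ (r • y) = γ y)
    (perp : ∀ y, ‖y‖ = 1 → ∀ w, inner ℝ y (fderiv ℝ γ y w) = 0)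
    (pos : ∀ y w, ‖y‖ = 1 → inner ℝ y w = 0 → w ≠ 0 → 0 < inner ℝ (fderiv ℝ γ y w) w) :
    IsSupportField γ := by
  have hfderiv {y : Euc d} (hy : y ≠ 0) :
      fderiv ℝ γ y = ‖y‖⁻¹ • fderiv ℝ γ (‖y‖⁻¹ • y) := by
    rw [← fderiv_comp_smul]
    exact congrArg (fderiv ℝ · y) (funext fun x => (smul x _ (by positivity)).symm)
  have hunit {y : Euc d} (hy : y ≠ 0) : ‖‖y‖⁻¹ • y‖ = 1 := norm_smul_inv_norm hy
  refine ⟨smooth, smul, fun y hy w => ?_, fun y w hy hyw hw => ?_⟩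
  · have hperp := perp _ (hunit hy) w
    rw [inner_smul_left] at hperp
    rw [hfderiv hy, smul_apply, inner_smul_right,
      (mul_eq_zero.1 hperp).resolve_left (by simpa using hy), mul_zero]
  · rw [hfderiv hy, smul_apply, inner_smul_left]
    exact mul_pos (inv_pos.2 (norm_pos_iff.2 hy))
      (pos _ w (hunit hy) (by rw [inner_smul_left, hyw, mul_zero]) hw)

end IsSupportField

section ParametrizedMaxima

theorem continuousAt_of_isMaxOn {X Y : Type*} [TopologicalSpace X] [TopologicalSpace Y] {K : Set Y}
    (hK : IsCompact K) {h : X × Y → ℝ} {m : X → Y} {x₀ : X}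
    (hh : ∀ y ∈ K, ContinuousAt h (x₀, y))
    (hm : ∀ᶠ x in 𝓝 x₀, m x ∈ K ∧ IsMaxOn (fun y => h (x, y)) K (m x))
    (huniq : ∀ y ∈ K, IsMaxOn (fun y => h (x₀, y)) K y → y = m x₀) : ContinuousAt m x₀ := by
  obtain ⟨hm₀, hmax₀⟩ := hm.self_of_nhds
  refine tendsto_nhds.2 fun W hW hmW => ?_
  have hlt : ∀ᶠ x in 𝓝 x₀, ∀ y ∈ K \ W, h (x, y) < h (x, m x₀) := by
    refine (hK.diff hW).eventually_forall_of_forall_eventually fun y hy => ?_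
    have hne : h (x₀, y) ≠ h (x₀, m x₀) := fun heq =>
      hy.2 (huniq y hy.1 (fun x hx => (hmax₀ hx).trans heq.ge) ▸ hmW)
    have hconst : ContinuousAt (fun a : X × Y => h (a.1, m x₀)) (x₀, y) :=
      ContinuousAt.comp (g := h) (hh _ hm₀) (continuousAt_fst.prodMk continuousAt_const)
    exact (hh y hy.1).eventually_lt hconst ((hmax₀ hy.1).lt_of_ne hne)
  filter_upwards [hlt, hm] with x hx ⟨hmx, hmaxx⟩
  by_contra hxW
  exact (hx (m x) ⟨hmx, hxW⟩).not_ge (hmaxx hm₀)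

theorem contDiffAt_of_fderiv_eq_zero {E F : Type*} [NormedAddCommGroup E] [NormedSpace ℝ E]
    [CompleteSpace E] [NormedAddCommGroup F] [NormedSpace ℝ F] [FiniteDimensional ℝ F]
    {h : E × F → ℝ} {m : E → F} {x₀ : E} (hh : ContDiffAt ℝ ∞ h (x₀, m x₀))
    (hm : ContinuousAt m x₀) (hcrit : ∀ᶠ x in 𝓝 x₀, ∀ w, fderiv ℝ h (x, m x) (0, w) = 0)
    (hnondeg : ∀ w ≠ 0, fderiv ℝ (fderiv ℝ h) (x₀, m x₀) (0, w) (0, w) ≠ 0) :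
    ContDiffAt ℝ ∞ m x₀ := by
  have : CompleteSpace F := FiniteDimensional.complete ℝ F
  let G : E × F → F →L[ℝ] ℝ := fun a => (fderiv ℝ h a).comp (.inr ℝ E F)
  have hh' : ContDiffAt ℝ ∞ (fderiv ℝ h) (x₀, m x₀) := hh.fderiv_right (by simp)
  have hG : ContDiffAt ℝ ∞ G (x₀, m x₀) := hh'.clm_comp contDiffAt_const
  have hGapply (v : E × F) (w : F) :
      fderiv ℝ G (x₀, m x₀) v w = fderiv ℝ (fderiv ℝ h) (x₀, m x₀) v (0, w) := by
    have hGderiv : HasFDerivAt G _ (x₀, m x₀) :=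
      (hh'.differentiableAt (by simp)).hasFDerivAt.clm_comp (hasFDerivAt_const _ _)
    rw [hGderiv.fderiv]
    simp
  have hinj : Function.Injective
      (fderiv ℝ G (x₀, m x₀) ∘L .inr ℝ E F : F →L[ℝ] F →L[ℝ] ℝ).toLinearMap := by
    refine (injective_iff_map_eq_zero _).2 fun w hw => ?_
    by_contra hw0
    exact hnondeg w hw0 ((hGapply (0, w) w).symm.trans (congrArg (· w) hw))
  have hfinrank : Module.finrank ℝ F = Module.finrank ℝ (F →L[ℝ] ℝ) := by
    rw [← Subspace.dual_finrank_eq (K := ℝ) (V := F)]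
    exact (LinearMap.toContinuousLinearMap (𝕜 := ℝ) (E := F) (F' := ℝ)).finrank_eq
  have hinv : (fderiv ℝ G (x₀, m x₀) ∘L .inr ℝ E F).IsInvertible :=
    ⟨(LinearEquiv.ofInjectiveOfFinrankEq _ hinj hfinrank).toContinuousLinearEquiv, by ext1; rfl⟩
  have hGm : ∀ᶠ x in 𝓝 x₀, G (x, m x) = 0 := hcrit.mono fun x hx => ContinuousLinearMap.ext hx
  refine (hG.contDiffAt_implicitFunction (by simp) hinv).congr_of_eventuallyEq ?_
  filter_upwards [hGm, (continuousAt_id.prodMk hm).eventually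
    (hG.eventually_apply_eq_iff_implicitFunction (by simp) hinv)] with x hx hiff
  exact (hiff.1 (hx.trans hGm.self_of_nhds.symm)).symm

end ParametrizedMaxima

section CurvesInOvaloids

variable {d : ℕ} {O U : Set (Euc d)} {p u : Euc d} {f : Euc d → ℝ} {c : ℝ → Euc d} {t : ℝ}

namespace IsOutwardDefiningFunction

theorem comp_eventuallyEq_zero (hf : IsOutwardDefiningFunction O (c t) U f)
    (hc : ContinuousAt c t) (hcO : ∀ᶠ s in 𝓝 t, c s ∈ O) : (fun s => f (c s)) =ᶠ[𝓝 t] 0 := by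
  filter_upwards [hcO, hc.eventually hf.eventually_mem] with s hs hsU
  exact (hf.mem_iff _ hsU).1 hs

theorem fderiv_apply_deriv_eq_zero (hf : IsOutwardDefiningFunction O (c t) U f)
    (hc : DifferentiableAt ℝ c t) (hcO : ∀ᶠ s in 𝓝 t, c s ∈ O) :
    fderiv ℝ f (c t) (deriv c t) = 0 := by
  have hcomp : HasDerivAt (fun s => f (c s)) (fderiv ℝ f (c t) (deriv c t)) t :=
    (hf.contDiffAt.differentiableAt (by simp)).hasFDerivAt.comp_hasDerivAt t hc.hasDerivAt
  exact hcomp.unique ((hasDerivAt_const t (0 : ℝ)).congr_of_eventuallyEq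
    (hf.comp_eventuallyEq_zero hc.continuousAt hcO))

theorem fderiv_apply_deriv_deriv (hf : IsOutwardDefiningFunction O (c t) U f)
    (hc : ContDiffAt ℝ 2 c t) (hcO : ∀ᶠ s in 𝓝 t, c s ∈ O) :
    fderiv ℝ f (c t) (deriv (deriv c) t) =
      -fderiv ℝ (fderiv ℝ f) (c t) (deriv c t) (deriv c t) := by
  have hsecond := deriv_deriv_comp hf.contDiffAt_two hc
  rw [(hf.comp_eventuallyEq_zero hc.continuousAt hcO).deriv.deriv_eq] at hsecond
  simp only [deriv_zero, Pi.zero_apply] at hsecond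
  exact eq_neg_of_add_eq_zero_right hsecond.symm

theorem eq_smul_gradient (hf : IsOutwardDefiningFunction O p U f) (hp : p ∈ O) (hu : u ≠ 0)
    (hmax : IsMaxOn (inner ℝ u) O p) : u = (‖u‖ * ‖gradient f p‖⁻¹) • gradient f p := by
  have hnormal : unitNormal f p = ‖u‖⁻¹ • u := by
    refine hf.unitNormal_eq hp (norm_smul_inv_norm hu) fun y hy => ?_
    rw [inner_smul_left, inner_smul_left]
    exact mul_le_mul_of_nonneg_left (hmax hy) (by simp)
  rw [mul_smul, ← unitNormal, hnormal, smul_inv_smul₀ (norm_ne_zero_iff.2 hu)]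

theorem inner_deriv_deriv (hf : IsOutwardDefiningFunction O (c t) U f) (hu : u ≠ 0)
    (hmax : IsMaxOn (inner ℝ u) O (c t)) (hc : ContDiffAt ℝ 2 c t) (hcO : ∀ᶠ s in 𝓝 t, c s ∈ O) :
    inner ℝ u (deriv (deriv c) t) = -(‖u‖ * ‖gradient f (c t)‖⁻¹ *
      fderiv ℝ (fderiv ℝ f) (c t) (deriv c t) (deriv c t)) := by
  conv_lhs => rw [hf.eq_smul_gradient hcO.self_of_nhds hu hmax]
  rw [real_inner_smul_left, inner_gradient_left, hf.fderiv_apply_deriv_deriv hc hcO, mul_neg]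

end IsOutwardDefiningFunction

namespace IsOvaloid

theorem inner_deriv_deriv_nonpos (hO : IsOvaloid O) (hu : u ≠ 0)
    (hmax : IsMaxOn (inner ℝ u) O (c t)) (hc : ContDiffAt ℝ 2 c t)
    (hcO : ∀ᶠ s in 𝓝 t, c s ∈ O) : inner ℝ u (deriv (deriv c) t) ≤ 0 := by
  obtain ⟨U, f, hf⟩ := hO.hypersurface _ hcO.self_of_nhds
  rw [hf.inner_deriv_deriv hu hmax hc hcO, neg_nonpos]
  obtain h | h := eq_or_ne (deriv c t) 0
  · simp [h]
  · have := hO.fderiv_fderiv_pos hcO.self_of_nhds hf h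
      (hf.fderiv_apply_deriv_eq_zero (hc.differentiableAt two_ne_zero) hcO)
    positivity

theorem inner_deriv_deriv_neg (hO : IsOvaloid O) (hu : u ≠ 0)
    (hmax : IsMaxOn (inner ℝ u) O (c t)) (hc : ContDiffAt ℝ 2 c t)
    (hcO : ∀ᶠ s in 𝓝 t, c s ∈ O) (hc' : deriv c t ≠ 0) : inner ℝ u (deriv (deriv c) t) < 0 := by
  obtain ⟨U, f, hf⟩ := hO.hypersurface _ hcO.self_of_nhds
  rw [hf.inner_deriv_deriv hu hmax hc hcO, neg_lt_zero]
  have := hO.fderiv_fderiv_pos hcO.self_of_nhds hf hc'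
    (hf.fderiv_apply_deriv_eq_zero (hc.differentiableAt two_ne_zero) hcO)
  have := norm_pos_iff.2 (hf.regular _ hf.mem)
  have := norm_pos_iff.2 hu
  positivity

end IsOvaloid

end CurvesInOvaloids

theorem deriv_deriv_inner_left {E : Type*} [NormedAddCommGroup E] [InnerProductSpace ℝ E]
    {c : ℝ → E} {t : ℝ} (hc : ContDiffAt ℝ 2 c t) (u : E) :
    deriv (deriv fun s => inner ℝ u (c s)) t = inner ℝ u (deriv (deriv c) t) := by
  have hL : fderiv ℝ (innerSL ℝ u) = fun _ => innerSL ℝ u := funext fun _ => (innerSL ℝ u).fderiv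
  have hsecond := deriv_deriv_comp (innerSL ℝ u).contDiff.contDiffAt hc
  rwa [hL, fderiv_fun_const, Pi.zero_apply, zero_apply, zero_apply, zero_add] at hsecond

theorem deriv_deriv_sq_norm_sq_sub_one {E : Type*} [NormedAddCommGroup E] [InnerProductSpace ℝ E]
    {y : E} (hy : ‖y‖ = 1) (w : E) :
    deriv (deriv fun s : ℝ => (‖y + s • w‖ ^ 2 - 1) ^ 2) 0 = 8 * inner ℝ y w ^ 2 := by
  have hsq (s : ℝ) : HasDerivAt (fun s : ℝ => ‖y + s • w‖ ^ 2 - 1)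
      (2 * inner ℝ (y + s • w) w) s := by
    simpa using (((hasDerivAt_id s).smul_const w).const_add y).norm_sq.sub_const 1
  have hderiv : deriv (fun s : ℝ => (‖y + s • w‖ ^ 2 - 1) ^ 2) = fun s =>
      2 * (‖y + s • w‖ ^ 2 - 1) * (2 * inner ℝ (y + s • w) w) :=
    funext fun s => by simpa using ((hsq s).fun_pow 2).deriv
  have hinner : DifferentiableAt ℝ (fun s : ℝ => 2 * inner ℝ (y + s • w) w) 0 :=
    (DifferentiableAt.inner ℝ (by fun_prop) (by fun_prop)).const_mul 2
  rw [hderiv, (((hsq 0).const_mul 2).fun_mul hinner.hasDerivAt).deriv]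
  simp only [zero_smul, add_zero, hy]
  ring

/-- A smooth family of ovaloids, each parametrized by an immersion of the unit sphere that is
extended to be constant on rays. -/
structure IsOvaloidFamily {d : ℕ} (A : Euc d × ℝ → Euc d) : Prop where
  smooth : ContDiffOn ℝ ∞ A ({0}ᶜ ×ˢ I)
  inj : ∀ z ∈ I, InjOn (fun y => A (y, z)) (Metric.sphere 0 1)
  smul : ∀ y z, ∀ r : ℝ, 0 < r → A (r • y, z) = A (y, z)
  imm : ∀ z ∈ I, ∀ y w, ‖y‖ = 1 → inner ℝ y w = 0 → w ≠ 0 →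
    fderiv ℝ (fun y => A (y, z)) y w ≠ 0
  ovaloid : ∀ z ∈ I, IsOvaloid ((fun y => A (y, z)) '' Metric.sphere 0 1)

/-- The unit vector `y` at which `A (y, z)` is highest in the direction `u`, where `q = (u, z)`.
It is arbitrary when the maximum is not attained. -/
noncomputable def top {d : ℕ} (A : Euc d × ℝ → Euc d) (q : Euc d × ℝ) : Euc d :=
  Classical.epsilon fun y => y ∈ Metric.sphere 0 1 ∧
    IsMaxOn (fun x => inner ℝ q.1 (A (x, q.2))) (Metric.sphere 0 1) y

/-- The point of the ovaloid `A (·, z)` that is highest in the direction `u`, where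
`q = (u, z)`. -/
noncomputable def support {d : ℕ} (A : Euc d × ℝ → Euc d) (q : Euc d × ℝ) : Euc d :=
  A (top A q, q.2)

/-- The height of `A (y, z)` in the direction `u` as a function of `((u, z), y)`, minus a penalty
that makes its maxima over all `y ≠ 0` nondegenerate also in the radial direction. -/
noncomputable def penalizedHeight {d : ℕ} (A : Euc d × ℝ → Euc d) (a : (Euc d × ℝ) × Euc d) : ℝ :=
  inner ℝ a.1.1 (A (a.2, a.1.2)) - (‖a.2‖ ^ 2 - 1) ^ 2

namespace IsOvaloidFamily

variable {d : ℕ} {A : Euc d × ℝ → Euc d} {q : Euc d × ℝ} {u y w : Euc d} {z : ℝ}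

theorem contDiffAt (hA : IsOvaloidFamily A) (hy : y ≠ 0) (hz : z ∈ I) :
    ContDiffAt ℝ ∞ A (y, z) :=
  hA.smooth.contDiffAt ((isOpen_compl_singleton.prod isOpen_Ioo).mem_nhds ⟨hy, hz⟩)

theorem contDiffAt_left (hA : IsOvaloidFamily A) (hy : y ≠ 0) (hz : z ∈ I) :
    ContDiffAt ℝ ∞ (fun y => A (y, z)) y :=
  (hA.contDiffAt hy hz).comp y (contDiffAt_id.prodMk contDiffAt_const)

theorem contDiffAt_height (hA : IsOvaloidFamily A) (hy : y ≠ 0) (hq : q.2 ∈ I) :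
    ContDiffAt ℝ ∞ (fun a : (Euc d × ℝ) × Euc d => (inner ℝ a.1.1 (A (a.2, a.1.2)) : ℝ))
      (q, y) :=
  contDiffAt_fst.fst.inner ℝ ((hA.contDiffAt hy hq).comp (f := fun a : (Euc d × ℝ) × Euc d =>
    (a.2, a.1.2)) (q, y) (contDiffAt_snd.prodMk contDiffAt_fst.snd))

theorem contDiffAt_penalizedHeight (hA : IsOvaloidFamily A) (hy : y ≠ 0) (hq : q.2 ∈ I) :
    ContDiffAt ℝ ∞ (penalizedHeight A) (q, y) :=
  have hpenalty : ContDiff ℝ ∞ fun a : (Euc d × ℝ) × Euc d => (‖a.2‖ ^ 2 - 1) ^ 2 :=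
    ((contDiff_snd.norm_sq ℝ).sub contDiff_const).pow 2
  (hA.contDiffAt_height hy hq).sub hpenalty.contDiffAt

theorem apply_mem (hA : IsOvaloidFamily A) (hy : y ≠ 0) (z : ℝ) :
    A (y, z) ∈ (fun y => A (y, z)) '' Metric.sphere 0 1 :=
  ⟨‖y‖⁻¹ • y, by simp [norm_smul, hy], hA.smul y z _ (by positivity)⟩

theorem top_spec (hA : IsOvaloidFamily A) (hq : q.2 ∈ I) :
    top A q ∈ Metric.sphere 0 1 ∧
      IsMaxOn (fun x => inner ℝ q.1 (A (x, q.2))) (Metric.sphere 0 1) (top A q) := by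
  refine Classical.epsilon_spec (p := fun y => y ∈ Metric.sphere 0 1 ∧
    IsMaxOn (fun x => inner ℝ q.1 (A (x, q.2))) (Metric.sphere 0 1) y) ?_
  refine (isCompact_sphere (0 : Euc d) 1).exists_isMaxOn ⟨EuclideanSpace.single 0 1, by simp⟩
    fun y hy => ?_
  exact (continuousAt_const.inner (hA.contDiffAt_left
    (ne_zero_of_mem_unit_sphere ⟨y, hy⟩) hq).continuousAt).continuousWithinAt

theorem norm_top (hA : IsOvaloidFamily A) (hq : q.2 ∈ I) : ‖top A q‖ = 1 :=
  mem_sphere_zero_iff_norm.1 (hA.top_spec hq).1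

theorem top_ne_zero (hA : IsOvaloidFamily A) (hq : q.2 ∈ I) : top A q ≠ 0 :=
  norm_ne_zero_iff.1 (by simp [hA.norm_top hq])

theorem support_mem (hA : IsOvaloidFamily A) (hq : q.2 ∈ I) :
    support A q ∈ (fun y => A (y, q.2)) '' Metric.sphere 0 1 :=
  mem_image_of_mem _ (hA.top_spec hq).1

theorem isMaxOn_support (hA : IsOvaloidFamily A) (hq : q.2 ∈ I) :
    IsMaxOn (inner ℝ q.1) ((fun y => A (y, q.2)) '' Metric.sphere 0 1) (support A q) := by
  rintro _ ⟨y, hy, rfl⟩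
  exact (hA.top_spec hq).2 hy

theorem eq_top (hA : IsOvaloidFamily A) (hq0 : q.1 ≠ 0) (hq : q.2 ∈ I)
    (hy : y ∈ Metric.sphere 0 1)
    (hmax : IsMaxOn (fun x => inner ℝ q.1 (A (x, q.2))) (Metric.sphere 0 1) y) : y = top A q := by
  refine hA.inj _ hq hy (hA.top_spec hq).1 ((hA.ovaloid _ hq).eq_of_isMaxOn_inner hq0
    (mem_image_of_mem _ hy) (hA.support_mem hq) ?_ (hA.isMaxOn_support hq))
  rintro _ ⟨x, hx, rfl⟩
  exact hmax hx

theorem top_smul (A : Euc d × ℝ → Euc d) (u : Euc d) (z : ℝ) {r : ℝ} (hr : 0 < r) :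
    top A (r • u, z) = top A (u, z) := by
  simp only [top, isMaxOn_iff, inner_smul_left, conj_trivial, mul_le_mul_iff_right₀ hr]

theorem continuousAt_top (hA : IsOvaloidFamily A) (hq0 : q.1 ≠ 0) (hq : q.2 ∈ I) :
    ContinuousAt (top A) q := by
  let h (a : (Euc d × ℝ) × Euc d) : ℝ := inner ℝ a.1.1 (A (a.2, a.1.2))
  have hcont (y : Euc d) (hy : y ∈ Metric.sphere 0 1) : ContinuousAt h (q, y) :=
    (hA.contDiffAt_height (ne_zero_of_mem_unit_sphere ⟨y, hy⟩) hq).continuousAt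
  refine continuousAt_of_isMaxOn (isCompact_sphere 0 1) hcont ?_
    fun y hy hmax => hA.eq_top hq0 hq hy hmax
  filter_upwards [continuousAt_snd.eventually (isOpen_Ioo.eventually_mem hq)] with x hx
  exact hA.top_spec hx

theorem fderiv_penalizedHeight_top (hA : IsOvaloidFamily A) (hq : q.2 ∈ I) (w : Euc d) :
    fderiv ℝ (penalizedHeight A) (q, top A q) (0, w) = 0 := by
  have hloc : IsLocalMax (fun y => penalizedHeight A (q, y)) (top A q) := by
    filter_upwards [isOpen_compl_singleton.mem_nhds (hA.top_ne_zero hq)] with y hy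
    have hle : inner ℝ q.1 (A (y, q.2)) ≤ inner ℝ q.1 (A (top A q, q.2)) :=
      hA.isMaxOn_support hq (hA.apply_mem hy q.2)
    simp only [penalizedHeight, hA.norm_top hq]
    nlinarith [sq_nonneg (‖y‖ ^ 2 - 1)]
  have hslice : HasFDerivAt (fun y => penalizedHeight A (q, y)) _ (top A q) :=
    ((hA.contDiffAt_penalizedHeight (hA.top_ne_zero hq) hq).differentiableAt
      (by simp)).hasFDerivAt.comp _ (hasFDerivAt_prodMk_right q (top A q))
  exact congrArg (· w) (hloc.hasFDerivAt_eq_zero hslice)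

theorem contDiffAt_line (hA : IsOvaloidFamily A) (hy : y ≠ 0) (hz : z ∈ I) (w : Euc d) :
    ContDiffAt ℝ ∞ (fun s : ℝ => A (y + s • w, z)) 0 :=
  ContDiffAt.comp (g := fun y => A (y, z)) 0 (hA.contDiffAt_left (by simpa using hy) hz)
    (by fun_prop)

theorem deriv_line (hA : IsOvaloidFamily A) (hy : y ≠ 0) (hz : z ∈ I) (w : Euc d) :
    deriv (fun s : ℝ => A (y + s • w, z)) 0 = fderiv ℝ (fun y => A (y, z)) y w :=
  (((hA.contDiffAt_left hy hz).differentiableAt (by simp)).hasFDerivAt.hasLineDerivAt w).deriv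

theorem fderiv_fderiv_penalizedHeight (hA : IsOvaloidFamily A) (hy : ‖y‖ = 1) (hz : z ∈ I)
    (u w : Euc d) :
    fderiv ℝ (fderiv ℝ (penalizedHeight A)) ((u, z), y) (0, w) (0, w) =
      inner ℝ u (deriv (deriv fun s : ℝ => A (y + s • w, z)) 0) - 8 * inner ℝ y w ^ 2 := by
  have hy0 : y ≠ 0 := norm_ne_zero_iff.1 (by simp [hy])
  have hline : (fun s : ℝ => penalizedHeight A
      (AffineMap.lineMap ((u, z), y) ((u, z), y + w) s)) = fun s =>
      inner ℝ u (A (y + s • w, z)) - (‖y + s • w‖ ^ 2 - 1) ^ 2 := by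
    funext s
    simp [penalizedHeight, AffineMap.lineMap_apply, add_comm]
  have hsecond := deriv_deriv_comp_lineMap (f := penalizedHeight A) (x := ((u, z), y))
    (y := ((u, z), y + w)) (t := 0) (by
      rw [AffineMap.lineMap_apply_zero]
      exact (hA.contDiffAt_penalizedHeight hy0 hz).of_le (by norm_cast))
  rw [hline, AffineMap.lineMap_apply_zero, Prod.mk_sub_mk, sub_self, add_sub_cancel_left]
    at hsecond
  have hc : ContDiffAt ℝ 2 (fun s : ℝ => A (y + s • w, z)) 0 :=
    (hA.contDiffAt_line hy0 hz w).of_le (by norm_cast)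
  have hpenalty : ContDiffAt ℝ 2 (fun s : ℝ => (‖y + s • w‖ ^ 2 - 1) ^ 2) 0 :=
    (((contDiff_const.add (contDiff_id.smul contDiff_const)).norm_sq ℝ).sub
      contDiff_const).pow 2 |>.contDiffAt
  have hsub := iteratedDeriv_fun_sub (contDiffAt_const (c := u).inner ℝ hc) hpenalty
  simp only [iteratedDeriv_succ, iteratedDeriv_zero] at hsub
  rw [← hsecond, hsub, deriv_deriv_inner_left hc, deriv_deriv_sq_norm_sq_sub_one hy]

theorem fderiv_fderiv_penalizedHeight_top_neg (hA : IsOvaloidFamily A) (hq0 : q.1 ≠ 0)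
    (hq : q.2 ∈ I) (hw : w ≠ 0) :
    fderiv ℝ (fderiv ℝ (penalizedHeight A)) (q, top A q) (0, w) (0, w) < 0 := by
  have htop := hA.top_ne_zero hq
  have hc : ContDiffAt ℝ 2 (fun s : ℝ => A (top A q + s • w, q.2)) 0 :=
    (hA.contDiffAt_line htop hq w).of_le (by norm_cast)
  have hcO : ∀ᶠ s : ℝ in 𝓝 0,
      A (top A q + s • w, q.2) ∈ (fun y => A (y, q.2)) '' Metric.sphere 0 1 := by
    have hline : ContinuousAt (fun s : ℝ => top A q + s • w) 0 := by fun_prop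
    filter_upwards [hline.eventually_ne (by simpa using htop)] with s hs
    exact hA.apply_mem hs q.2
  have hmax : IsMaxOn (inner ℝ q.1) ((fun y => A (y, q.2)) '' Metric.sphere 0 1)
      (A (top A q + (0 : ℝ) • w, q.2)) := by
    simpa only [zero_smul, add_zero, support] using hA.isMaxOn_support hq
  rw [hA.fderiv_fderiv_penalizedHeight (hA.norm_top hq) hq]
  by_cases hperp : inner ℝ (top A q) w = 0
  · have hneg := (hA.ovaloid _ hq).inner_deriv_deriv_neg hq0 hmax hc hcO
      (hA.deriv_line htop hq w ▸ hA.imm _ hq _ w (hA.norm_top hq) hperp hw)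
    simpa [hperp] using hneg
  · have := (hA.ovaloid _ hq).inner_deriv_deriv_nonpos hq0 hmax hc hcO
    have : 0 < inner ℝ (top A q) w ^ 2 := by positivity
    linarith

theorem contDiffAt_top (hA : IsOvaloidFamily A) (hq0 : q.1 ≠ 0) (hq : q.2 ∈ I) :
    ContDiffAt ℝ ∞ (top A) q := by
  refine contDiffAt_of_fderiv_eq_zero (hA.contDiffAt_penalizedHeight (hA.top_ne_zero hq) hq)
    (hA.continuousAt_top hq0 hq) ?_
    fun w hw => (hA.fderiv_fderiv_penalizedHeight_top_neg hq0 hq hw).ne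
  filter_upwards [continuousAt_snd.eventually (isOpen_Ioo.eventually_mem hq)] with x hx
  exact hA.fderiv_penalizedHeight_top hx

theorem contDiffAt_support (hA : IsOvaloidFamily A) (hq0 : q.1 ≠ 0) (hq : q.2 ∈ I) :
    ContDiffAt ℝ ∞ (support A) q :=
  (hA.contDiffAt (hA.top_ne_zero hq) hq).comp q ((hA.contDiffAt_top hq0 hq).prodMk contDiffAt_snd)

end IsOvaloidFamily

theorem IsSupportField.const_add {d : ℕ} {γ : Euc d → Euc d} (hγ : IsSupportField γ) (b : Euc d) :
    IsSupportField fun y => b + γ y where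
  smooth := contDiffOn_const.add hγ.smooth
  smul y r hr := congrArg (b + ·) (hγ.smul y r hr)
  perp := by simpa only [fderiv_const_add] using hγ.perp
  pos := by simpa only [fderiv_const_add] using hγ.pos

theorem inner_fderiv_eq_zero_of_isLocalMax {d : ℕ} {γ : Euc d → Euc d} {y : Euc d}
    (hγ : DifferentiableAt ℝ γ y) (hmax : IsLocalMax (fun x => inner ℝ y (γ x)) y) (w : Euc d) :
    inner ℝ y (fderiv ℝ γ y w) = 0 :=
  congrArg (· w) (hmax.hasFDerivAt_eq_zero ((innerSL ℝ y).hasFDerivAt.comp y hγ.hasFDerivAt))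

namespace IsOvaloidFamily

variable {d : ℕ} {A : Euc d × ℝ → Euc d} {u w : Euc d} {z : ℝ}

theorem contDiffAt_support_left (hA : IsOvaloidFamily A) (hu : u ≠ 0) (hz : z ∈ I) :
    ContDiffAt ℝ ∞ (fun u => support A (u, z)) u :=
  ContDiffAt.comp (g := support A) u (hA.contDiffAt_support (q := (u, z)) hu hz)
    (contDiffAt_id.prodMk contDiffAt_const)

theorem unitNormal_support (hA : IsOvaloidFamily A) (hu : u ≠ 0) (hz : z ∈ I) {U : Set (Euc d)}
    {f : Euc d → ℝ} (hf : IsOutwardDefiningFunction ((fun y => A (y, z)) '' Metric.sphere 0 1)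
      (support A (u, z)) U f) : unitNormal f (support A (u, z)) = sphereProj u := by
  refine hf.unitNormal_eq (hA.support_mem (q := (u, z)) hz) (norm_eq_of_mem_sphere _)
    fun y hy => ?_
  rw [coe_sphereProj hu, inner_smul_left, inner_smul_left]
  exact mul_le_mul_of_nonneg_left (hA.isMaxOn_support (q := (u, z)) hz hy) (by simp)

theorem inner_fderiv_support (hA : IsOvaloidFamily A) (hz : z ∈ I) (hu : u ≠ 0) (w : Euc d) :
    inner ℝ u (fderiv ℝ (fun u => support A (u, z)) u w) = 0 :=
  inner_fderiv_eq_zero_of_isLocalMax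
    ((hA.contDiffAt_support_left hu hz).differentiableAt (by simp))
    (Eventually.of_forall fun x => hA.isMaxOn_support (q := (u, z)) hz
      (hA.support_mem (q := (x, z)) hz)) w

theorem fderiv_unitNormal_fderiv_support (hA : IsOvaloidFamily A) (hz : z ∈ I) (hu : ‖u‖ = 1)
    (hw : inner ℝ u w = 0) {U : Set (Euc d)} {f : Euc d → ℝ}
    (hf : IsOutwardDefiningFunction ((fun y => A (y, z)) '' Metric.sphere 0 1)
      (support A (u, z)) U f) :
    fderiv ℝ (unitNormal f) (support A (u, z)) (fderiv ℝ (fun u => support A (u, z)) u w) = w := by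
  have hu0 : u ≠ 0 := norm_ne_zero_iff.1 (by simp [hu])
  have hS := (hA.contDiffAt_support_left hu0 hz).differentiableAt (by simp)
  have hN : DifferentiableAt ℝ (unitNormal f) (support A (u, z)) :=
    (contDiffAt_unitNormal (m := ∞) hf.contDiffAt (by simp)
      (hf.regular _ hf.mem)).differentiableAt (by simp)
  have hcomp := (hN.hasFDerivAt.comp u hS.hasFDerivAt).hasLineDerivAt w
  have hline : HasDerivAt (fun t : ℝ => u + t • w) w 0 := by
    simpa using ((hasDerivAt_id (0 : ℝ)).smul_const w).const_add u
  have hproj := hasDerivAt_coe_sphereProj_comp (u := ⟨u, mem_sphere_zero_iff_norm.2 hu⟩) hline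
    (by simp)
  rw [real_inner_comm, hw, zero_smul, sub_zero] at hproj
  refine (hcomp : HasDerivAt _ _ _).unique (hproj.congr_of_eventuallyEq ?_)
  have hne : ∀ᶠ v in 𝓝 u, v ≠ 0 ∧ support A (v, z) ∈ U :=
    (eventually_ne_nhds hu0).and
      (hS.continuousAt.eventually (hf.isOpen.eventually_mem hf.mem))
  have hline0 : Tendsto (fun t : ℝ => u + t • w) (𝓝 0) (𝓝 u) := by
    simpa using hline.continuousAt.tendsto
  filter_upwards [hline0.eventually hne] with t ⟨ht, htU⟩
  exact hA.unitNormal_support ht hz { hf with mem := htU }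

theorem inner_fderiv_support_pos (hA : IsOvaloidFamily A) (hz : z ∈ I) (hu : ‖u‖ = 1)
    (hw : inner ℝ u w = 0) (hw0 : w ≠ 0) :
    0 < inner ℝ (fderiv ℝ (fun u => support A (u, z)) u w) w := by
  have hu0 : u ≠ 0 := norm_ne_zero_iff.1 (by simp [hu])
  have hO := hA.ovaloid z hz
  have hp := hA.support_mem (q := (u, z)) hz
  obtain ⟨U, f, hf⟩ := hO.hypersurface _ hp
  have hgrad := hf.regular _ hf.mem
  set D := fderiv ℝ (fun u => support A (u, z)) u w
  have hDw : fderiv ℝ (unitNormal f) (support A (u, z)) D = w :=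
    hA.fderiv_unitNormal_fderiv_support hz hu hw hf
  have hD0 : D ≠ 0 := fun h => hw0 (by rw [← hDw, h, map_zero])
  have htan : inner ℝ (gradient f (support A (u, z))) D = 0 := by
    rw [← norm_gradient_smul_unitNormal hgrad, hA.unitNormal_support hu0 hz hf, coe_sphereProj hu0,
      inner_smul_left, inner_smul_left, hA.inner_fderiv_support hz hu0, mul_zero, mul_zero]
  have hcurv := hO.fderiv_fderiv_pos hp hf hD0 (by rwa [← inner_gradient_left])
  rw [real_inner_comm, ← hDw, inner_fderiv_unitNormal hf.contDiffAt_two hgrad htan]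
  have := norm_pos_iff.2 hgrad
  positivity

theorem isSupportField_support (hA : IsOvaloidFamily A) (hz : z ∈ I) :
    IsSupportField fun u => support A (u, z) := by
  have hsmul (u : Euc d) (r : ℝ) (hr : 0 < r) : support A (r • u, z) = support A (u, z) := by
    rw [support, support, top_smul A u z hr]
  refine .of_unit (fun _ hu => (hA.contDiffAt_support_left hu hz).contDiffWithinAt) hsmul
    (fun u hu => ?_) fun _ _ hu => hA.inner_fderiv_support_pos hz hu
  have hu0 : u ≠ 0 := norm_ne_zero_iff.1 (by rw [hu]; exact one_ne_zero)
  exact hA.inner_fderiv_support hz hu0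

theorem range_support (hA : IsOvaloidFamily A) (hz : z ∈ I) :
    range (fun u : Sph d => support A (u, z)) = (fun y => A (y, z)) '' Metric.sphere 0 1 := by
  refine Subset.antisymm
    (range_subset_iff.2 fun u => hA.support_mem (q := ((u : Euc d), z)) hz) ?_
  rintro _ ⟨y, hy, rfl⟩
  have hO := hA.ovaloid z hz
  have hp := mem_image_of_mem (fun y => A (y, z)) hy
  obtain ⟨U, f, hf⟩ := hO.hypersurface _ hp
  have hn : ‖unitNormal f (A (y, z))‖ = 1 := norm_unitNormal (hf.regular _ hf.mem)
  have htop : y = top A (unitNormal f (A (y, z)), z) :=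
    hA.eq_top (norm_ne_zero_iff.1 (by simp [hn])) hz hy
      fun x hx => hO.inner_unitNormal_le hp hf (mem_image_of_mem _ hx)
  exact ⟨⟨_, mem_sphere_zero_iff_norm.2 hn⟩, congrArg (fun y => A (y, z)) htop.symm⟩

end IsOvaloidFamily

section FixedPoint

variable {E : Type*} [NormedAddCommGroup E] [NormedSpace ℝ E] {g : E × ℝ → ℝ} {x : E}

theorem hasDerivAt_comp_prodMk_right {F : Type*} [NormedAddCommGroup F] [NormedSpace ℝ F]
    {f : E × ℝ → F} {s : ℝ} (hf : DifferentiableAt ℝ f (x, s)) :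
    HasDerivAt (fun s => f (x, s)) (fderiv ℝ f (x, s) (0, 1)) s :=
  HasFDerivAt.comp_hasDerivAt (l := f) s hf.hasFDerivAt
    ((hasDerivAt_const s x).prodMk (hasDerivAt_id s))

theorem contDiffAt_of_forall_eq_zero_imp_eq [CompleteSpace E] {σ : E → ℝ} {V : Set ℝ}
    (hg : ContDiffAt ℝ ∞ g (x, σ x)) (hzero : g (x, σ x) = 0)
    (hderiv : deriv (fun s => g (x, s)) (σ x) ≠ 0) (hV : V ∈ 𝓝 (σ x))
    (hunique : ∀ᶠ y in 𝓝 x, ∀ s ∈ V, g (y, s) = 0 → s = σ y) : ContDiffAt ℝ ∞ σ x := by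
  rw [(hasDerivAt_comp_prodMk_right (hg.differentiableAt (by simp))).deriv] at hderiv
  have hinv : (fderiv ℝ g (x, σ x) ∘L .inr ℝ E ℝ).IsInvertible := by
    refine ⟨.unitsEquivAut ℝ (.mk0 _ hderiv), ?_⟩
    ext
    simp
  have hσ := hg.contDiffAt_implicitFunction (by simp) hinv
  have hσV : ∀ᶠ y in 𝓝 x, hg.implicitFunction (by simp) hinv y ∈ V :=
    hσ.continuousAt.eventually_mem (by rwa [hg.implicitFunction_apply_self (by simp) hinv])
  refine hσ.congr_of_eventuallyEq ?_
  filter_upwards [hunique, hσV, hg.eventually_apply_implicitFunction (by simp) hinv]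
    with y hy hyV hgy
  exact (hy _ hyV (hgy.trans hzero)).symm

theorem strictAntiOn_sub_id_of_abs_deriv_lt_one {h : ℝ → ℝ} {s : Set ℝ} (hs : Convex ℝ s)
    (hh : ∀ x ∈ s, DifferentiableAt ℝ h x) (hlt : ∀ x ∈ s, |deriv h x| < 1) :
    StrictAntiOn (fun x => h x - x) s := by
  refine strictAntiOn_of_deriv_neg hs (fun x hx =>
    ((hh x hx).sub differentiableAt_id).continuousAt.continuousWithinAt) fun x hx => ?_
  have hx := interior_subset hx
  rw [deriv_fun_sub (hh x hx) differentiableAt_fun_id, deriv_id'', sub_neg]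
  exact (abs_lt.1 (hlt x hx)).2

theorem exists_mem_Ioo_eq_self_of_abs_lt {h : ℝ → ℝ} {r : ℝ} (hr : 0 ≤ r)
    (hh : ContinuousOn h (Icc (-r) r)) (hlt : ∀ s ∈ Icc (-r) r, |h s| < r) :
    ∃ s ∈ Ioo (-r) r, h s = s := by
  have hr' : -r ≤ r := neg_le_self hr
  obtain ⟨s, hs, hs0⟩ := intermediate_value_Ioo' hr' (hh.sub continuousOn_id)
    (show (0 : ℝ) ∈ Ioo _ _ from
      ⟨sub_neg.2 (abs_lt.1 (hlt r (right_mem_Icc.2 hr'))).2,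
        sub_pos.2 (abs_lt.1 (hlt (-r) (left_mem_Icc.2 hr'))).1⟩)
  exact ⟨s, hs, sub_eq_zero.1 hs0⟩

theorem exists_contDiffOn_fixedPoint [CompleteSpace E] {W : Set E} {r : ℝ} (hr : 0 ≤ r)
    (hW : IsOpen W) (hg : ∀ x ∈ W, ∀ s ∈ Icc (-r) r, ContDiffAt ℝ ∞ g (x, s))
    (hlt : ∀ x ∈ W, ∀ s ∈ Icc (-r) r, |g (x, s)| < r)
    (hderiv : ∀ x ∈ W, ∀ s ∈ Icc (-r) r, |deriv (fun s => g (x, s)) s| < 1) :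
    ∃ σ : E → ℝ, ContDiffOn ℝ ∞ σ W ∧ (∀ x ∈ W, σ x ∈ Ioo (-r) r) ∧
      ∀ x ∈ W, ∀ s ∈ Icc (-r) r, g (x, s) = s ↔ s = σ x := by
  have hdiff (x : E) (hx : x ∈ W) (s : ℝ) (hs : s ∈ Icc (-r) r) :
      DifferentiableAt ℝ (fun s => g (x, s)) s :=
    (hasDerivAt_comp_prodMk_right ((hg x hx s hs).differentiableAt (by simp))).differentiableAt
  have hex (x : E) (hx : x ∈ W) : ∃ s ∈ Ioo (-r) r, g (x, s) = s :=
    exists_mem_Ioo_eq_self_of_abs_lt hr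
      (fun s hs => (hdiff x hx s hs).continuousAt.continuousWithinAt) (hlt x hx)
  choose! σ hσ hσ_eq using hex
  have hunique (x : E) (hx : x ∈ W) (s : ℝ) (hs : s ∈ Icc (-r) r) : g (x, s) = s ↔ s = σ x := by
    refine ⟨fun h => ?_, fun h => h ▸ hσ_eq x hx⟩
    refine (strictAntiOn_sub_id_of_abs_deriv_lt_one (convex_Icc _ _) (hdiff x hx)
      (hderiv x hx)).injOn hs (Ioo_subset_Icc_self (hσ x hx)) ?_
    exact (sub_eq_zero.2 h).trans (sub_eq_zero.2 (hσ_eq x hx)).symm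
  refine ⟨σ, fun x hx => ContDiffAt.contDiffWithinAt ?_, hσ, hunique⟩
  have hσx := Ioo_subset_Icc_self (hσ x hx)
  refine contDiffAt_of_forall_eq_zero_imp_eq (g := fun a => g a - a.2)
    ((hg x hx _ hσx).sub contDiffAt_snd) (sub_eq_zero.2 (hσ_eq x hx)) ?_ (Ioo_mem_nhds
    (hσ x hx).1 (hσ x hx).2) ?_
  · rw [deriv_fun_sub (hdiff x hx _ hσx) differentiableAt_fun_id, deriv_id'']
    exact sub_ne_zero.2 (abs_lt.1 (hderiv x hx _ hσx)).2.ne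
  · filter_upwards [hW.mem_nhds hx] with y hy s hs h
    exact (hunique y hy s (Ioo_subset_Icc_self hs)).1 (sub_eq_zero.1 h)

end FixedPoint

section Radial

variable {d : ℕ} {g : (ℝ × Euc d) × ℝ → ℝ} {ε₀ r : ℝ}

theorem isOpen_strip (δ : ℝ) : IsOpen (Ioo (-δ) δ ×ˢ ({0}ᶜ : Set (Euc d))) :=
  isOpen_Ioo.prod isOpen_compl_singleton

theorem eventually_abs_lt_and_abs_deriv_lt (hr : 0 < r)
    (hg : ∀ u ≠ 0, ∀ s ∈ Icc (-r) r, ContDiffAt ℝ ∞ g ((0, u), s))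
    (hzero : ∀ u s, g ((0, u), s) = 0) :
    ∀ᶠ ε in 𝓝 0, ∀ u : Euc d, ‖u‖ = 1 → ∀ s ∈ Icc (-r) r,
      |g ((ε, u), s)| < r ∧ |deriv (fun s => g ((ε, u), s)) s| < 1 := by
  have hcompact : IsCompact (Metric.sphere (0 : Euc d) 1 ×ˢ Icc (-r) r) :=
    (isCompact_sphere _ _).prod isCompact_Icc
  have key := hcompact.eventually_forall_of_forall_eventually (x₀ := (0 : ℝ))
    (P := fun ε a => |g ((ε, a.1), a.2)| < r ∧ |deriv (fun s => g ((ε, a.1), s)) a.2| < 1) ?_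
  · exact key.mono fun ε h u hu s hs => h (u, s) ⟨mem_sphere_zero_iff_norm.2 hu, hs⟩
  rintro ⟨u, s⟩ ⟨hu, hs⟩
  have hgu := hg u (ne_zero_of_mem_unit_sphere ⟨u, hu⟩) s hs
  have hassoc : Tendsto (fun q : ℝ × Euc d × ℝ => ((q.1, q.2.1), q.2.2)) (𝓝 (0, u, s))
      (𝓝 ((0, u), s)) := Continuous.tendsto (by fun_prop) _
  have hg' : ContinuousAt (fun a => fderiv ℝ g a (0, 1)) ((0, u), s) :=
    ((hgu.fderiv_right (m := 0) (by simp)).continuousAt).clm_apply continuousAt_const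
  have hg'0 : fderiv ℝ g ((0, u), s) (0, 1) = 0 := by
    rw [← (hasDerivAt_comp_prodMk_right (hgu.differentiableAt (by simp))).deriv]
    simp only [hzero, deriv_const]
  have hdiff : ∀ᶠ a in 𝓝 ((0, u), s), DifferentiableAt ℝ g a :=
    ((hgu.of_le (m := 1) (by simp)).eventually (by simp)).mono fun a ha =>
      ha.differentiableAt (by simp)
  have hsmall : ∀ᶠ a in 𝓝 ((0, u), s), |g a| < r :=
    hgu.continuousAt.abs.eventually_lt_const (by simpa only [hzero, abs_zero] using hr)
  have hsmall' : ∀ᶠ a in 𝓝 ((0, u), s), |fderiv ℝ g a (0, 1)| < 1 :=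
    hg'.abs.eventually_lt_const (by simp only [hg'0, abs_zero, zero_lt_one])
  filter_upwards [hassoc.eventually hsmall, hassoc.eventually hsmall', hassoc.eventually hdiff]
    with q hq hq' hqd
  rw [(hasDerivAt_comp_prodMk_right hqd).deriv]
  exact ⟨hq, hq'⟩

theorem exists_contDiffOn_fixedPoint_of_smul (hε₀ : 0 < ε₀) (hr : 0 < r)
    (hg : ∀ ε ∈ Ioo (-ε₀) ε₀, ∀ u ≠ 0, ∀ s ∈ Icc (-r) r, ContDiffAt ℝ ∞ g ((ε, u), s))
    (hzero : ∀ u s, g ((0, u), s) = 0)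
    (hsmul : ∀ ε u s, ∀ t : ℝ, 0 < t → g ((ε, t • u), s) = g ((ε, u), s)) :
    ∃ δ, 0 < δ ∧ δ ≤ ε₀ ∧ ∃ σ : ℝ × Euc d → ℝ, ContDiffOn ℝ ∞ σ (Ioo (-δ) δ ×ˢ {0}ᶜ) ∧
      (∀ ε ∈ Ioo (-δ) δ, ∀ u ≠ 0, ∀ t : ℝ, 0 < t → σ (ε, t • u) = σ (ε, u)) ∧
      (∀ ε ∈ Ioo (-δ) δ, ∀ u ≠ 0, σ (ε, u) ∈ Ioo (-r) r) ∧
      ∀ ε ∈ Ioo (-δ) δ, ∀ u ≠ 0, ∀ s ∈ Icc (-r) r, g ((ε, u), s) = s ↔ s = σ (ε, u) := by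
  obtain ⟨δ₀, hδ₀, hsmall⟩ := Metric.eventually_nhds_iff.1 (eventually_abs_lt_and_abs_deriv_lt hr
    (hg 0 ⟨neg_lt_zero.2 hε₀, hε₀⟩) hzero)
  set δ := min δ₀ ε₀
  have hmem {ε : ℝ} (hε : ε ∈ Ioo (-δ) δ) : ε ∈ Ioo (-ε₀) ε₀ :=
    abs_lt.1 ((abs_lt.2 hε).trans_le (min_le_right _ _))
  have hbound (ε : ℝ) (hε : ε ∈ Ioo (-δ) δ) (u : Euc d) (hu : u ≠ 0) (s : ℝ)
      (hs : s ∈ Icc (-r) r) : |g ((ε, u), s)| < r ∧ |deriv (fun s => g ((ε, u), s)) s| < 1 := by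
    have hdist : dist ε 0 < δ₀ := by
      rw [dist_zero_right]
      exact (abs_lt.2 hε).trans_le (min_le_left _ _)
    simpa only [hsmul ε u _ _ (inv_pos.2 (norm_pos_iff.2 hu))] using
      hsmall hdist (‖u‖⁻¹ • u) (norm_smul_inv_norm hu) s hs
  obtain ⟨σ, hσ, hσr, hσ_iff⟩ := exists_contDiffOn_fixedPoint hr.le (isOpen_strip δ)
    (fun q hq => hg q.1 (hmem hq.1) q.2 hq.2) (fun q hq s hs => (hbound q.1 hq.1 q.2 hq.2 s hs).1)
    (fun q hq s hs => (hbound q.1 hq.1 q.2 hq.2 s hs).2)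
  refine ⟨δ, lt_min hδ₀ hε₀, min_le_right _ _, σ, hσ, fun ε hε u hu t ht => ?_,
    fun ε hε u hu => hσr (ε, u) ⟨hε, hu⟩, fun ε hε u hu => hσ_iff (ε, u) ⟨hε, hu⟩⟩
  have htu : t • u ≠ 0 := smul_ne_zero ht.ne' hu
  have hσt := Ioo_subset_Icc_self (hσr (ε, t • u) ⟨hε, htu⟩)
  rw [← hσ_iff (ε, u) ⟨hε, hu⟩ _ hσt, ← hsmul ε u _ t ht]
  exact (hσ_iff (ε, t • u) ⟨hε, htu⟩ _ hσt).2 rfl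

end Radial

/-- A bounded smooth family of support fields, one for each height `z ∈ I`. -/
structure IsSupportFamily {d : ℕ} (Γ : Euc d × ℝ → Euc d) : Prop where
  smooth : ContDiffOn ℝ ∞ Γ ({0}ᶜ ×ˢ I)
  smul : ∀ u z, ∀ t : ℝ, 0 < t → Γ (t • u, z) = Γ (u, z)
  isSupportField : ∀ z ∈ I, IsSupportField fun u => Γ (u, z)
  isBounded : Bornology.IsBounded (Γ '' ({0}ᶜ ×ˢ I))

/-- `ζ (ε, u)` is the height at which the section tilted by `ε` has the horizontal normal
direction `u`. Like the support fields, it is constant on rays in `u`. -/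
structure IsTiltedHeight {d : ℕ} (Γ : Euc d × ℝ → Euc d) (τ : Euc d) (z₀ δ : ℝ)
    (ζ : ℝ × Euc d → ℝ) : Prop where
  smooth : ContDiffOn ℝ ∞ ζ (Ioo (-δ) δ ×ˢ {0}ᶜ)
  smul : ∀ ε ∈ Ioo (-δ) δ, ∀ u ≠ 0, ∀ t : ℝ, 0 < t → ζ (ε, t • u) = ζ (ε, u)
  mem : ∀ ε ∈ Ioo (-δ) δ, ∀ u ≠ 0, ζ (ε, u) ∈ I
  solves_iff : ∀ ε ∈ Ioo (-δ) δ, ∀ u ≠ 0, ∀ z ∈ I,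
    z = z₀ + ε * inner ℝ τ (Γ (u, z)) ↔ z = ζ (ε, u)

/-- The speed, in the direction of the normal vector `q.2`, at which the horizontal section moves
with the height, at the height `ζ q`. It is homogeneous of degree one in `q.2`. -/
noncomputable def normalVelocity {d : ℕ} (Γ : Euc d × ℝ → Euc d) (ζ : ℝ × Euc d → ℝ)
    (q : ℝ × Euc d) : ℝ :=
  inner ℝ q.2 (fderiv ℝ Γ (q.2, ζ q) (0, 1))

/-- A normal vector of the section tilted by `q.1` at its point with horizontal normal `q.2`. -/
noncomputable def tiltedNormal {d : ℕ} (Γ : Euc d × ℝ → Euc d) (τ : Euc d) (ζ : ℝ × Euc d → ℝ)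
    (q : ℝ × Euc d) : Euc d :=
  q.2 - (q.1 * normalVelocity Γ ζ q) • τ

/-- The unit vector in the direction `q.2`, displaced by `σ q` in the direction `τ`. For a suitable
`σ` this is the horizontal normal at the point of the tilted section with normal `q.2`. -/
noncomputable def displaced {d : ℕ} (τ : Euc d) (σ : ℝ × Euc d → ℝ) (q : ℝ × Euc d) : Euc d :=
  ‖q.2‖⁻¹ • q.2 + σ q • τ

/-- For tilts `|ε| < δ` the displacement `σ` solves the fixed point equation which makes
`displaced τ σ (ε, ·)` an inverse, up to scale, of `tiltedNormal Γ τ ζ (ε, ·)`. -/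
structure IsTilt {d : ℕ} (Γ : Euc d × ℝ → Euc d) (τ : Euc d) (ζ : ℝ × Euc d → ℝ) (δ : ℝ)
    (σ : ℝ × Euc d → ℝ) : Prop where
  smooth : ContDiffOn ℝ ∞ σ (Ioo (-δ) δ ×ˢ {0}ᶜ)
  smul : ∀ ε ∈ Ioo (-δ) δ, ∀ u ≠ 0, ∀ t : ℝ, 0 < t → σ (ε, t • u) = σ (ε, u)
  mem : ∀ ε ∈ Ioo (-δ) δ, ∀ u ≠ 0, σ (ε, u) ∈ Ioo (-(1 / 2) : ℝ) (1 / 2)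
  eq_iff : ∀ ε ∈ Ioo (-δ) δ, ∀ u ≠ 0, ∀ s ∈ Icc (-(1 / 2) : ℝ) (1 / 2),
    ε * normalVelocity Γ ζ (ε, ‖u‖⁻¹ • u + s • τ) = s ↔ s = σ (ε, u)
  abs_mul_normalVelocity_le : ∀ ε ∈ Ioo (-δ) δ, ∀ u ≠ 0,
    |ε * normalVelocity Γ ζ (ε, u)| ≤ 1 / 3 * ‖u‖

section SupportFamilies

variable {d : ℕ} {Γ : Euc d × ℝ → Euc d} {τ u : Euc d} {z₀ z δ δ' ε t : ℝ} {ζ σ : ℝ × Euc d → ℝ}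

theorem Ioo_neg_subset (h : δ' ≤ δ) : Ioo (-δ') δ' ⊆ Ioo (-δ) δ :=
  Ioo_subset_Ioo (neg_le_neg h) h

theorem zero_mem_Ioo_neg (hδ : 0 < δ) : (0 : ℝ) ∈ Ioo (-δ) δ :=
  ⟨neg_lt_zero.2 hδ, hδ⟩

namespace IsSupportFamily

theorem contDiffAt (hΓ : IsSupportFamily Γ) (hu : u ≠ 0) (hz : z ∈ I) :
    ContDiffAt ℝ ∞ Γ (u, z) :=
  hΓ.smooth.contDiffAt ((isOpen_compl_singleton.prod isOpen_Ioo).mem_nhds ⟨hu, hz⟩)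

theorem hasDerivAt (hΓ : IsSupportFamily Γ) (hu : u ≠ 0) (hz : z ∈ I) :
    HasDerivAt (fun z => Γ (u, z)) (fderiv ℝ Γ (u, z) (0, 1)) z :=
  hasDerivAt_comp_prodMk_right ((hΓ.contDiffAt hu hz).differentiableAt (by simp))

theorem exists_isTiltedHeight (hΓ : IsSupportFamily Γ) (hτ : ‖τ‖ = 1) (hz₀ : z₀ ∈ I) :
    ∃ δ, 0 < δ ∧ ∃ ζ, IsTiltedHeight Γ τ z₀ δ ζ := by
  obtain ⟨R, hR, hΓR⟩ := hΓ.isBounded.exists_pos_norm_le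
  have hinner (u : Euc d) (hu : u ≠ 0) (z : ℝ) (hz : z ∈ I) : |inner ℝ τ (Γ (u, z))| ≤ R := by
    refine (abs_real_inner_le_norm _ _).trans ?_
    rw [hτ, one_mul]
    exact hΓR _ (mem_image_of_mem _ ⟨hu, hz⟩)
  obtain ⟨r, hr, hrI⟩ := Metric.nhds_basis_closedBall.mem_iff.1 (isOpen_Ioo.mem_nhds hz₀)
  have hI (s : ℝ) (hs : s ∈ Icc (-r) r) : z₀ + s ∈ I :=
    hrI (by simpa [mem_closedBall_iff_norm] using abs_le.2 hs)
  let g (a : (ℝ × Euc d) × ℝ) : ℝ := a.1.1 * inner ℝ τ (Γ (a.1.2, z₀ + a.2))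
  have hg (ε : ℝ) (u : Euc d) (hu : u ≠ 0) (s : ℝ) (hs : s ∈ Icc (-r) r) :
      ContDiffAt ℝ ∞ g ((ε, u), s) := by
    have hΓg : ContDiffAt ℝ ∞ (fun a : (ℝ × Euc d) × ℝ => Γ (a.1.2, z₀ + a.2)) ((ε, u), s) :=
      ContDiffAt.comp (g := Γ) (f := fun a : (ℝ × Euc d) × ℝ => (a.1.2, z₀ + a.2)) ((ε, u), s)
        (hΓ.contDiffAt hu (hI s hs)) (by fun_prop)
    exact (contDiffAt_fst.comp _ contDiffAt_fst).mul (contDiffAt_const.inner ℝ hΓg)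
  obtain ⟨δ, hδ, -, σ, hσ, hσ_smul, hσ_mem, hσ_iff⟩ :=
    exists_contDiffOn_fixedPoint_of_smul (g := g) one_pos hr (fun ε _ => hg ε)
      (fun _ _ => zero_mul _) (fun ε u s t ht => by simp only [g, hΓ.smul u _ t ht])
  have hsub : Ioo (-min δ (r / R)) (min δ (r / R)) ⊆ Ioo (-δ) δ := Ioo_neg_subset (min_le_left _ _)
  refine ⟨min δ (r / R), by positivity, fun q => z₀ + σ q,
    contDiffOn_const.add (hσ.mono (prod_mono_left hsub)),
    fun ε hε u hu t ht => congrArg (z₀ + ·) (hσ_smul ε (hsub hε) u hu t ht),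
    fun ε hε u hu => hI _ (Ioo_subset_Icc_self (hσ_mem ε (hsub hε) u hu)),
    fun ε hε u hu z hz => ?_⟩
  have hiff (hzr : z - z₀ ∈ Icc (-r) r) :
      z = z₀ + ε * inner ℝ τ (Γ (u, z)) ↔ z = z₀ + σ (ε, u) := by
    have h := hσ_iff ε (hsub hε) u hu (z - z₀) hzr
    simp only [g, add_sub_cancel] at h
    rw [← sub_eq_iff_eq_add', eq_comm, h, sub_eq_iff_eq_add']
  refine ⟨fun h => (hiff (abs_le.1 ?_)).1 h, fun h => (hiff ?_).2 h⟩
  · rw [sub_eq_iff_eq_add'.2 h, abs_mul]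
    calc |ε| * |inner ℝ τ (Γ (u, z))| ≤ r / R * R := by
          gcongr
          exacts [(abs_lt.2 hε).le.trans (min_le_right _ _), hinner u hu z hz]
      _ = r := div_mul_cancel₀ _ hR.ne'
  · rw [sub_eq_iff_eq_add'.2 h]
    exact Ioo_subset_Icc_self (hσ_mem ε (hsub hε) u hu)

end IsSupportFamily

namespace IsTiltedHeight

theorem mono (hζ : IsTiltedHeight Γ τ z₀ δ ζ) (h : δ' ≤ δ) : IsTiltedHeight Γ τ z₀ δ' ζ where
  smooth := hζ.smooth.mono (prod_mono_left (Ioo_neg_subset h))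
  smul ε hε := hζ.smul ε (Ioo_neg_subset h hε)
  mem ε hε := hζ.mem ε (Ioo_neg_subset h hε)
  solves_iff ε hε := hζ.solves_iff ε (Ioo_neg_subset h hε)

theorem contDiffAt (hζ : IsTiltedHeight Γ τ z₀ δ ζ) (hε : ε ∈ Ioo (-δ) δ) (hu : u ≠ 0) :
    ContDiffAt ℝ ∞ ζ (ε, u) :=
  hζ.smooth.contDiffAt ((isOpen_strip δ).mem_nhds ⟨hε, hu⟩)

theorem apply_eq (hζ : IsTiltedHeight Γ τ z₀ δ ζ) (hε : ε ∈ Ioo (-δ) δ) (hu : u ≠ 0) :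
    ζ (ε, u) = z₀ + ε * inner ℝ τ (Γ (u, ζ (ε, u))) :=
  (hζ.solves_iff ε hε u hu _ (hζ.mem ε hε u hu)).2 rfl

theorem apply_zero (hζ : IsTiltedHeight Γ τ z₀ δ ζ) (hδ : 0 < δ) (hu : u ≠ 0) :
    ζ (0, u) = z₀ := by
  rw [hζ.apply_eq (zero_mem_Ioo_neg hδ) hu, zero_mul, add_zero]

theorem contDiffAt_normalVelocity (hζ : IsTiltedHeight Γ τ z₀ δ ζ) (hΓ : IsSupportFamily Γ)
    (hε : ε ∈ Ioo (-δ) δ) (hu : u ≠ 0) : ContDiffAt ℝ ∞ (normalVelocity Γ ζ) (ε, u) := by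
  have hfderiv : ContDiffAt ℝ ∞ (fun q : ℝ × Euc d => fderiv ℝ Γ (q.2, ζ q)) (ε, u) :=
    ContDiffAt.comp (g := fderiv ℝ Γ) (f := fun q : ℝ × Euc d => (q.2, ζ q)) (ε, u)
      ((hΓ.contDiffAt hu (hζ.mem ε hε u hu)).fderiv_right (m := ∞) (by simp))
      (contDiffAt_snd.prodMk (hζ.contDiffAt hε hu))
  exact contDiffAt_snd.inner ℝ (hfderiv.clm_apply contDiffAt_const)

theorem normalVelocity_smul (hζ : IsTiltedHeight Γ τ z₀ δ ζ) (hΓ : IsSupportFamily Γ)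
    (hε : ε ∈ Ioo (-δ) δ) (hu : u ≠ 0) (ht : 0 < t) :
    normalVelocity Γ ζ (ε, t • u) = t * normalVelocity Γ ζ (ε, u) := by
  have hz := hζ.mem ε hε u hu
  have hderiv := hΓ.hasDerivAt (smul_ne_zero ht.ne' hu) hz
  simp only [hΓ.smul u _ t ht] at hderiv
  simp only [normalVelocity, hζ.smul ε hε u hu t ht, hderiv.unique (hΓ.hasDerivAt hu hz),
    inner_smul_left, conj_trivial]

theorem tiltedNormal_smul (hζ : IsTiltedHeight Γ τ z₀ δ ζ) (hΓ : IsSupportFamily Γ)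
    (hε : ε ∈ Ioo (-δ) δ) (hu : u ≠ 0) (ht : 0 < t) :
    tiltedNormal Γ τ ζ (ε, t • u) = t • tiltedNormal Γ τ ζ (ε, u) := by
  simp only [tiltedNormal, hζ.normalVelocity_smul hΓ hε hu ht]
  module

theorem contDiffAt_tiltedNormal (hζ : IsTiltedHeight Γ τ z₀ δ ζ) (hΓ : IsSupportFamily Γ)
    (hε : ε ∈ Ioo (-δ) δ) (hu : u ≠ 0) : ContDiffAt ℝ ∞ (tiltedNormal Γ τ ζ) (ε, u) :=
  contDiffAt_snd.sub ((contDiffAt_fst.mul (hζ.contDiffAt_normalVelocity hΓ hε hu)).smul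
    contDiffAt_const)

theorem exists_abs_mul_normalVelocity_le (hζ : IsTiltedHeight Γ τ z₀ δ ζ)
    (hΓ : IsSupportFamily Γ) (hδ : 0 < δ) {C : ℝ} (hC : 0 < C) :
    ∃ δ', 0 < δ' ∧ δ' ≤ δ ∧ ∀ ε ∈ Ioo (-δ') δ', ∀ u ≠ 0,
      |ε * normalVelocity Γ ζ (ε, u)| ≤ C * ‖u‖ := by
  have key := (isCompact_sphere (0 : Euc d) 1).eventually_forall_of_forall_eventually
    (x₀ := (0 : ℝ)) (P := fun ε u => |ε * normalVelocity Γ ζ (ε, u)| < C) fun u hu => ?_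
  · obtain ⟨δ', hδ', h⟩ := Metric.eventually_nhds_iff.1 key
    refine ⟨min δ' δ, lt_min hδ' hδ, min_le_right _ _, fun ε hε u hu => ?_⟩
    have hunit := (h (y := ε) (by
      rw [dist_zero_right]
      exact (abs_lt.2 hε).trans_le (min_le_left _ _)) (‖u‖⁻¹ • u)
      (mem_sphere_zero_iff_norm.2 (norm_smul_inv_norm hu))).le
    have hpos : 0 < ‖u‖ := norm_pos_iff.2 hu
    rwa [hζ.normalVelocity_smul hΓ (Ioo_neg_subset (min_le_right _ _) hε) hu (inv_pos.2 hpos),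
      mul_left_comm, abs_mul, abs_of_pos (inv_pos.2 hpos), inv_mul_le_iff₀ hpos,
      mul_comm ‖u‖ C] at hunit
  · have hcont : ContinuousAt (fun q : ℝ × Euc d => q.1 * normalVelocity Γ ζ q) (0, u) :=
      continuousAt_fst.mul (hζ.contDiffAt_normalVelocity hΓ (zero_mem_Ioo_neg hδ)
        (ne_zero_of_mem_unit_sphere ⟨u, hu⟩)).continuousAt
    exact hcont.abs.eventually_lt_const (by simpa only [zero_mul, abs_zero] using hC)

end IsTiltedHeight

theorem inv_norm_smul_add_smul_ne_zero (hτ : ‖τ‖ = 1) (hu : u ≠ 0) {s : ℝ} (hs : |s| < 1) :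
    ‖u‖⁻¹ • u + s • τ ≠ 0 := fun h => by
  have hunit : ‖‖u‖⁻¹ • u‖ = 1 := norm_smul_inv_norm hu
  rw [eq_neg_of_add_eq_zero_left h, norm_neg, norm_smul, hτ, mul_one] at hunit
  exact hs.ne hunit

theorem contDiffAt_inv_norm_smul {E : Type*} [NormedAddCommGroup E] [NormedSpace ℝ E]
    {f : E → Euc d} {x : E} (hf : ContDiffAt ℝ ∞ f x) (hx : f x ≠ 0) :
    ContDiffAt ℝ ∞ (fun x => ‖f x‖⁻¹ • f x) x :=
  ((hf.norm ℝ hx).inv (norm_ne_zero_iff.2 hx)).smul hf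

theorem IsTiltedHeight.exists_isTilt (hζ : IsTiltedHeight Γ τ z₀ δ ζ) (hΓ : IsSupportFamily Γ)
    (hδ : 0 < δ) (hτ : ‖τ‖ = 1) : ∃ δ', 0 < δ' ∧ δ' ≤ δ ∧ ∃ σ, IsTilt Γ τ ζ δ' σ := by
  obtain ⟨δ₁, hδ₁, hδ₁δ, hle⟩ := hζ.exists_abs_mul_normalVelocity_le hΓ hδ (C := 1 / 3) (by simp)
  let y (a : (ℝ × Euc d) × ℝ) : Euc d := ‖a.1.2‖⁻¹ • a.1.2 + a.2 • τ
  let g (a : (ℝ × Euc d) × ℝ) : ℝ := a.1.1 * normalVelocity Γ ζ (a.1.1, y a)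
  have hg (ε : ℝ) (hε : ε ∈ Ioo (-δ₁) δ₁) (u : Euc d) (hu : u ≠ 0) (s : ℝ)
      (hs : s ∈ Icc (-(1 / 2) : ℝ) (1 / 2)) : ContDiffAt ℝ ∞ g ((ε, u), s) := by
    have hy : ContDiffAt ℝ ∞ y ((ε, u), s) :=
      (contDiffAt_inv_norm_smul (f := fun a : (ℝ × Euc d) × ℝ => a.1.2) (by fun_prop) hu).add
        (contDiffAt_snd.smul contDiffAt_const)
    have hy0 : y ((ε, u), s) ≠ 0 :=
      inv_norm_smul_add_smul_ne_zero hτ hu ((abs_le.2 hs).trans_lt one_half_lt_one)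
    have hfst : ContDiffAt ℝ ∞ (fun a : (ℝ × Euc d) × ℝ => a.1.1) ((ε, u), s) :=
      contDiffAt_fst.comp _ contDiffAt_fst
    have hvelocity := hζ.contDiffAt_normalVelocity hΓ (Ioo_neg_subset hδ₁δ hε) hy0
    exact hfst.mul (ContDiffAt.comp (g := normalVelocity Γ ζ)
      (f := fun a : (ℝ × Euc d) × ℝ => (a.1.1, y a)) ((ε, u), s) hvelocity (hfst.prodMk hy))
  obtain ⟨δ', hδ', hδ'δ₁, σ, hσ, hσ_smul, hσ_mem, hσ_iff⟩ :=
    exists_contDiffOn_fixedPoint_of_smul (g := g) hδ₁ one_half_pos hg (fun _ _ => zero_mul _)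
      (fun ε u s t ht => by simp only [g, y, inv_norm_smul_smul ht])
  exact ⟨δ', hδ', hδ'δ₁.trans hδ₁δ, σ, hσ, hσ_smul, hσ_mem, hσ_iff,
    fun ε hε => hle ε (Ioo_neg_subset hδ'δ₁ hε)⟩

namespace IsTilt

theorem mono (hσ : IsTilt Γ τ ζ δ σ) (h : δ' ≤ δ) : IsTilt Γ τ ζ δ' σ where
  smooth := hσ.smooth.mono (prod_mono_left (Ioo_neg_subset h))
  smul ε hε := hσ.smul ε (Ioo_neg_subset h hε)
  mem ε hε := hσ.mem ε (Ioo_neg_subset h hε)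
  eq_iff ε hε := hσ.eq_iff ε (Ioo_neg_subset h hε)
  abs_mul_normalVelocity_le ε hε := hσ.abs_mul_normalVelocity_le ε (Ioo_neg_subset h hε)

theorem contDiffAt (hσ : IsTilt Γ τ ζ δ σ) (hε : ε ∈ Ioo (-δ) δ) (hu : u ≠ 0) :
    ContDiffAt ℝ ∞ σ (ε, u) :=
  hσ.smooth.contDiffAt ((isOpen_strip δ).mem_nhds ⟨hε, hu⟩)

theorem contDiffAt_displaced (hσ : IsTilt Γ τ ζ δ σ) (hε : ε ∈ Ioo (-δ) δ) (hu : u ≠ 0) :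
    ContDiffAt ℝ ∞ (displaced τ σ) (ε, u) :=
  (contDiffAt_inv_norm_smul contDiffAt_snd hu).add ((hσ.contDiffAt hε hu).smul contDiffAt_const)

theorem displaced_smul (hσ : IsTilt Γ τ ζ δ σ) (hε : ε ∈ Ioo (-δ) δ) (hu : u ≠ 0) (ht : 0 < t) :
    displaced τ σ (ε, t • u) = displaced τ σ (ε, u) := by
  simp only [displaced, hσ.smul ε hε u hu t ht, inv_norm_smul_smul ht]

theorem displaced_ne_zero (hσ : IsTilt Γ τ ζ δ σ) (hτ : ‖τ‖ = 1) (hε : ε ∈ Ioo (-δ) δ)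
    (hu : u ≠ 0) : displaced τ σ (ε, u) ≠ 0 :=
  inv_norm_smul_add_smul_ne_zero hτ hu ((abs_lt.2 (hσ.mem ε hε u hu)).trans one_half_lt_one)

theorem apply_eq (hσ : IsTilt Γ τ ζ δ σ) (hε : ε ∈ Ioo (-δ) δ) (hu : u ≠ 0) :
    σ (ε, u) = ε * normalVelocity Γ ζ (ε, displaced τ σ (ε, u)) :=
  ((hσ.eq_iff ε hε u hu _ (Ioo_subset_Icc_self (hσ.mem ε hε u hu))).2 rfl).symm

theorem tiltedNormal_displaced (hσ : IsTilt Γ τ ζ δ σ) (hε : ε ∈ Ioo (-δ) δ) (hu : u ≠ 0) :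
    tiltedNormal Γ τ ζ (ε, displaced τ σ (ε, u)) = ‖u‖⁻¹ • u := by
  rw [tiltedNormal, ← hσ.apply_eq hε hu, displaced, add_sub_cancel_right]

theorem tiltedNormal_ne_zero (hσ : IsTilt Γ τ ζ δ σ) (hτ : ‖τ‖ = 1) (hε : ε ∈ Ioo (-δ) δ)
    (hu : u ≠ 0) : tiltedNormal Γ τ ζ (ε, u) ≠ 0 := fun h => by
  have hnorm : ‖u‖ = |ε * normalVelocity Γ ζ (ε, u)| := by
    simpa only [norm_smul, hτ, mul_one, Real.norm_eq_abs] using congrArg norm (sub_eq_zero.1 h)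
  linarith [hσ.abs_mul_normalVelocity_le ε hε u hu, norm_pos_iff.2 hu]

theorem displaced_tiltedNormal (hσ : IsTilt Γ τ ζ δ σ) (hζ : IsTiltedHeight Γ τ z₀ δ ζ)
    (hΓ : IsSupportFamily Γ) (hτ : ‖τ‖ = 1) (hε : ε ∈ Ioo (-δ) δ) (hu : u ≠ 0) :
    displaced τ σ (ε, tiltedNormal Γ τ ζ (ε, u)) = ‖tiltedNormal Γ τ ζ (ε, u)‖⁻¹ • u := by
  have hn := hσ.tiltedNormal_ne_zero hτ hε hu
  set n := tiltedNormal Γ τ ζ (ε, u) with hn_def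
  have hnpos : 0 < ‖n‖⁻¹ := inv_pos.2 (norm_pos_iff.2 hn)
  set s := ε * normalVelocity Γ ζ (ε, ‖n‖⁻¹ • u) with hs
  have hsum : ‖n‖⁻¹ • n + s • τ = ‖n‖⁻¹ • u := by
    rw [hs, hζ.normalVelocity_smul hΓ hε hu hnpos, hn_def, tiltedNormal]
    module
  -- `|s| ≤ (1 + |s|) / 3` by the bound on the normal velocity.
  have hs_le : |s| ≤ 1 / 2 := by
    have hbound := hσ.abs_mul_normalVelocity_le ε hε _ (smul_ne_zero hnpos.ne' hu)
    have htri : ‖‖n‖⁻¹ • u‖ ≤ 1 + |s| := by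
      have hunit : ‖‖n‖⁻¹ • n‖ = 1 := norm_smul_inv_norm hn
      rw [← hsum]
      refine (norm_add_le _ _).trans_eq ?_
      rw [hunit, norm_smul, hτ, mul_one, Real.norm_eq_abs]
    linarith
  have hsσ : s = σ (ε, n) := (hσ.eq_iff ε hε n hn s (abs_le.1 hs_le)).1 (by rw [hsum])
  rw [displaced, ← hsσ, hsum]

theorem apply_zero (hσ : IsTilt Γ τ ζ δ σ) (hδ : 0 < δ) (hu : u ≠ 0) : σ (0, u) = 0 := by
  rw [hσ.apply_eq (zero_mem_Ioo_neg hδ) hu, zero_mul]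

theorem displaced_zero (hσ : IsTilt Γ τ ζ δ σ) (hδ : 0 < δ) (hu : u ≠ 0) :
    displaced τ σ (0, u) = ‖u‖⁻¹ • u := by
  rw [displaced, hσ.apply_zero hδ hu, zero_smul, add_zero]

end IsTilt

end SupportFamilies

theorem eventually_forall_inner_clm_apply_self_pos {T E : Type*} [TopologicalSpace T]
    [NormedAddCommGroup E] [InnerProductSpace ℝ E] [ProperSpace E] {L : T × E → E →L[ℝ] E} {t₀ : T}
    (hL : ∀ m, ‖m‖ = 1 → ContinuousAt L (t₀, m))
    (hpos : ∀ m w, ‖m‖ = 1 → inner ℝ m w = 0 → w ≠ 0 → 0 < inner ℝ (L (t₀, m) w) w) :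
    ∀ᶠ t in 𝓝 t₀, ∀ m w, ‖m‖ = 1 → inner ℝ m w = 0 → w ≠ 0 → 0 < inner ℝ (L (t, m) w) w := by
  let K : Set (E × E) := (Metric.sphere 0 1 ×ˢ Metric.sphere 0 1) ∩ {a | inner ℝ a.1 a.2 = 0}
  have hK : IsCompact K :=
    ((isCompact_sphere 0 1).prod (isCompact_sphere 0 1)).inter_right
      (isClosed_eq (by fun_prop) continuous_const)
  have key := hK.eventually_forall_of_forall_eventually (x₀ := t₀)
    (P := fun t a => 0 < inner ℝ (L (t, a.1) a.2) a.2) fun a ha => ?_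
  · filter_upwards [key] with t ht m w hm hmw hw
    have hw_inv : 0 < ‖w‖⁻¹ := inv_pos.2 (norm_pos_iff.2 hw)
    have hunit := ht (m, ‖w‖⁻¹ • w) ⟨⟨mem_sphere_zero_iff_norm.2 hm,
      mem_sphere_zero_iff_norm.2 (norm_smul_inv_norm hw)⟩,
      by rw [mem_ofPred_eq, inner_smul_right, hmw, mul_zero]⟩
    rw [map_smul, real_inner_smul_left, real_inner_smul_right] at hunit
    exact pos_of_mul_pos_right (pos_of_mul_pos_right hunit hw_inv.le) hw_inv.le
  · obtain ⟨⟨hm, hw⟩, hmw⟩ := ha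
    have hLa : ContinuousAt (fun b : T × (E × E) => L (b.1, b.2.1)) (t₀, a) :=
      ContinuousAt.comp (g := L) (f := fun b : T × (E × E) => (b.1, b.2.1))
        (hL a.1 (mem_sphere_zero_iff_norm.1 hm)) (by fun_prop)
    exact ((hLa.clm_apply (by fun_prop)).inner (by fun_prop)).eventually
      (lt_mem_nhds (hpos a.1 a.2 (mem_sphere_zero_iff_norm.1 hm) hmw
        (ne_zero_of_mem_unit_sphere ⟨a.2, hw⟩)))

/-- The point with normal direction `q.2` of the projected section tilted by `q.1`. -/
noncomputable def tiltedSupport {d : ℕ} (Γ : Euc d × ℝ → Euc d) (τ : Euc d) (ζ σ : ℝ × Euc d → ℝ)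
    (q : ℝ × Euc d) : Euc d :=
  Γ (displaced τ σ q, ζ (q.1, displaced τ σ q))

section Tilt

variable {d : ℕ} {Γ : Euc d × ℝ → Euc d} {τ u : Euc d} {z₀ z δ ε t : ℝ} {ζ σ : ℝ × Euc d → ℝ}

theorem IsSupportFamily.inner_fderiv_apply (hΓ : IsSupportFamily Γ) (hu : u ≠ 0) (hz : z ∈ I)
    (v : Euc d) (s : ℝ) :
    inner ℝ u (fderiv ℝ Γ (u, z) (v, s)) = s * inner ℝ u (fderiv ℝ Γ (u, z) (0, 1)) := by
  have hΓd := ((hΓ.contDiffAt hu hz).differentiableAt (by simp)).hasFDerivAt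
  have hslice : HasFDerivAt (fun x => Γ (x, z)) ((fderiv ℝ Γ (u, z)).comp (.inl ℝ (Euc d) ℝ)) u :=
    HasFDerivAt.comp (g := Γ) u hΓd (hasFDerivAt_prodMk_left u z)
  have hperp : inner ℝ u (fderiv ℝ Γ (u, z) (v, 0)) = 0 := by
    simpa [hslice.fderiv] using (hΓ.isSupportField z hz).perp u hu v
  have hsplit : ((v, s) : Euc d × ℝ) = (v, 0) + s • ((0 : Euc d), (1 : ℝ)) := by simp
  rw [hsplit, map_add, map_smul, inner_add_right, hperp, zero_add, inner_smul_right]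

namespace IsTilt

theorem contDiffAt_tiltedSupport (hσ : IsTilt Γ τ ζ δ σ) (hζ : IsTiltedHeight Γ τ z₀ δ ζ)
    (hΓ : IsSupportFamily Γ) (hτ : ‖τ‖ = 1) (hε : ε ∈ Ioo (-δ) δ) (hu : u ≠ 0) :
    ContDiffAt ℝ ∞ (tiltedSupport Γ τ ζ σ) (ε, u) := by
  have hne := hσ.displaced_ne_zero hτ hε hu
  have hdisplaced := hσ.contDiffAt_displaced hε hu
  have hheight : ContDiffAt ℝ ∞ (fun q : ℝ × Euc d => ζ (q.1, displaced τ σ q)) (ε, u) :=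
    ContDiffAt.comp (g := ζ) (f := fun q : ℝ × Euc d => (q.1, displaced τ σ q)) (ε, u)
      (hζ.contDiffAt hε hne) (contDiffAt_fst.prodMk hdisplaced)
  exact ContDiffAt.comp (g := Γ)
    (f := fun q : ℝ × Euc d => (displaced τ σ q, ζ (q.1, displaced τ σ q))) (ε, u)
    (hΓ.contDiffAt hne (hζ.mem ε hε _ hne)) (hdisplaced.prodMk hheight)

theorem tiltedSupport_zero (hσ : IsTilt Γ τ ζ δ σ) (hζ : IsTiltedHeight Γ τ z₀ δ ζ)
    (hΓ : IsSupportFamily Γ) (hδ : 0 < δ) (hu : u ≠ 0) :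
    tiltedSupport Γ τ ζ σ (0, u) = Γ (u, z₀) := by
  have hinv : 0 < ‖u‖⁻¹ := inv_pos.2 (norm_pos_iff.2 hu)
  rw [tiltedSupport, hσ.displaced_zero hδ hu, hζ.apply_zero hδ (smul_ne_zero hinv.ne' hu),
    hΓ.smul u _ _ hinv]

theorem hasFDerivAt_tiltedSupport (hσ : IsTilt Γ τ ζ δ σ) (hζ : IsTiltedHeight Γ τ z₀ δ ζ)
    (hΓ : IsSupportFamily Γ) (hτ : ‖τ‖ = 1) (hε : ε ∈ Ioo (-δ) δ) (hu : u ≠ 0) :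
    HasFDerivAt (fun u => tiltedSupport Γ τ ζ σ (ε, u))
      ((fderiv ℝ (tiltedSupport Γ τ ζ σ) (ε, u)).comp (.inr ℝ ℝ (Euc d))) u :=
  HasFDerivAt.comp (g := tiltedSupport Γ τ ζ σ) u
    ((hσ.contDiffAt_tiltedSupport hζ hΓ hτ hε hu).differentiableAt (by simp)).hasFDerivAt
    (hasFDerivAt_prodMk_right ε u)

theorem exists_fderiv_tiltedSupport_eq (hσ : IsTilt Γ τ ζ δ σ) (hζ : IsTiltedHeight Γ τ z₀ δ ζ)
    (hΓ : IsSupportFamily Γ) (hτ : ‖τ‖ = 1) (hε : ε ∈ Ioo (-δ) δ) (hu : u ≠ 0) (w : Euc d) :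
    ∃ v, fderiv ℝ (fun u => tiltedSupport Γ τ ζ σ (ε, u)) u w =
      fderiv ℝ Γ (displaced τ σ (ε, u), ζ (ε, displaced τ σ (ε, u)))
        (v, ε * inner ℝ τ (fderiv ℝ (fun u => tiltedSupport Γ τ ζ σ (ε, u)) u w)) := by
  have hne := hσ.displaced_ne_zero hτ hε hu
  have hsupport :=
    (hσ.hasFDerivAt_tiltedSupport hζ hΓ hτ hε hu).differentiableAt.hasFDerivAt
  set D := fderiv ℝ (fun u => tiltedSupport Γ τ ζ σ (ε, u)) u
  obtain ⟨Y, hY⟩ : ∃ Y, HasFDerivAt (fun u => displaced τ σ (ε, u)) Y u :=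
    ⟨_, HasFDerivAt.comp (g := displaced τ σ) u
      ((hσ.contDiffAt_displaced hε hu).differentiableAt (by simp)).hasFDerivAt
      (hasFDerivAt_prodMk_right ε u)⟩
  have hheight : HasFDerivAt (fun u => ζ (ε, displaced τ σ (ε, u)))
      (ε • (innerSL ℝ τ).comp D) u := by
    have hplane : HasFDerivAt (fun u => z₀ + ε * innerSL ℝ τ (tiltedSupport Γ τ ζ σ (ε, u)))
        (ε • (innerSL ℝ τ).comp D) u :=
      (((innerSL ℝ τ).hasFDerivAt.comp u hsupport).const_mul ε).const_add z₀
    refine hplane.congr_of_eventuallyEq ?_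
    filter_upwards [isOpen_compl_singleton.mem_nhds hu] with x hx
    exact hζ.apply_eq hε (hσ.displaced_ne_zero hτ hε hx)
  have hchain : HasFDerivAt (fun u => tiltedSupport Γ τ ζ σ (ε, u))
      ((fderiv ℝ Γ (displaced τ σ (ε, u), ζ (ε, displaced τ σ (ε, u)))).comp
        (Y.prod (ε • (innerSL ℝ τ).comp D))) u :=
    HasFDerivAt.comp (g := Γ)
      (f := fun u => (displaced τ σ (ε, u), ζ (ε, displaced τ σ (ε, u)))) u
      ((hΓ.contDiffAt hne (hζ.mem ε hε _ hne)).differentiableAt (by simp)).hasFDerivAt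
      (hY.prodMk hheight)
  exact ⟨Y w, congrArg (fun L => L w) (hsupport.unique hchain)⟩

theorem inner_fderiv_tiltedSupport (hσ : IsTilt Γ τ ζ δ σ) (hζ : IsTiltedHeight Γ τ z₀ δ ζ)
    (hΓ : IsSupportFamily Γ) (hτ : ‖τ‖ = 1) (hε : ε ∈ Ioo (-δ) δ) (hu : ‖u‖ = 1) (w : Euc d) :
    inner ℝ u (fderiv ℝ (fun u => tiltedSupport Γ τ ζ σ (ε, u)) u w) = 0 := by
  have hu0 : u ≠ 0 := ne_zero_of_norm_ne_zero (hu ▸ one_ne_zero)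
  have hne := hσ.displaced_ne_zero hτ hε hu0
  obtain ⟨v, hv⟩ := hσ.exists_fderiv_tiltedSupport_eq hζ hΓ hτ hε hu0 w
  have hnormal := hσ.tiltedNormal_displaced hε hu0
  rw [hu, inv_one, one_smul] at hnormal
  have hinner := hΓ.inner_fderiv_apply hne (hζ.mem ε hε _ hne) v
    (ε * inner ℝ τ (fderiv ℝ (fun u => tiltedSupport Γ τ ζ σ (ε, u)) u w))
  rw [← hv] at hinner
  nth_rewrite 1 [← hnormal]
  rw [tiltedNormal, inner_sub_left, real_inner_smul_left, hinner, normalVelocity]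
  ring

theorem exists_inner_fderiv_tiltedSupport_pos (hσ : IsTilt Γ τ ζ δ σ)
    (hζ : IsTiltedHeight Γ τ z₀ δ ζ) (hΓ : IsSupportFamily Γ) (hτ : ‖τ‖ = 1) (hδ : 0 < δ)
    (hz₀ : z₀ ∈ I) : ∃ δ', 0 < δ' ∧ δ' ≤ δ ∧ ∀ ε ∈ Ioo (-δ') δ', ∀ u w : Euc d, ‖u‖ = 1 →
      inner ℝ u w = 0 → w ≠ 0 →
        0 < inner ℝ (fderiv ℝ (fun u => tiltedSupport Γ τ ζ σ (ε, u)) u w) w := by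
  have h0 := zero_mem_Ioo_neg hδ
  have hfderiv {ε : ℝ} (hε : ε ∈ Ioo (-δ) δ) {u : Euc d} (hu : ‖u‖ = 1) :=
    (hσ.hasFDerivAt_tiltedSupport hζ hΓ hτ hε (ne_zero_of_norm_ne_zero (hu ▸ one_ne_zero))).fderiv
  have hev := eventually_forall_inner_clm_apply_self_pos (t₀ := (0 : ℝ))
    (L := fun q => (fderiv ℝ (tiltedSupport Γ τ ζ σ) q).comp (.inr ℝ ℝ (Euc d)))
    (fun u hu => ?_) fun u w hu huw hw => ?_
  · obtain ⟨δ', hδ', h⟩ := Metric.eventually_nhds_iff.1 hev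
    refine ⟨min δ' δ, lt_min hδ' hδ, min_le_right _ _, fun ε hε u w hu huw hw => ?_⟩
    rw [hfderiv (Ioo_neg_subset (min_le_right _ _) hε) hu]
    refine h ?_ u w hu huw hw
    rw [dist_zero_right]
    exact (abs_lt.2 hε).trans_le (min_le_left _ _)
  · have hu0 : u ≠ 0 := ne_zero_of_norm_ne_zero (hu ▸ one_ne_zero)
    exact (((hσ.contDiffAt_tiltedSupport hζ hΓ hτ h0 hu0).fderiv_right (m := ∞)
      (by simp)).clm_comp contDiffAt_const).continuousAt
  · have hu0 : u ≠ 0 := ne_zero_of_norm_ne_zero (hu ▸ one_ne_zero)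
    have heq : (fun u => tiltedSupport Γ τ ζ σ (0, u)) =ᶠ[𝓝 u] fun u => Γ (u, z₀) := by
      filter_upwards [isOpen_compl_singleton.mem_nhds hu0] with x hx
      exact hσ.tiltedSupport_zero hζ hΓ hδ hx
    rw [← hfderiv h0 hu, heq.fderiv_eq]
    exact (hΓ.isSupportField z₀ hz₀).pos u w hu0 huw hw

theorem exists_isSupportField_tiltedSupport (hσ : IsTilt Γ τ ζ δ σ)
    (hζ : IsTiltedHeight Γ τ z₀ δ ζ) (hΓ : IsSupportFamily Γ) (hτ : ‖τ‖ = 1) (hδ : 0 < δ)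
    (hz₀ : z₀ ∈ I) : ∃ δ', 0 < δ' ∧ δ' ≤ δ ∧ ∀ ε ∈ Ioo (-δ') δ',
      IsSupportField fun u => tiltedSupport Γ τ ζ σ (ε, u) := by
  obtain ⟨δ', hδ', hδ'δ, hpos⟩ := hσ.exists_inner_fderiv_tiltedSupport_pos hζ hΓ hτ hδ hz₀
  refine ⟨δ', hδ', hδ'δ, fun ε hε => ?_⟩
  have hεδ : ε ∈ Ioo (-δ) δ := Ioo_neg_subset hδ'δ hε
  refine .of_unit (fun u hu => ?_) (fun u t ht => ?_)
    (fun u hu w => hσ.inner_fderiv_tiltedSupport hζ hΓ hτ hεδ hu w) (hpos ε hε)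
  · exact (ContDiffAt.comp (g := tiltedSupport Γ τ ζ σ) (f := fun u => (ε, u)) u
      (hσ.contDiffAt_tiltedSupport hζ hΓ hτ hεδ hu)
      (contDiffAt_const.prodMk contDiffAt_id)).contDiffWithinAt
  · obtain rfl | hu := eq_or_ne u 0
    · rw [smul_zero]
    · simp only [tiltedSupport, hσ.displaced_smul hεδ hu ht]

theorem hasDerivAt_displaced (hσ : IsTilt Γ τ ζ δ σ) (hζ : IsTiltedHeight Γ τ z₀ δ ζ)
    (hΓ : IsSupportFamily Γ) (hδ : 0 < δ) (hu : ‖u‖ = 1) :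
    HasDerivAt (fun ε => displaced τ σ (ε, u))
      ((inner ℝ u (fderiv ℝ Γ (u, z₀) (0, 1)) : ℝ) • τ) 0 := by
  have hu0 : u ≠ 0 := ne_zero_of_norm_ne_zero (hu ▸ one_ne_zero)
  have h0 := zero_mem_Ioo_neg hδ
  have hdisplaced₀ : displaced τ σ (0, u) = u := by
    rw [hσ.displaced_zero hδ hu0, hu, inv_one, one_smul]
  have hdisplaced : ContDiffAt ℝ ∞ (fun ε : ℝ => displaced τ σ (ε, u)) 0 :=
    ContDiffAt.comp (g := displaced τ σ) (f := fun ε : ℝ => (ε, u)) 0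
      (hσ.contDiffAt_displaced h0 hu0) (contDiffAt_id.prodMk contDiffAt_const)
  have hvelocity : ContDiffAt ℝ ∞ (fun ε => normalVelocity Γ ζ (ε, displaced τ σ (ε, u))) 0 :=
    ContDiffAt.comp (g := normalVelocity Γ ζ)
      (f := fun ε : ℝ => (ε, displaced τ σ (ε, u))) 0
      (hζ.contDiffAt_normalVelocity hΓ h0 (hdisplaced₀.symm ▸ hu0))
      (contDiffAt_id.prodMk hdisplaced)
  have hσ' : HasDerivAt (fun ε => σ (ε, u)) (inner ℝ u (fderiv ℝ Γ (u, z₀) (0, 1))) 0 := by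
    refine (((hasDerivAt_id (0 : ℝ)).mul (hvelocity.differentiableAt (by simp)).hasDerivAt
      ).congr_of_eventuallyEq ?_).congr_deriv ?_
    · filter_upwards [isOpen_Ioo.mem_nhds h0] with ε hε using hσ.apply_eq hε hu0
    · simp [hdisplaced₀, normalVelocity, hζ.apply_zero hδ hu0]
  exact (hσ'.smul_const τ).const_add (‖u‖⁻¹ • u)

end IsTilt

theorem contMDiffOn_comp_coe_sphere {F : Type*} [NormedAddCommGroup F] [NormedSpace ℝ F]
    {Φ : ℝ × Euc d → F} {s : Set ℝ} (hΦ : ContDiffOn ℝ ∞ Φ (s ×ˢ {0}ᶜ)) :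
    ContMDiffOn (𝓘(ℝ, ℝ).prod (𝓡 d)) 𝓘(ℝ, F) ∞
      (fun q : ℝ × Sph d => Φ (q.1, (q.2 : Euc d))) (s ×ˢ univ) := by
  have hcoe : ContMDiff (𝓘(ℝ, ℝ).prod (𝓡 d)) 𝓘(ℝ, ℝ × Euc d) ∞
      (fun q : ℝ × Sph d => (q.1, (q.2 : Euc d))) :=
    contMDiff_fst.prodMk_space (contMDiff_coe_sph.comp contMDiff_snd)
  exact hΦ.contMDiffOn.comp hcoe.contMDiffOn fun q hq => ⟨hq.1, ne_zero_of_mem_unit_sphere q.2⟩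

theorem contMDiffOn_sphereProj_comp_coe_sphere {Φ : ℝ × Euc d → Euc d} {s : Set ℝ}
    (hΦ : ContDiffOn ℝ ∞ Φ (s ×ˢ {0}ᶜ)) (hne : ∀ ε ∈ s, ∀ u ≠ 0, Φ (ε, u) ≠ 0) :
    ContMDiffOn (𝓘(ℝ, ℝ).prod (𝓡 d)) (𝓡 d) ∞
      (fun q : ℝ × Sph d => sphereProj (Φ (q.1, (q.2 : Euc d)))) (s ×ˢ univ) := fun q hq =>
  (contMDiffAt_sphereProj (hne q.1 hq.1 q.2 (ne_zero_of_mem_unit_sphere q.2))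
    ).comp_contMDiffWithinAt q (contMDiffOn_comp_coe_sphere hΦ q hq)

theorem contMDiff_of_contMDiffOn_prod {f : ℝ × Sph d → Sph d} {s : Set ℝ}
    (hf : ContMDiffOn (𝓘(ℝ, ℝ).prod (𝓡 d)) (𝓡 d) ∞ f (s ×ˢ univ)) (hε : ε ∈ s) :
    ContMDiff (𝓡 d) (𝓡 d) ∞ fun u => f (ε, u) := by
  rw [← contMDiffOn_univ]
  exact hf.comp (contMDiff_const.prodMk contMDiff_id).contMDiffOn fun u _ => ⟨hε, trivial⟩

theorem IsTilt.contMDiffOn_sphereProj_displaced (hσ : IsTilt Γ τ ζ δ σ) (hτ : ‖τ‖ = 1) :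
    ContMDiffOn (𝓘(ℝ, ℝ).prod (𝓡 d)) (𝓡 d) ∞
      (fun q : ℝ × Sph d => sphereProj (displaced τ σ (q.1, (q.2 : Euc d))))
      (Ioo (-δ) δ ×ˢ univ) :=
  contMDiffOn_sphereProj_comp_coe_sphere
    (fun _ hq => (hσ.contDiffAt_displaced hq.1 hq.2).contDiffWithinAt)
    fun _ hε _ hu => hσ.displaced_ne_zero hτ hε hu

/-- The diffeomorphism of the sphere which maps the normal of the tilted section at a point to the
normal of the horizontal section through that point. -/
noncomputable def tiltDiffeomorph (hσ : IsTilt Γ τ ζ δ σ) (hζ : IsTiltedHeight Γ τ z₀ δ ζ)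
    (hΓ : IsSupportFamily Γ) (hτ : ‖τ‖ = 1) (hε : ε ∈ Ioo (-δ) δ) :
    Diffeomorph (𝓡 d) (𝓡 d) (Sph d) (Sph d) ∞ where
  toFun u := sphereProj (displaced τ σ (ε, (u : Euc d)))
  invFun u := sphereProj (tiltedNormal Γ τ ζ (ε, (u : Euc d)))
  left_inv u := by
    have hu : (u : Euc d) ≠ 0 := ne_zero_of_mem_unit_sphere u
    have hy := hσ.displaced_ne_zero hτ hε hu
    have hinv := inv_pos.2 (norm_pos_iff.2 hy)
    simp only
    rw [coe_sphereProj hy, hζ.tiltedNormal_smul hΓ hε hy hinv, hσ.tiltedNormal_displaced hε hu,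
      sphereProj_smul hinv, sphereProj_smul (inv_pos.2 (norm_pos_iff.2 hu)), sphereProj_coe]
  right_inv u := by
    have hu : (u : Euc d) ≠ 0 := ne_zero_of_mem_unit_sphere u
    have hn := hσ.tiltedNormal_ne_zero hτ hε hu
    have hinv := inv_pos.2 (norm_pos_iff.2 hn)
    simp only
    rw [coe_sphereProj hn, hσ.displaced_smul hε hn hinv,
      hσ.displaced_tiltedNormal hζ hΓ hτ hε hu, sphereProj_smul hinv, sphereProj_coe]
  contMDiff_toFun := contMDiff_of_contMDiffOn_prod (hσ.contMDiffOn_sphereProj_displaced hτ) hε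
  contMDiff_invFun := contMDiff_of_contMDiffOn_prod (contMDiffOn_sphereProj_comp_coe_sphere
    (fun _ hq => (hζ.contDiffAt_tiltedNormal hΓ hq.1 hq.2).contDiffWithinAt)
    fun _ hε _ hu => hσ.tiltedNormal_ne_zero hτ hε hu) hε

end Tilt

section Tube

variable {d : ℕ} {T : Set (Euc d × ℝ)} {c : ℝ → Euc d} {α : Sph d × ℝ → Euc d} {z : ℝ}

theorem image_comp_sphereProj_sphere {F : Type*} (f : Sph d → F) :
    (fun y => f (sphereProj y)) '' Metric.sphere 0 1 = range f := by
  rw [image_eq_range]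
  simp only [sphereProj_coe]

theorem IsEmbeddingOnTube.injective_left (hX : IsEmbeddingOnTube (tubeMap c α)) (hz : z ∈ I) :
    Function.Injective fun u => α (u, z) := fun u v huv =>
  congrArg (fun q => q.1.1) <| hX.embedding.injective
    (a₁ := ⟨(u, z), trivial, hz⟩) (a₂ := ⟨(v, z), trivial, hz⟩)
    (Prod.ext (congrArg (c z + ·) huv) rfl)

theorem IsEmbeddingOnTube.fderiv_comp_sphereProj_ne_zero
    (hα : ContMDiffOn ((𝓡 d).prod 𝓘(ℝ, ℝ)) 𝓘(ℝ, Euc d) ∞ α (univ ×ˢ I))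
    (hX : IsEmbeddingOnTube (tubeMap c α)) (hz : z ∈ I) {u : Sph d} {w : Euc d}
    (hw : inner ℝ (u : Euc d) w = 0) (hw0 : w ≠ 0) :
    fderiv ℝ (fun y => α (sphereProj y, z)) u w ≠ 0 := by
  intro hzero
  have hXd : MDifferentiableAt ((𝓡 d).prod 𝓘(ℝ, ℝ)) 𝓘(ℝ, Euc d × ℝ) (tubeMap c α) (u, z) :=
    (hX.smooth.contMDiffAt ((isOpen_univ.prod isOpen_Ioo).mem_nhds ⟨trivial, hz⟩)
      ).mdifferentiableAt (by simp)
  have hαd : ContDiffAt ℝ ∞ (fun y => α (sphereProj y, z)) (u : Euc d) :=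
    ContDiffAt.comp (g := fun q : Euc d × ℝ => α (sphereProj q.1, q.2)) (f := fun y => (y, z))
      (u : Euc d) ((contDiffOn_comp_sphereProj hα).contDiffAt
        ((isOpen_compl_singleton.prod isOpen_Ioo).mem_nhds ⟨ne_zero_of_mem_unit_sphere u, hz⟩))
      (contDiffAt_id.prodMk contDiffAt_const)
  have hline : HasDerivAt (fun t : ℝ => α (sphereProj ((u : Euc d) + t • w), z)) 0 0 := by
    have h := (hαd.differentiableAt (by simp)).hasFDerivAt.hasLineDerivAt w
    rwa [hzero] at h
  exact ne_zero_of_hasDerivAt_comp_sphereProj hXd (hX.immersion (u, z) ⟨trivial, hz⟩) hw hw0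
    ((hline.const_add (c z)).prodMk (hasDerivAt_const (0 : ℝ) z)) rfl

theorem IsEmbeddingOnTube.isOvaloidFamily
    (hα : ContMDiffOn ((𝓡 d).prod 𝓘(ℝ, ℝ)) 𝓘(ℝ, Euc d) ∞ α (univ ×ˢ I))
    (hX : IsEmbeddingOnTube (tubeMap c α)) (hO : ∀ z ∈ I, IsOvaloid (range fun u => α (u, z))) :
    IsOvaloidFamily fun q : Euc d × ℝ => α (sphereProj q.1, q.2) where
  smooth := contDiffOn_comp_sphereProj hα
  inj z hz x hx y hy hxy := by
    have hproj : sphereProj x = sphereProj y := hX.injective_left hz hxy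
    rw [sphereProj_coe (⟨x, hx⟩ : Sph d), sphereProj_coe (⟨y, hy⟩ : Sph d)] at hproj
    exact congrArg Subtype.val hproj
  smul y z r hr := by simp only [sphereProj_smul hr]
  imm z hz y w hy :=
    hX.fderiv_comp_sphereProj_ne_zero hα hz (u := ⟨y, mem_sphere_zero_iff_norm.2 hy⟩)
  ovaloid z hz := by
    rw [image_comp_sphereProj_sphere fun u => α (u, z)]
    exact hO z hz

theorem horizontalSlice_tubeMap (hz : z ∈ I) :
    horizontalSlice (tubeMap c α '' (univ ×ˢ I)) z = (c z + ·) '' range fun u => α (u, z) := by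
  ext p
  simp only [horizontalSlice, tubeMap, mem_ofPred_eq, mem_image, mem_range,
    exists_exists_eq_and, Prod.exists, Prod.mk.injEq, mem_prod, mem_univ, true_and]
  constructor
  · rintro ⟨u, _, -, hp, rfl⟩
    exact ⟨u, hp⟩
  · rintro ⟨u, hp⟩
    exact ⟨u, z, hz, hp, rfl⟩

/-- The horizontal sections of the tube `T` over `I` are the hypersurfaces parametrized by the
support fields `Γ (·, z)`. -/
structure IsSupportFamilyOf (T : Set (Euc d × ℝ)) (Γ : Euc d × ℝ → Euc d) : Prop
    extends IsSupportFamily Γ where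
  horizontalSlice_eq : ∀ z ∈ I, horizontalSlice T z = range fun u : Sph d => Γ (u, z)
  snd_mem : ∀ q ∈ T, q.2 ∈ I

theorem IsTransverselyConvexTube.exists_isSupportFamilyOf (hT : IsTransverselyConvexTube T)
    (hbdd : Bornology.IsBounded T) : ∃ Γ, IsSupportFamilyOf T Γ := by
  obtain ⟨c, α, hc, hα, hX, hO, rfl⟩ := hT
  have hA := hX.isOvaloidFamily hα fun z hz => (hO z hz).1
  set A : Euc d × ℝ → Euc d := fun q => α (sphereProj q.1, q.2)
  have hfield (z : ℝ) (hz : z ∈ I) : IsSupportField fun u => c z + support A (u, z) :=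
    (hA.isSupportField_support hz).const_add (c z)
  have hslice (z : ℝ) (hz : z ∈ I) : horizontalSlice (tubeMap c α '' (univ ×ˢ I)) z =
      range fun u : Sph d => c z + support A (u, z) := by
    rw [horizontalSlice_tubeMap hz, ← image_comp_sphereProj_sphere fun u => α (u, z),
      ← hA.range_support hz, ← range_comp]
    rfl
  refine ⟨fun q => c q.2 + support A q, ⟨?_, fun u z t ht => ?_, hfield, ?_⟩, hslice, ?_⟩
  · rintro ⟨u, z⟩ ⟨hu, hz⟩
    have hcz : ContDiffAt ℝ ∞ (fun q : Euc d × ℝ => c q.2) (u, z) :=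
      ContDiffAt.comp (g := c) (f := fun q : Euc d × ℝ => q.2) (u, z)
        (hc.contDiffAt (isOpen_Ioo.mem_nhds hz)) contDiffAt_snd
    exact (hcz.add (hA.contDiffAt_support hu hz)).contDiffWithinAt
  · simp only [support, IsOvaloidFamily.top_smul A u z ht]
  · refine (Bornology.IsBounded.image_fst hbdd).subset ?_
    rintro _ ⟨⟨u, z⟩, ⟨hu, hz⟩, rfl⟩
    exact ⟨(_, z), (hslice z hz).ge ((hfield z hz).apply_mem_range hu), rfl⟩
  · rintro _ ⟨⟨_, z⟩, ⟨-, hz⟩, rfl⟩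
    exact hz

end Tube

namespace IsSupportFamilyOf

variable {d : ℕ} {T : Set (Euc d × ℝ)} {Γ : Euc d × ℝ → Euc d} {τ : Sph d} {z₀ z δ ε : ℝ}
  {ζ σ : ℝ × Euc d → ℝ}

theorem supportMap_eq (hΓ : IsSupportFamilyOf T Γ) (hd : 1 ≤ d) (hz : z ∈ I) (u : Sph d) :
    supportMap T u z = Γ (u, z) := by
  rw [supportMap, hΓ.horizontalSlice_eq z hz]
  exact (hΓ.isSupportField z hz).gaussInverse_eq hd u

theorem contMDiffOn_supportMap (hΓ : IsSupportFamilyOf T Γ) (hd : 1 ≤ d) :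
    ContMDiffOn ((𝓡 d).prod 𝓘(ℝ, ℝ)) 𝓘(ℝ, Euc d) ∞
      (fun q : Sph d × ℝ => supportMap T q.1 q.2) (univ ×ˢ I) := by
  have hcoe : ContMDiff ((𝓡 d).prod 𝓘(ℝ, ℝ)) 𝓘(ℝ, Euc d × ℝ) ∞
      (fun q : Sph d × ℝ => ((q.1 : Euc d), q.2)) :=
    (contMDiff_coe_sph.comp contMDiff_fst).prodMk_space contMDiff_snd
  exact (hΓ.smooth.contMDiffOn.comp hcoe.contMDiffOn fun q hq =>
    ⟨ne_zero_of_mem_unit_sphere q.1, hq.2⟩).congr fun q hq => hΓ.supportMap_eq hd hq.2 q.1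

theorem isSupportParametrization_supportMap (hΓ : IsSupportFamilyOf T Γ) (hd : 1 ≤ d)
    (hz : z ∈ I) :
    IsSupportParametrization (fun u => supportMap T u z) (horizontalSlice T z) := by
  rw [hΓ.horizontalSlice_eq z hz, funext (hΓ.supportMap_eq hd hz)]
  exact (hΓ.isSupportField z hz).isSupportParametrization hd

theorem deriv_supportMap (hΓ : IsSupportFamilyOf T Γ) (hd : 1 ≤ d) (hz : z ∈ I) (u : Sph d) :
    deriv (fun z => supportMap T u z) z = fderiv ℝ Γ ((u : Euc d), z) (0, 1) := by
  rw [← (hΓ.hasDerivAt (ne_zero_of_mem_unit_sphere u) hz).deriv]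
  refine EventuallyEq.deriv_eq ?_
  filter_upwards [isOpen_Ioo.mem_nhds hz] with x hx using hΓ.supportMap_eq hd hx u

theorem isHeightFunction (hΓ : IsSupportFamilyOf T Γ) (hd : 1 ≤ d)
    (hζ : IsTiltedHeight Γ τ z₀ δ ζ) (hδ : 0 < δ) :
    IsHeightFunction T τ z₀ δ fun ε u => ζ (ε, u) where
  smooth := contMDiffOn_comp_coe_sphere hζ.smooth
  zero u := hζ.apply_zero hδ (ne_zero_of_mem_unit_sphere u)
  mem ε hε u := hζ.mem ε hε u (ne_zero_of_mem_unit_sphere u)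
  solves_iff ε hε u z hz := by
    rw [← hζ.solves_iff ε hε u (ne_zero_of_mem_unit_sphere u) z hz, hΓ.supportMap_eq hd hz,
      sub_sub, sub_eq_zero]

theorem projectedSlice_eq_range (hΓ : IsSupportFamilyOf T Γ) (hζ : IsTiltedHeight Γ τ z₀ δ ζ)
    (hσ : IsTilt Γ τ ζ δ σ) (hε : ε ∈ Ioo (-δ) δ) :
    projectedSlice T τ z₀ ε = range fun u : Sph d => tiltedSupport Γ τ ζ σ (ε, u) := by
  have hτ : ‖(τ : Euc d)‖ = 1 := norm_eq_of_mem_sphere τ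
  ext p
  constructor
  · rintro ⟨⟨p, z⟩, ⟨hpT, hpz : z = ε * inner ℝ p (τ : Euc d) + z₀⟩, rfl⟩
    have hz : z ∈ I := hΓ.snd_mem _ hpT
    obtain ⟨u, rfl⟩ := (hΓ.horizontalSlice_eq z hz).le hpT
    have hu : (u : Euc d) ≠ 0 := ne_zero_of_mem_unit_sphere u
    have hzζ : z = ζ (ε, u) :=
      (hζ.solves_iff ε hε u hu z hz).1 (by rwa [real_inner_comm, add_comm])
    have hn := hσ.tiltedNormal_ne_zero hτ hε hu
    have hinv := inv_pos.2 (norm_pos_iff.2 hn)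
    refine ⟨sphereProj (tiltedNormal Γ τ ζ (ε, u)), ?_⟩
    simp only [tiltedSupport]
    rw [coe_sphereProj hn, hσ.displaced_smul hε hn hinv,
      hσ.displaced_tiltedNormal hζ hΓ.toIsSupportFamily hτ hε hu, hζ.smul ε hε u hu _ hinv,
      hΓ.smul _ _ _ hinv, ← hzζ]
  · rintro ⟨u, rfl⟩
    have hu : (u : Euc d) ≠ 0 := ne_zero_of_mem_unit_sphere u
    have hy := hσ.displaced_ne_zero hτ hε hu
    have hz := hζ.mem ε hε _ hy
    refine ⟨(_, ζ (ε, displaced τ σ (ε, u))), ⟨?_, ?_⟩, rfl⟩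
    · exact (hΓ.horizontalSlice_eq _ hz).ge ((hΓ.isSupportField _ hz).apply_mem_range hy)
    · change ζ (ε, displaced τ σ (ε, u)) =
        ε * inner ℝ (tiltedSupport Γ τ ζ σ (ε, u)) (τ : Euc d) + z₀
      rw [real_inner_comm]
      exact (hζ.apply_eq hε hy).trans (add_comm _ _)

theorem isSupportParametrization_projectedSlice (hΓ : IsSupportFamilyOf T Γ) (hd : 1 ≤ d)
    (hζ : IsTiltedHeight Γ τ z₀ δ ζ) (hσ : IsTilt Γ τ ζ δ σ) (hε : ε ∈ Ioo (-δ) δ)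
    (hfield : IsSupportField fun u => tiltedSupport Γ τ ζ σ (ε, u)) {θ : Sph d → Sph d}
    (hθ : ∀ u : Sph d, θ u = sphereProj (displaced τ σ (ε, (u : Euc d)))) :
    IsSupportParametrization (fun u => supportMap T (θ u) (ζ (ε, (θ u : Euc d))))
      (projectedSlice T τ z₀ ε) := by
  have hsupport (u : Sph d) :
      supportMap T (θ u) (ζ (ε, (θ u : Euc d))) = tiltedSupport Γ τ ζ σ (ε, u) := by
    have hy := hσ.displaced_ne_zero (norm_eq_of_mem_sphere τ) hε (ne_zero_of_mem_unit_sphere u)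
    have hinv := inv_pos.2 (norm_pos_iff.2 hy)
    rw [hΓ.supportMap_eq hd (hζ.mem ε hε _ (ne_zero_of_mem_unit_sphere _)), hθ u,
      coe_sphereProj hy, hζ.smul ε hε _ hy _ hinv, hΓ.smul _ _ _ hinv, tiltedSupport]
  rw [funext hsupport, hΓ.projectedSlice_eq_range hζ hσ hε]
  exact hfield.isSupportParametrization hd

end IsSupportFamilyOf

theorem IsSupportFamily.exists_isTilt {d : ℕ} {Γ : Euc d × ℝ → Euc d} {τ : Euc d} {z₀ : ℝ}
    (hΓ : IsSupportFamily Γ) (hτ : ‖τ‖ = 1) (hz₀ : z₀ ∈ I) :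
    ∃ δ, 0 < δ ∧ ∃ ζ σ, IsTiltedHeight Γ τ z₀ δ ζ ∧ IsTilt Γ τ ζ δ σ ∧
      ∀ ε ∈ Ioo (-δ) δ, IsSupportField fun u => tiltedSupport Γ τ ζ σ (ε, u) := by
  obtain ⟨δ₁, hδ₁, ζ, hζ⟩ := hΓ.exists_isTiltedHeight hτ hz₀
  obtain ⟨δ₂, hδ₂, hδ₂₁, σ, hσ⟩ := hζ.exists_isTilt hΓ hδ₁ hτ
  obtain ⟨δ, hδ, hδ₂', hfield⟩ :=
    hσ.exists_isSupportField_tiltedSupport (hζ.mono hδ₂₁) hΓ hτ hδ₂ hz₀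
  exact ⟨δ, hδ, ζ, σ, hζ.mono (hδ₂'.trans hδ₂₁), hσ.mono hδ₂', hfield⟩

section Sphere

variable {d : ℕ} {Γ : Euc d × ℝ → Euc d} {τ : Sph d} {z₀ δ : ℝ} {ζ σ : ℝ × Euc d → ℝ}

theorem IsTilt.exists_diffeomorph (hσ : IsTilt Γ τ ζ δ σ) (hζ : IsTiltedHeight Γ τ z₀ δ ζ)
    (hΓ : IsSupportFamily Γ) :
    ∃ θ : ℝ → Diffeomorph (𝓡 d) (𝓡 d) (Sph d) (Sph d) ∞, ∀ ε ∈ Ioo (-δ) δ, ∀ u : Sph d,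
      θ ε u = sphereProj (displaced τ σ (ε, (u : Euc d))) := by
  classical
  refine ⟨fun ε => if hε : ε ∈ Ioo (-δ) δ then
    tiltDiffeomorph hσ hζ hΓ (norm_eq_of_mem_sphere τ) hε else Diffeomorph.refl _ _ _,
    fun ε hε u => ?_⟩
  simp only [dif_pos hε]
  rfl

theorem IsTilt.displaced_zero_coe_sphere (hσ : IsTilt Γ τ ζ δ σ) (hδ : 0 < δ) (u : Sph d) :
    displaced τ σ (0, (u : Euc d)) = u := by
  rw [hσ.displaced_zero hδ (ne_zero_of_mem_unit_sphere u), norm_eq_of_mem_sphere, inv_one,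
    one_smul]

theorem IsTilt.hasDerivAt_sphereProj_displaced (hσ : IsTilt Γ τ ζ δ σ)
    (hζ : IsTiltedHeight Γ τ z₀ δ ζ) (hΓ : IsSupportFamily Γ) (hδ : 0 < δ) (u : Sph d) :
    HasDerivAt (fun ε => (sphereProj (displaced τ σ (ε, (u : Euc d))) : Euc d))
      (inner ℝ (u : Euc d) (fderiv ℝ Γ ((u : Euc d), z₀) (0, 1)) • tangentialPart τ u) 0 := by
  refine (hasDerivAt_coe_sphereProj_comp (hσ.hasDerivAt_displaced hζ hΓ hδ
    (norm_eq_of_mem_sphere u)) (hσ.displaced_zero_coe_sphere hδ u)).congr_deriv ?_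
  rw [tangentialPart, real_inner_smul_left, smul_sub, smul_smul]

end Sphere

end ConvexTube

theorem mainTheorem8 (d : ℕ) (hd : 1 ≤ d) (T : Set (Euc d × ℝ))
    (hT : IsTransverselyConvexTube T) (hbdd : Bornology.IsBounded T) :
    -- the support map is well defined and smooth
    ContMDiffOn ((𝓡 d).prod 𝓘(ℝ, ℝ)) 𝓘(ℝ, Euc d) ∞
      (fun q : Sph d × ℝ => supportMap T q.1 q.2) (Set.univ ×ˢ I) ∧
    (∀ z ∈ I, IsSupportParametrization (fun u => supportMap T u z) (horizontalSlice T z)) ∧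
    ∀ z₀ ∈ I, ∀ τ : Sph d,
      ∃ δ : ℝ, 0 < δ ∧
      ∃ ζ : ℝ → Sph d → ℝ, IsHeightFunction T τ z₀ δ ζ ∧
      ∃ θ : ℝ → Diffeomorph (𝓡 d) (𝓡 d) (Sph d) (Sph d) ∞,
        ContMDiffOn (𝓘(ℝ, ℝ).prod (𝓡 d)) (𝓡 d) ∞
          (fun q : ℝ × Sph d => θ q.1 q.2) (Set.Ioo (-δ) δ ×ˢ Set.univ) ∧
        (∀ ε ∈ Set.Ioo (-δ) δ, IsSupportParametrization
          (fun u => supportMap T (θ ε u) (ζ ε (θ ε u))) (projectedSlice T τ z₀ ε)) ∧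
        (∀ u, θ 0 u = u) ∧
        ∀ u : Sph d, HasDerivAt (fun ε => (θ ε u : Euc d))
          (inner ℝ (u : Euc d) (deriv (fun z => supportMap T u z) z₀) • tangentialPart τ u) 0 := by
  obtain ⟨Γ, hΓ⟩ := hT.exists_isSupportFamilyOf hbdd
  refine ⟨hΓ.contMDiffOn_supportMap hd,
    fun z hz => hΓ.isSupportParametrization_supportMap hd hz, fun z₀ hz₀ τ => ?_⟩
  have hτ : ‖(τ : Euc d)‖ = 1 := norm_eq_of_mem_sphere τ
  obtain ⟨δ, hδ, ζ, σ, hζ, hσ, hfield⟩ := hΓ.exists_isTilt hτ hz₀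
  obtain ⟨θ, hθ⟩ := hσ.exists_diffeomorph hζ hΓ.toIsSupportFamily
  have h0 : (0 : ℝ) ∈ Set.Ioo (-δ) δ := zero_mem_Ioo_neg hδ
  refine ⟨δ, hδ, fun ε u => ζ (ε, u), hΓ.isHeightFunction hd hζ hδ, θ, ?_, fun ε hε => ?_,
    fun u => ?_, fun u => ?_⟩
  · exact (hσ.contMDiffOn_sphereProj_displaced hτ).congr fun q hq => hθ q.1 hq.1 q.2
  · exact hΓ.isSupportParametrization_projectedSlice hd hζ hσ hε (hfield ε hε) (hθ ε hε)
  · rw [hθ 0 h0, hσ.displaced_zero_coe_sphere hδ, sphereProj_coe]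
  · rw [hΓ.deriv_supportMap hd hz₀]
    refine (hσ.hasDerivAt_sphereProj_displaced hζ hΓ.toIsSupportFamily hδ u
      ).congr_of_eventuallyEq ?_
    filter_upwards [Ioo_mem_nhds h0.1 h0.2] with ε hε
    rw [hθ ε hε]
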